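/- Let $\mathcal A\subset\mathbb R^n$ be a finite set of nonzero, pairwise noncolinear vectors $\alpha$ with multiplicities $m_\alpha\in\mathbb Z_{\ge 0}$. Write $(x,y)=\sum_j x_jy_j$ and $x^2=(x,x)$ for $x,y\in\mathbb C^n$, and put $A_m(x)=\prod_{\alpha\in\mathcal A}(x,\alpha)^{m_\alpha}$, $|m|=\sum_{\alpha\in\mathcal A} m_\alpha$, $\Pi_\alpha=\{x\in\mathbb R^n:(x,\alpha)=0\}$, $\partial_\alpha=(\alpha,\partial/\partial x)$. Let $\phi(x,\lambda)$, $x,\lambda\in\mathbb C^n$, be a Baker–Akhiezer function associated to $\mathcal A$; that is: 1. for every $\lambda$, $\phi(x,\lambda)=P(x,\lambda)e^{(x,\lambda)}$, where $P(\cdot,\lambda)$ is a polynomial in $x$ of degree at most $|m|$ whose homogeneous part of degree $|m|$ is $A_m(x)A_m(\lambda)$; 2. for every $\lambda$ and every $\alpha\in\mathcal A$, $\partial_\alpha\phi(x,\lambda)=\partial_\alpha^3\phi(x,\lambda)=\cdots=\partial_\alpha^{2m_\alpha-1}\phi(x,\lambda)=0$ for all $x\in\Pi_\alpha$; 3. for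 every $x$, $\phi(x,\lambda)$ depends continuously on $\lambda$. Assume that $\phi(0,0)\neq 0$. Then for every $\xi\in\mathbb R^n\setminus\bigcup_{\alpha\in\mathcal A}\Pi_\alpha$ the integral below converges absolutely, and $$\phi(0,0)=\left(\int_{i\xi+\mathbb R^n}\frac{d\gamma(x)}{A_m(x)^2}\right)^{-1},\qquad d\gamma(x)=(2\pi)^{-n/2}e^{-x^2/2}\,dx .$$ -/

import Mathlib

open MeasureTheory

noncomputable section

namespace BakerAkhiezer

/-- The inclusion of `ℝⁿ` in `ℂⁿ`. -/
def toComplex {n : ℕ} (v : Fin n → ℝ) : Fin n → ℂ := fun i => (v i : ℂ)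

/-- A finite collection of pairwise noncolinear (nonzero) vectors in `ℝⁿ`, each with a
multiplicity. Only the values of `mult` on `vectors` matter. -/
structure Configuration (n : ℕ) where
  vectors : Finset (Fin n → ℝ)
  mult : (Fin n → ℝ) → ℕ
  ne_zero : ∀ α ∈ vectors, α ≠ 0
  noncolinear : ∀ α ∈ vectors, ∀ β ∈ vectors, α ≠ β → LinearIndependent ℝ ![α, β]

namespace Configuration

variable {n : ℕ} (A : Configuration n)

/-- `|m|`, the sum of all multiplicities. -/
def totalMult : ℕ := ∑ α ∈ A.vectors, A.mult α

/-- `A_m(x) = ∏ (x, α) ^ m_α` for `x` in `ℂⁿ`; the pairing is the complex bilinear extension of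
the standard inner product. -/
def Am (x : Fin n → ℂ) : ℂ := ∏ α ∈ A.vectors, (x ⬝ᵥ toComplex α) ^ A.mult α

/-- `A_m` as a polynomial in `x`. -/
def AmPoly : MvPolynomial (Fin n) ℂ :=
  ∏ α ∈ A.vectors, (∑ i, MvPolynomial.X i * MvPolynomial.C (α i : ℂ)) ^ A.mult α

theorem eval_AmPoly (x : Fin n → ℂ) : MvPolynomial.eval x A.AmPoly = A.Am x := by
  simp [AmPoly, Am, dotProduct, toComplex, map_prod, map_sum]

end Configuration

/-- The `k`-th directional derivative `(∂_α)^k f (x)`, where `∂_α = (α, ∂/∂x)`, of a function on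
`ℂⁿ`: the `k`-th derivative at `t = 0` of `t ↦ f (x + t α)`. -/
def dirDeriv {n : ℕ} (α : Fin n → ℝ) (k : ℕ) (f : (Fin n → ℂ) → ℂ) (x : Fin n → ℂ) : ℂ :=
  iteratedDeriv k (fun t : ℂ => f (x + t • toComplex α)) 0

/-- `φ(x, l)` is a (rational) Baker-Akhiezer function of the configuration `A`. -/
structure IsBakerAkhiezer {n : ℕ} (A : Configuration n)
    (φ : (Fin n → ℂ) → (Fin n → ℂ) → ℂ) : Prop where
  /-- `φ(x, l) = P(x, l) exp (x, l)` with `P` a polynomial in `x` of degree at most `|m|` whose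
  homogeneous part of degree `|m|` is `A_m(x) A_m(l)`. -/
  form : ∀ l : Fin n → ℂ, ∃ P : MvPolynomial (Fin n) ℂ,
    P.totalDegree ≤ A.totalMult ∧
    MvPolynomial.homogeneousComponent A.totalMult P = MvPolynomial.C (A.Am l) * A.AmPoly ∧
    ∀ x, φ x l = MvPolynomial.eval x P * Complex.exp (x ⬝ᵥ l)
  /-- `∂_α φ = ∂_α³ φ = ⋯ = ∂_α^(2 m_α - 1) φ = 0` on the hyperplane `(x, α) = 0` of `ℝⁿ`
  (the odd orders are `2 s + 1` with `s < m_α`). -/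
  quasi : ∀ l : Fin n → ℂ, ∀ α ∈ A.vectors, ∀ s < A.mult α, ∀ x : Fin n → ℝ, x ⬝ᵥ α = 0 →
    dirDeriv α (2 * s + 1) (fun y => φ y l) (toComplex x) = 0
  /-- `φ` depends continuously on the spectral parameter `l`. Without this, the two conditions above
  do not determine `φ(·, l)` for the exceptional `l` with `A_m(l) = 0`, such as `l = 0`. -/
  continuous_param : ∀ x : Fin n → ℂ, Continuous (fun l => φ x l)

/-- The point `y + i ξ` of the affine subspace `i ξ + ℝⁿ` of `ℂⁿ`. -/
def shift {n : ℕ} (ξ y : Fin n → ℝ) : Fin n → ℂ := toComplex y + Complex.I • toComplex ξ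

/-- The density `(2π)^(-n/2) exp (-x²/2)`, `x² = x₁² + ⋯ + xₙ²`, of the Gaussian measure `dγ(x)`
with respect to `dx`, at `x` in `ℂⁿ`. -/
def gaussianDensity {n : ℕ} (x : Fin n → ℂ) : ℂ :=
  (((2 * Real.pi) ^ (-(n : ℝ) / 2) : ℝ) : ℂ) * Complex.exp (-(x ⬝ᵥ x) / 2)

/-- `F` is absolutely integrable over `i ξ + ℝⁿ` with respect to `γ`. -/
def GaussianIntegrable {n : ℕ} (ξ : Fin n → ℝ) (F : (Fin n → ℂ) → ℂ) : Prop :=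
  Integrable (fun y : Fin n → ℝ => F (shift ξ y) * gaussianDensity (shift ξ y)) volume

/-- `∫ F(x) dγ(x)` over `i ξ + ℝⁿ`. -/
def gaussianIntegral {n : ℕ} (ξ : Fin n → ℝ) (F : (Fin n → ℂ) → ℂ) : ℂ :=
  ∫ y : Fin n → ℝ, F (shift ξ y) * gaussianDensity (shift ξ y)

end BakerAkhiezer

end

/-! Write `φ(x, l) = P(x, l) exp (x, l)` and `N = |m|`. The algebraic half turns `φ` into a solution
of a differential equation. A quasi-invariant polynomial times `exp (x, l)` with `A_m(l) ≠ 0` has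
leading part divisible by `A_m` (`Quasi.AmPoly_dvd`), so one of degree at most `N` is determined by
its part of degree `N` (`Quasi.eq_zero`). By Cramer's rule the coefficients of `P` are then rational
in `l`; continuity makes them polynomial, and uniqueness under scaling makes `P` a sum of products
of forms of equal degree in `x` and `l`, with top term `A_m(x) A_m(l)`
(`IsBakerAkhiezer.exists_biPoly`).

Let `T_x` be `A_m(x) (Δ_x - ∑ 2 m_α (x, α)⁻¹ ∂_α - l²)`, and let `T_l` be the same with `x` and `l`
exchanged. `T_l` preserves quasi-invariance in `x`, so `T_l φ = κ(l) φ`; at `x = 0` the factor `P`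
is the constant `φ(0, 0) ≠ 0`, which forces `κ = 0`. The commutator of `T_x` and `T_l` is a multiple
of the difference of the two Euler operators and kills `P`, so `T_x φ` also solves the equation in
`l`. Uniqueness for that equation (`eq_zero_of_eigen`) and evaluation at `l = 0` give `T_x φ = 0`.

The analytic half takes `l = ξ` and studies `J(s) = ∫ φ(s z, ξ) A_m(z)⁻² dγ(z)` over `z ∈ i ξ + ℝⁿ`.
Integration by parts and `T_x φ = 0` give `J'(s) = s ξ² J(s)` (`integral_euler_scaledExp`), so `exp
(-s² ξ² / 2) J(s)` is constant. Translating by `s ξ` completes the square, and as `s → ∞` only the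
top term of `P` survives against `A_m⁻²`, so the constant is `1`
(`tendsto_integral_blowupIntegrand`). Finally `J(0) = φ(0, 0) ∫ A_m⁻² dγ`. -/

noncomputable section

namespace BakerAkhiezer

open MvPolynomial Filter Topology

/-! ### Divisibility by powers of real linear forms -/

section LinearForms

variable {n : ℕ}

/-- The linear form `(x, α)` as a polynomial in `x`. -/
def linForm (α : Fin n → ℝ) : MvPolynomial (Fin n) ℂ := ∑ i, X i * C (α i : ℂ)

theorem eval_linForm (α : Fin n → ℝ) (x : Fin n → ℂ) :
    eval x (linForm α) = x ⬝ᵥ toComplex α := by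
  simp [linForm, dotProduct, toComplex]

theorem toComplex_dotProduct (y α : Fin n → ℝ) :
    toComplex y ⬝ᵥ toComplex α = ((y ⬝ᵥ α : ℝ) : ℂ) := by
  simp [dotProduct, toComplex]

theorem isHomogeneous_linForm (α : Fin n → ℝ) : (linForm α).IsHomogeneous 1 := by
  refine IsHomogeneous.sum _ _ _ fun i _ => ?_
  simpa using (isHomogeneous_X ℂ i).mul (isHomogeneous_C (Fin n) (α i : ℂ))

theorem dotProduct_self_ne_zero {α : Fin n → ℝ} (hα : α ≠ 0) : α ⬝ᵥ α ≠ 0 := fun h =>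
  hα (dotProduct_self_eq_zero.1 h)

theorem eq_zero_of_eval_toComplex {p : MvPolynomial (Fin n) ℂ}
    (h : ∀ y : Fin n → ℝ, eval (toComplex y) p = 0) : p = 0 := by
  have hinf : (Set.range ((↑) : ℝ → ℂ)).Infinite :=
    Set.infinite_range_of_injective Complex.ofReal_injective
  refine funext_set (fun _ => Set.range ((↑) : ℝ → ℂ)) (fun _ => hinf) fun x hx => ?_
  choose y hy using fun i => hx i (Set.mem_univ i)
  rw [map_zero, ← h y]
  congr 1
  congr 1
  ext i
  simp [toComplex, hy]

theorem linForm_ne_zero {α : Fin n → ℝ} (hα : α ≠ 0) : linForm α ≠ 0 := by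
  intro h
  have := eval_linForm α (toComplex α)
  rw [h, map_zero, toComplex_dotProduct] at this
  exact dotProduct_self_ne_zero hα (by exact_mod_cast this.symm)

/-- A polynomial vanishing on the real hyperplane `(x, α) = 0` is divisible by `(x, α)`. -/
theorem linForm_dvd_of_eval_eq_zero {α : Fin n → ℝ} (hα : α ≠ 0) {g : MvPolynomial (Fin n) ℂ}
    (h : ∀ y : Fin n → ℝ, y ⬝ᵥ α = 0 → eval (toComplex y) g = 0) : linForm α ∣ g := by
  set c : ℝ := α ⬝ᵥ α with hc
  have hc0 : c ≠ 0 := dotProduct_self_ne_zero hα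
  -- Composition with the orthogonal projection onto the hyperplane. It kills `g`, yet it is the
  -- identity modulo `(x, α)`, so `g` is zero modulo `(x, α)`.
  let σ : MvPolynomial (Fin n) ℂ →ₐ[ℂ] MvPolynomial (Fin n) ℂ :=
    aeval fun i => X i - linForm α * C ((α i / c : ℝ) : ℂ)
  have hσ : σ g = 0 := by
    apply eq_zero_of_eval_toComplex
    intro y
    have h1 : eval (toComplex y) (σ g) = eval (toComplex (y - ((y ⬝ᵥ α) / c) • α)) g := by
      rw [← aeval_eq_eval, ← aeval_eq_eval, ← AlgHom.coe_toRingHom, ← AlgHom.coe_toRingHom]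
      change ((aeval (toComplex y)).comp σ) g = _
      congr 1
      ext i
      simp [σ, eval_linForm, toComplex_dotProduct, toComplex]
      ring
    rw [h1]
    apply h
    rw [sub_dotProduct, smul_dotProduct, ← hc, smul_eq_mul]
    field_simp
    ring
  rw [← Ideal.mem_span_singleton, ← Ideal.Quotient.eq_zero_iff_mem]
  have : (Ideal.Quotient.mkₐ ℂ (Ideal.span {linForm α})).comp σ =
      Ideal.Quotient.mkₐ ℂ (Ideal.span {linForm α}) := by
    ext i
    have h0 : Ideal.Quotient.mk (Ideal.span {linForm α}) (linForm α) = 0 :=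
      Ideal.Quotient.eq_zero_iff_mem.2 (Ideal.mem_span_singleton_self _)
    simp [σ, h0]
  have h2 := DFunLike.congr_fun this g
  simp only [AlgHom.comp_apply, hσ, map_zero] at h2
  exact h2.symm

theorem irreducible_linForm {α : Fin n → ℝ} (hα : α ≠ 0) : Irreducible (linForm α) := by
  refine irreducible_of_totalDegree_eq_one
    ((isHomogeneous_linForm α).totalDegree (linForm_ne_zero hα)) fun x hx => ?_
  rw [isUnit_iff_ne_zero]
  rintro rfl
  exact linForm_ne_zero hα (by ext i; simpa using hx i)

theorem isRelPrime_linForm {α β : Fin n → ℝ} (hα : α ≠ 0) (h : LinearIndependent ℝ ![α, β]) :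
    IsRelPrime (linForm α) (linForm β) := by
  rw [(irreducible_linForm hα).isRelPrime_iff_not_dvd]
  rintro ⟨g, hg⟩
  set c : ℝ := α ⬝ᵥ α with hc
  have hc0 : c ≠ 0 := dotProduct_self_ne_zero hα
  -- The component of `β` orthogonal to `α`. Divisibility makes `(y, β)` vanish as well, hence `(y,
  -- y) = 0`, and `y = 0` contradicts independence.
  set y : Fin n → ℝ := β - ((β ⬝ᵥ α) / c) • α with hy
  have hyα : y ⬝ᵥ α = 0 := by
    rw [hy, sub_dotProduct, smul_dotProduct, ← hc, smul_eq_mul]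
    field_simp
    ring
  have hyβ : y ⬝ᵥ β = 0 := by
    have := congrArg (eval (toComplex y)) hg
    rw [map_mul, eval_linForm, eval_linForm, toComplex_dotProduct, toComplex_dotProduct, hyα] at this
    simpa using this
  have hyy : y ⬝ᵥ y = 0 := by
    nth_rw 2 [hy]
    rw [dotProduct_sub, dotProduct_smul, hyα, hyβ]
    simp
  have hy0 : y = 0 := dotProduct_self_eq_zero.1 hyy
  have := LinearIndependent.pair_iff.1 h (-((β ⬝ᵥ α) / c)) 1 (by
    rw [one_smul, neg_smul, neg_add_eq_sub]; exact hy0)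
  exact one_ne_zero this.2

/-- The derivation `∂_α` of the polynomial ring. -/
def dirD (α : Fin n → ℝ) : Derivation ℂ (MvPolynomial (Fin n) ℂ) (MvPolynomial (Fin n) ℂ) :=
  ∑ i, (α i : ℂ) • pderiv i

theorem dirD_apply (α : Fin n → ℝ) (p : MvPolynomial (Fin n) ℂ) :
    dirD α p = ∑ i, (α i : ℂ) • pderiv i p := by
  have := map_sum (Derivation.coeFnAddMonoidHom (R := ℂ) (A := MvPolynomial (Fin n) ℂ)
    (M := MvPolynomial (Fin n) ℂ)) (fun i => (α i : ℂ) • pderiv i) Finset.univ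
  have h := congrFun this p
  rw [Finset.sum_apply] at h
  exact h

theorem dirD_linForm (α : Fin n → ℝ) : dirD α (linForm α) = C ((α ⬝ᵥ α : ℝ) : ℂ) := by
  classical
  rw [dirD_apply]
  have : ∀ i, pderiv i (linForm α) = C (α i : ℂ) := by
    intro i
    simp [linForm, pderiv_X, Pi.single_apply]
  simp only [this, smul_eq_C_mul, ← C_mul, dotProduct, Complex.ofReal_sum, map_sum, Complex.ofReal_mul]

/-- Leibniz rule, where only the first derivative of the linear form is a nonzero constant. The
truncated `j - 1` at `j = 0` is harmless because of the factor `j`. -/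
theorem iterate_dirD_linForm_mul (α : Fin n → ℝ) (h : MvPolynomial (Fin n) ℂ) (j : ℕ) :
    (dirD α)^[j] (linForm α * h) = linForm α * (dirD α)^[j] h +
      (j : ℂ) • (((α ⬝ᵥ α : ℝ) : ℂ) • (dirD α)^[j - 1] h) := by
  induction j with
  | zero => simp
  | succ j ih =>
    rw [Function.iterate_succ_apply', ih, map_add, Derivation.leibniz, dirD_linForm,
      Derivation.map_smul, Derivation.map_smul]
    rcases j with _ | j
    · simp [smul_eq_C_mul, mul_comm]
    · simp only [Nat.add_sub_cancel, ← Function.iterate_succ_apply' (f := dirD α)]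
      simp only [smul_eq_C_mul, smul_eq_mul]
      push_cast
      simp only [map_add, map_natCast, map_one]
      ring

/-- If `g = (x, α) h`, then on the hyperplane `∂_α^(j+1) g` equals `(j + 1) (α, α) ∂_α^j h`, so `h`
satisfies the hypotheses with one derivative fewer. -/
theorem linForm_pow_dvd {α : Fin n → ℝ} (hα : α ≠ 0) (m : ℕ) : ∀ g : MvPolynomial (Fin n) ℂ,
    (∀ j < m, ∀ y : Fin n → ℝ, y ⬝ᵥ α = 0 → eval (toComplex y) ((dirD α)^[j] g) = 0) →
    linForm α ^ m ∣ g := by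
  induction m with
  | zero => simp
  | succ m ih =>
    intro g hg
    obtain ⟨h, rfl⟩ := linForm_dvd_of_eval_eq_zero hα (hg 0 m.succ_pos)
    rw [pow_succ']
    refine mul_dvd_mul_left _ (ih h fun j hj y hy => ?_)
    have := hg (j + 1) (by omega) y hy
    rw [iterate_dirD_linForm_mul, map_add, map_mul, eval_linForm, toComplex_dotProduct, hy] at this
    simp only [Complex.ofReal_zero, zero_mul, zero_add, smul_eval, Nat.add_sub_cancel] at this
    have hc := dotProduct_self_ne_zero hα
    have h2 : ((j + 1 : ℕ) : ℂ) ≠ 0 := Nat.cast_ne_zero.2 j.succ_ne_zero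
    have h3 : ((α ⬝ᵥ α : ℝ) : ℂ) ≠ 0 := by exact_mod_cast hc
    exact (mul_eq_zero.1 ((mul_eq_zero.1 this).resolve_left h2)).resolve_left h3

end LinearForms

/-- A combination of `m` binomial polynomials `binom(z, k)`, `k < m`, with zeros at
`1, 3, …, 2m - 1` is trivial. -/
theorem eq_zero_of_sum_choose_eq_zero (m : ℕ) (b : ℕ → ℂ)
    (h : ∀ s < m, ∑ k ∈ Finset.range m, b k * ((2 * s + 1).choose k : ℂ) = 0) :
    ∀ k < m, b k = 0 := by
  -- `B(z) = ∑ b_k binom(z, k)` has degree below `m` and `m` distinct roots, hence vanishes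
  -- identically.
  let B : Polynomial ℂ := ∑ k ∈ Finset.range m,
    Polynomial.C (b k / (k.factorial : ℂ)) * descPochhammer ℂ k
  have hB : ∀ N : ℕ, B.eval (N : ℂ) = ∑ k ∈ Finset.range m, b k * (N.choose k : ℂ) := by
    intro N
    simp only [B, Polynomial.eval_finsetSum, Polynomial.eval_mul, Polynomial.eval_C]
    refine Finset.sum_congr rfl fun k _ => ?_
    rw [descPochhammer_eval_eq_descFactorial, Nat.descFactorial_eq_factorial_mul_choose]
    have : (k.factorial : ℂ) ≠ 0 := Nat.cast_ne_zero.2 k.factorial_ne_zero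
    push_cast
    field_simp
  have hB0 : B = 0 := by
    rcases m.eq_zero_or_pos with rfl | hm
    · simp [B]
    by_contra hne
    have hdeg : B.natDegree < m := by
      refine lt_of_le_of_lt (Polynomial.natDegree_sum_le_of_forall_le (n := m - 1) _ _ fun k hk => ?_)
        (by omega)
      refine (Polynomial.natDegree_C_mul_le _ _).trans ?_
      rw [descPochhammer_natDegree]
      have := Finset.mem_range.1 hk
      omega
    refine hne (Polynomial.eq_zero_of_natDegree_lt_card_of_eval_eq_zero' B
      ((Finset.range m).image fun s => ((2 * s + 1 : ℕ) : ℂ)) ?_ ?_)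
    · intro z hz
      obtain ⟨s, hs, rfl⟩ := Finset.mem_image.1 hz
      rw [hB, h s (Finset.mem_range.1 hs)]
    · rw [Finset.card_image_of_injective, Finset.card_range]
      · exact hdeg
      · intro s t hst
        have : 2 * s + 1 = 2 * t + 1 := Nat.cast_injective (R := ℂ) hst
        omega
  -- Evaluation of `B = 0` at `z = k` involves only `b_0, …, b_k`: the system is unitriangular.
  intro k
  induction k using Nat.strong_induction_on with
  | _ k ih =>
    intro hk
    have := hB k
    rw [hB0, Polynomial.eval_zero, Finset.sum_eq_single k] at this
    · simpa using this.symm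
    · intro j hj hjk
      rcases lt_or_gt_of_ne hjk with hlt | hgt
      · rw [ih j hlt (Finset.mem_range.1 hj), zero_mul]
      · rw [Nat.choose_eq_zero_of_lt hgt, Nat.cast_zero, mul_zero]
    · intro h'
      exact absurd (Finset.mem_range.2 hk) h'

/-! ### Homogeneous components and scaling -/

section Homogeneity

variable {n : ℕ}

theorem eval_smul_of_isHomogeneous {σ : Type*} {p : MvPolynomial σ ℂ} {d : ℕ} (hp : p.IsHomogeneous d)
    (t : ℂ) (x : σ → ℂ) : eval (t • x) p = t ^ d * eval x p := by
  rw [eval_eq, eval_eq, Finset.mul_sum]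
  refine Finset.sum_congr rfl fun m hm => ?_
  have hd := hp (mem_support_iff.1 hm)
  simp only [Pi.smul_apply, smul_eq_mul, mul_pow, Finset.prod_mul_distrib, Finset.prod_pow_eq_pow_sum]
  rw [← hd, Finsupp.weight_apply, Finsupp.sum]
  simp
  ring

theorem eval_smul_eq_sum {σ : Type*} (p : MvPolynomial σ ℂ) (t : ℂ) (x : σ → ℂ) {d : ℕ}
    (hd : p.totalDegree ≤ d) :
    eval (t • x) p = ∑ i ∈ Finset.range (d + 1), t ^ i * eval x (homogeneousComponent i p) := by
  conv_lhs => rw [← sum_homogeneousComponent p]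
  rw [map_sum]
  simp only [fun i => eval_smul_of_isHomogeneous (homogeneousComponent_isHomogeneous i p) t x]
  refine Finset.sum_subset (Finset.range_mono (by omega)) fun i _ hi => ?_
  rw [homogeneousComponent_eq_zero _ _ (by simpa using hi), map_zero, mul_zero]

/-- Along a ray the value is a polynomial in `t` with infinitely many roots. This splits the
quasi-invariance conditions by degree, the hyperplanes being cones. -/
theorem eval_homogeneousComponent_eq_zero {σ : Type*} {p : MvPolynomial σ ℂ} {x : σ → ℂ}
    (h : ∀ t : ℝ, 0 < t → eval ((t : ℂ) • x) p = 0) (r : ℕ) :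
    eval x (homogeneousComponent r p) = 0 := by
  by_cases hr : p.totalDegree < r
  · rw [homogeneousComponent_eq_zero _ _ hr, map_zero]
  let Q : Polynomial ℂ := ∑ i ∈ Finset.range (p.totalDegree + 1),
    Polynomial.C (eval x (homogeneousComponent i p)) * Polynomial.X ^ i
  have hQ : Q = 0 := by
    refine Polynomial.eq_zero_of_infinite_isRoot _
      (((Set.Ioi_infinite (0 : ℝ)).image Complex.ofReal_injective.injOn).mono ?_)
    rintro _ ⟨t, ht, rfl⟩
    have := h t ht
    rw [eval_smul_eq_sum p _ _ le_rfl] at this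
    simp only [Set.mem_ofPred, Polynomial.IsRoot.def, Q, Polynomial.eval_finsetSum]
    rw [← this]
    refine Finset.sum_congr rfl fun i _ => ?_
    rw [Polynomial.eval_mul, Polynomial.eval_C, Polynomial.eval_pow, Polynomial.eval_X, mul_comm]
  have hc := congrArg (fun q => Polynomial.coeff q r) hQ
  simp only [Q, Polynomial.finsetSum_coeff, Polynomial.coeff_C_mul_X_pow, Polynomial.coeff_zero] at hc
  rw [Finset.sum_ite_eq, if_pos (by simp; omega)] at hc
  exact hc

theorem homogeneousComponent_pderiv {σ : Type*} (i : σ) (r : ℕ) (p : MvPolynomial σ ℂ) :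
    homogeneousComponent r (pderiv i p) = pderiv i (homogeneousComponent (r + 1) p) := by
  ext m
  rw [coeff_homogeneousComponent, coeff_pderiv, coeff_pderiv, coeff_homogeneousComponent]
  simp

theorem homogeneousComponent_iterate_dirD (α : Fin n → ℝ) (j : ℕ) : ∀ (r : ℕ)
    (p : MvPolynomial (Fin n) ℂ), homogeneousComponent r ((dirD α)^[j] p) =
      (dirD α)^[j] (homogeneousComponent (r + j) p) := by
  induction j with
  | zero => simp
  | succ j ih =>
    intro r p
    rw [Function.iterate_succ_apply, ih, Function.iterate_succ_apply]
    congr 1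
    simp only [dirD_apply, map_sum, map_smul, homogeneousComponent_pderiv]
    rfl

theorem iterate_dirD_eq_zero (α : Fin n → ℝ) (d : ℕ) : ∀ (p : MvPolynomial (Fin n) ℂ),
    p.IsHomogeneous d → ∀ j, d < j → (dirD α)^[j] p = 0 := by
  induction d with
  | zero =>
    intro p hp j hj
    obtain ⟨j, rfl⟩ := Nat.exists_eq_succ_of_ne_zero hj.ne'
    rw [← totalDegree_zero_iff_isHomogeneous, totalDegree_eq_zero_iff_eq_C] at hp
    have : dirD α p = 0 := by
      rw [hp, dirD_apply]
      simp
    rw [Function.iterate_succ_apply, this]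
    exact iterate_map_zero (dirD α) j
  | succ d ih =>
    intro p hp j hj
    obtain ⟨j, rfl⟩ := Nat.exists_eq_succ_of_ne_zero (by omega : j ≠ 0)
    rw [Function.iterate_succ_apply]
    refine ih _ ?_ j (by omega)
    rw [dirD_apply]
    refine IsHomogeneous.sum _ _ _ fun i _ => ?_
    rw [smul_eq_C_mul]
    exact (hp.pderiv (i := i)).C_mul _

end Homogeneity

/-! ### Quasi-invariance and uniqueness -/

section Quasi

variable {n : ℕ}

/-- The operator `∂_α + (α, l)`, that is, `∂_α` conjugated by `exp (x, l)`. -/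
def twist (α : Fin n → ℝ) (l : Fin n → ℂ) : Module.End ℂ (MvPolynomial (Fin n) ℂ) :=
  (dirD α : MvPolynomial (Fin n) ℂ →ₗ[ℂ] MvPolynomial (Fin n) ℂ) + (l ⬝ᵥ toComplex α) • 1

theorem twist_apply (α : Fin n → ℝ) (l : Fin n → ℂ) (p : MvPolynomial (Fin n) ℂ) :
    twist α l p = dirD α p + (l ⬝ᵥ toComplex α) • p := rfl

theorem twist_pow_apply (α : Fin n → ℝ) (l : Fin n → ℂ) (k : ℕ) (p : MvPolynomial (Fin n) ℂ) :
    (twist α l ^ k) p = ∑ j ∈ Finset.range (k + 1),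
      ((l ⬝ᵥ toComplex α) ^ (k - j) * (k.choose j : ℂ)) • (dirD α)^[j] p := by
  have hc : Commute (dirD α : MvPolynomial (Fin n) ℂ →ₗ[ℂ] MvPolynomial (Fin n) ℂ)
      ((l ⬝ᵥ toComplex α) • (1 : Module.End ℂ (MvPolynomial (Fin n) ℂ))) :=
    (Commute.one_right _).smul_right _
  rw [twist, hc.add_pow, LinearMap.sum_apply]
  refine Finset.sum_congr rfl fun j _ => ?_
  rw [smul_pow, one_pow]
  simp only [Module.End.mul_apply, LinearMap.smul_apply, Module.End.one_apply, Module.End.natCast_apply,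
    map_smul, map_nsmul, Module.End.pow_apply]
  rw [mul_smul, Nat.cast_smul_eq_nsmul, smul_comm]
  rfl

/-- The conditions of quasi-invariance for `p(x) exp (x, l)`. -/
def Quasi (A : Configuration n) (l : Fin n → ℂ) (p : MvPolynomial (Fin n) ℂ) : Prop :=
  ∀ α ∈ A.vectors, ∀ s < A.mult α, ∀ y : Fin n → ℝ, y ⬝ᵥ α = 0 →
    eval (toComplex y) ((twist α l ^ (2 * s + 1)) p) = 0

variable {A : Configuration n} {l : Fin n → ℂ} {p q : MvPolynomial (Fin n) ℂ}

theorem Quasi.sub_smul (hp : Quasi A l p) (hq : Quasi A l q) (c : ℂ) : Quasi A l (p - c • q) := by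
  intro α hα s hs y hy
  rw [map_sub, map_smul, map_sub, smul_eval, hp α hα s hs y hy, hq α hα s hs y hy]
  simp

/-- With `c = (l, α)`, the part of degree `r = d - j` of the condition of order `2s + 1` reads `∑_k
binom(2s+1, k) c^(2s+1-k) ∂_α^k p_(r+k) = 0` on the hyperplane. Terms with `k > j` vanish because
`p` has degree at most `d`; for `j < m_α` the conditions then force every remaining term to vanish,
in particular `∂_α^j p_d`. -/
theorem Quasi.linForm_pow_dvd (hp : Quasi A l p) {α : Fin n → ℝ} (hα : α ∈ A.vectors)
    (hl : l ⬝ᵥ toComplex α ≠ 0) {d : ℕ} (hd : p.totalDegree ≤ d) :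
    linForm α ^ A.mult α ∣ homogeneousComponent d p := by
  refine BakerAkhiezer.linForm_pow_dvd (A.ne_zero α hα) _ _ fun j hj y hy => ?_
  by_cases hjd : d < j
  · rw [iterate_dirD_eq_zero α d _ (homogeneousComponent_isHomogeneous d p) j hjd, map_zero]
  obtain ⟨r, rfl⟩ := Nat.exists_eq_add_of_le' (not_lt.1 hjd)
  set c := l ⬝ᵥ toComplex α with hc
  let a : ℕ → ℂ := fun k => eval (toComplex y) ((dirD α)^[k] (homogeneousComponent (r + k) p))
  have ha : ∀ k, j < k → a k = 0 := by
    intro k hk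
    simp only [a]
    rw [homogeneousComponent_eq_zero _ _ (by omega), iterate_map_zero, map_zero]
  have key : ∀ s < A.mult α, ∑ k ∈ Finset.range (2 * s + 1 + 1),
      c ^ (2 * s + 1 - k) * ((2 * s + 1).choose k : ℂ) * a k = 0 := by
    intro s hs
    have h1 := eval_homogeneousComponent_eq_zero
      (p := (twist α l ^ (2 * s + 1)) p) (x := toComplex y) (fun t _ => by
        have : (t : ℂ) • toComplex y = toComplex (t • y) := by
          ext i; simp [toComplex]
        rw [this]
        exact hp α hα s hs _ (by rw [smul_dotProduct, hy, smul_zero])) r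
    rw [twist_pow_apply, map_sum, map_sum] at h1
    rw [← h1]
    refine Finset.sum_congr rfl fun k _ => ?_
    rw [map_smul, smul_eval, homogeneousComponent_iterate_dirD]
  have hb := eq_zero_of_sum_choose_eq_zero (A.mult α) (fun k => a k * (c ^ k)⁻¹) (fun s hs => by
    have h2 := key s hs
    have e1 : ∑ k ∈ Finset.range (2 * s + 1 + 1),
        c ^ (2 * s + 1 - k) * ((2 * s + 1).choose k : ℂ) * a k =
        c ^ (2 * s + 1) * ∑ k ∈ Finset.range (2 * s + 1 + 1),
          a k * (c ^ k)⁻¹ * ((2 * s + 1).choose k : ℂ) := by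
      rw [Finset.mul_sum]
      refine Finset.sum_congr rfl fun k hk => ?_
      rw [pow_sub₀ _ hl (by have := Finset.mem_range.1 hk; omega)]
      ring
    rw [e1] at h2
    have h3 := (mul_eq_zero.1 h2).resolve_left (pow_ne_zero _ hl)
    rw [← h3]
    -- Both ranges are enlarged to a common one: the extra terms vanish because `a k = 0` for `k >
    -- j`, respectively because the binomial coefficient is zero.
    trans ∑ k ∈ Finset.range (2 * s + 1 + 1 + A.mult α),
        a k * (c ^ k)⁻¹ * ((2 * s + 1).choose k : ℂ)
    · refine Finset.sum_subset (Finset.range_mono (by omega)) fun k _ hk => ?_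
      rw [ha k (by have := Finset.mem_range.not.1 hk; omega)]
      simp
    · symm
      refine Finset.sum_subset (Finset.range_mono (by omega)) fun k _ hk => ?_
      rw [Nat.choose_eq_zero_of_lt (by have := Finset.mem_range.not.1 hk; omega)]
      simp) j hj
  exact (mul_eq_zero.1 hb).resolve_right (inv_ne_zero (pow_ne_zero _ hl))

namespace Configuration

variable (A)

theorem AmPoly_eq : A.AmPoly = ∏ α ∈ A.vectors, linForm α ^ A.mult α := rfl

theorem AmPoly_ne_zero : A.AmPoly ≠ 0 := by
  rw [AmPoly_eq]
  exact Finset.prod_ne_zero_iff.2 fun α hα => pow_ne_zero _ (linForm_ne_zero (A.ne_zero α hα))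

theorem isHomogeneous_AmPoly : A.AmPoly.IsHomogeneous A.totalMult := by
  rw [AmPoly_eq]
  refine IsHomogeneous.prod _ _ _ fun α _ => ?_
  simpa using (isHomogeneous_linForm α).pow (A.mult α)

theorem totalDegree_AmPoly : A.AmPoly.totalDegree = A.totalMult :=
  A.isHomogeneous_AmPoly.totalDegree A.AmPoly_ne_zero

end Configuration

/-- The factors are pairwise coprime because the vectors are noncolinear. Vectors of multiplicity
zero are separated, since `A_m(l) ≠ 0` says nothing about them. -/
theorem Quasi.AmPoly_dvd (hp : Quasi A l p) (hl : A.Am l ≠ 0) {d : ℕ} (hd : p.totalDegree ≤ d) :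
    A.AmPoly ∣ homogeneousComponent d p := by
  rw [A.AmPoly_eq]
  refine Finset.prod_dvd_of_isRelPrime (fun α hα β hβ hne => ?_) fun α hα => ?_
  · exact (isRelPrime_linForm (A.ne_zero α hα) (A.noncolinear α hα β hβ hne)).pow
  · rcases Nat.eq_zero_or_pos (A.mult α) with h0 | h0
    · rw [h0, pow_zero]
      exact one_dvd _
    · refine hp.linForm_pow_dvd hα (fun h => hl ?_) hd
      exact Finset.prod_eq_zero hα (by rw [h, zero_pow h0.ne'])

theorem Quasi.exists_homogeneousComponent_eq (hp : Quasi A l p) (hl : A.Am l ≠ 0)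
    (hd : p.totalDegree ≤ A.totalMult) :
    ∃ κ : ℂ, homogeneousComponent A.totalMult p = C κ * A.AmPoly := by
  obtain ⟨h, hh⟩ := hp.AmPoly_dvd hl hd
  by_cases h0 : h = 0
  · exact ⟨0, by rw [hh, h0]; simp⟩
  have h1 : (homogeneousComponent A.totalMult p).totalDegree = A.totalMult :=
    (homogeneousComponent_isHomogeneous _ _).totalDegree
      (by rw [hh]; exact mul_ne_zero A.AmPoly_ne_zero h0)
  rw [hh, totalDegree_mul_of_isDomain A.AmPoly_ne_zero h0, A.totalDegree_AmPoly] at h1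
  have h2 := totalDegree_eq_zero_iff_eq_C.1 (by omega : h.totalDegree = 0)
  exact ⟨_, by rw [hh, mul_comm]; nth_rw 1 [h2]⟩

theorem homogeneousComponent_totalDegree_ne_zero {σ : Type*} {p : MvPolynomial σ ℂ} (hp : p ≠ 0) :
    homogeneousComponent p.totalDegree p ≠ 0 := by
  obtain ⟨m, hm, hd⟩ := Finset.exists_mem_eq_sup p.support (support_nonempty.2 hp)
    fun s => s.sum fun _ e => e
  intro h
  have := congrArg (coeff m) h
  rw [coeff_homogeneousComponent, if_pos (show m.degree = p.totalDegree from hd.symm), coeff_zero] at this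
  exact mem_support_iff.1 hm this

/-- A nonzero `p` would have degree below `|m|`, while its leading part is divisible by `A_m`, of
degree `|m|`. -/
theorem Quasi.eq_zero (hp : Quasi A l p) (hl : A.Am l ≠ 0) (hd : p.totalDegree ≤ A.totalMult)
    (htop : homogeneousComponent A.totalMult p = 0) : p = 0 := by
  by_contra h0
  have h1 := homogeneousComponent_totalDegree_ne_zero h0
  obtain ⟨h, hh⟩ := hp.AmPoly_dvd hl le_rfl
  have hlt : p.totalDegree < A.totalMult :=
    lt_of_le_of_ne hd fun h => h1 (by rw [h]; exact htop)
  have hne : h ≠ 0 := by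
    rintro rfl
    exact h1 (by rw [hh, mul_zero])
  have h2 := (homogeneousComponent_isHomogeneous p.totalDegree p).totalDegree h1
  rw [hh, totalDegree_mul_of_isDomain A.AmPoly_ne_zero hne, A.totalDegree_AmPoly] at h2
  omega

end Quasi

/-! ### Polynomial dependence on the spectral parameter -/

section PolynomialDependence

variable {n : ℕ}

/-- Continuous functions agreeing off a proper hypersurface are equal. -/
theorem eq_of_eq_of_eval_ne_zero {D : MvPolynomial (Fin n) ℂ} (hD : D ≠ 0)
    {f g : (Fin n → ℂ) → ℂ} (hf : Continuous f) (hg : Continuous g)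
    (h : ∀ l, eval l D ≠ 0 → f l = g l) (l : Fin n → ℂ) : f l = g l := by
  obtain ⟨μ, hμ⟩ : ∃ μ, eval μ D ≠ 0 := by
    by_contra! h'
    exact hD (funext fun x => by rw [h' x, map_zero])
  -- On the line through `l` and a point `μ` off the hypersurface, `D` has finitely many zeros, so
  -- agreement holds on a dense set.
  let L : ℂ → Fin n → ℂ := fun s => l + s • (μ - l)
  have hL : Continuous L := by fun_prop
  let u : Polynomial ℂ := aeval (fun i => Polynomial.C (l i) + Polynomial.X * Polynomial.C (μ i - l i)) D
  have hu : ∀ s, u.eval s = eval (L s) D := by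
    intro s
    have : (Polynomial.aeval s : Polynomial ℂ →ₐ[ℂ] ℂ).comp
        (aeval fun i => Polynomial.C (l i) + Polynomial.X * Polynomial.C (μ i - l i)) =
        aeval (L s) := by
      ext i
      simp [L]
    exact DFunLike.congr_fun this D
  have hu0 : u ≠ 0 := by
    intro h0
    apply hμ
    have := hu 1
    rw [h0] at this
    simpa [L] using this.symm
  have hfin : {s : ℂ | u.eval s = 0}.Finite := by
    have := Polynomial.finite_setOfPred_isRoot hu0
    exact this
  have hdense : Dense {s : ℂ | u.eval s = 0}ᶜ := hfin.countable.dense_compl ℝ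
  have := Continuous.ext_on hdense (hf.comp hL) (hg.comp hL) (fun s hs => h _ (by rw [← hu]; exact hs))
  simpa [L] using congrFun this 0

/-- The Nullstellensatz for the prime, hence radical, ideal generated by `π`. -/
theorem dvd_of_prime_of_eval {π Q : MvPolynomial (Fin n) ℂ} (hπ : Prime π)
    (h : ∀ l, eval l π = 0 → eval l Q = 0) : π ∣ Q := by
  have hprime : (Ideal.span {π}).IsPrime := (Ideal.span_singleton_prime hπ.ne_zero).2 hπ
  rw [← Ideal.mem_span_singleton, ← IsPrime.vanishingIdeal_zeroLocus (K := ℂ) (Ideal.span {π})]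
  intro l hl
  have := hl π (Ideal.mem_span_singleton_self π)
  rw [aeval_eq_eval] at this ⊢
  exact h l this

/-- A continuous function that is a quotient of polynomials is a polynomial. -/
theorem exists_eval_eq_of_continuous {D : MvPolynomial (Fin n) ℂ} : D ≠ 0 →
    ∀ f : (Fin n → ℂ) → ℂ, Continuous f →
    (∃ Q : MvPolynomial (Fin n) ℂ, ∀ l, eval l D * f l = eval l Q) →
    ∃ R : MvPolynomial (Fin n) ℂ, ∀ l, f l = eval l R := by
  induction D using UniqueFactorizationMonoid.induction_on_prime with
  | h₁ => exact fun h => absurd rfl h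
  | h₂ D hD =>
    rintro - f - ⟨Q, hQ⟩
    obtain ⟨E, hE⟩ := hD.exists_left_inv
    refine ⟨E * Q, fun l => ?_⟩
    rw [map_mul, ← hQ, ← mul_assoc, ← map_mul, hE, map_one, one_mul]
  | h₃ D π hD hπ ih =>
    rintro - f hf ⟨Q, hQ⟩
    -- The numerator vanishes wherever `π` does, since `f` is finite there; one prime factor of the
    -- denominator cancels. Continuity restores the identity on `π = 0`.
    obtain ⟨R, rfl⟩ := dvd_of_prime_of_eval (Q := Q) hπ fun l hl => by
      rw [← hQ, map_mul, hl, zero_mul, zero_mul]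
    refine ih hD f hf ⟨R, eq_of_eq_of_eval_ne_zero hπ.ne_zero
      ((MvPolynomial.continuous_eval D).mul hf) (MvPolynomial.continuous_eval R) fun l hl => ?_⟩
    have := hQ l
    rw [map_mul, map_mul, mul_assoc] at this
    exact mul_left_cancel₀ hl this

/-- Among linear equations with only the trivial solution there is a square invertible subsystem. -/
theorem exists_isUnit_det {ι E : Type*} [Fintype ι] [DecidableEq ι] (w : E → ι → ℂ)
    (h : ∀ v : ι → ℂ, (∀ e, ∑ i, w e i * v i = 0) → v = 0) :
    ∃ e : ι → E, IsUnit (Matrix.of fun j i => w (e j) i).det := by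
  -- A functional annihilating all the rows is a nontrivial solution of the system.
  have hspan : ⊤ ≤ Submodule.span ℂ (Set.range w) := by
    by_contra hlt
    obtain ⟨φ, hφ0, hφ⟩ := Submodule.exists_le_ker_of_lt_top _ (lt_top_iff_ne_top.2 fun h =>
      hlt h.ge)
    have hφe : ∀ x : ι → ℂ, φ x = ∑ i, x i * φ (Pi.single i 1) := by
      intro x
      conv_lhs => rw [pi_eq_sum_univ' x]
      simp [map_sum]
    have hv := h (fun i => φ (Pi.single i 1)) fun e => by
      rw [← hφe]
      exact hφ (Submodule.subset_span ⟨e, rfl⟩)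
    apply hφ0
    ext i
    simpa using congrFun hv i
  let b := Module.Basis.ofSpan hspan
  let b' := b.reindex (b.indexEquiv (Pi.basisFun ℂ ι))
  have hb : ∀ j, ∃ e, w e = b' j := by
    intro j
    rw [Module.Basis.reindex_apply]
    exact Module.Basis.ofSpan_subset hspan ⟨_, rfl⟩
  choose e he using hb
  refine ⟨e, ?_⟩
  rw [← Matrix.isUnit_iff_isUnit_det, ← Matrix.linearIndependent_rows_iff_isUnit]
  have : (Matrix.of fun j i => w (e j) i).row = b' := by
    funext j
    exact he j
  rw [this]
  exact b'.linearIndependent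

/-- The solution of a linear system with polynomial coefficients that has at most one solution at
some point is a rational function. -/
theorem exists_denominator {ι E : Type*} [Fintype ι] [DecidableEq ι]
    (r : E → ι → MvPolynomial (Fin n) ℂ) (b : E → MvPolynomial (Fin n) ℂ)
    (f : ι → (Fin n → ℂ) → ℂ) (hf : ∀ e l, ∑ i, eval l (r e i) * f i l = eval l (b e))
    (l₀ : Fin n → ℂ) (h : ∀ v : ι → ℂ, (∀ e, ∑ i, eval l₀ (r e i) * v i = 0) → v = 0) :
    ∃ D : MvPolynomial (Fin n) ℂ, D ≠ 0 ∧
      ∀ i, ∃ Q : MvPolynomial (Fin n) ℂ, ∀ l, eval l D * f i l = eval l Q := by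
  -- A square subsystem invertible at `l₀` has determinant a nonzero polynomial, and Cramer's rule
  -- uses it as denominator.
  obtain ⟨e, he⟩ := exists_isUnit_det (fun e i => eval l₀ (r e i)) h
  let M : Matrix ι ι (MvPolynomial (Fin n) ℂ) := Matrix.of fun j i => r (e j) i
  have hM : ∀ l, (M.map (eval l)).mulVec (fun i => f i l) = fun j => eval l (b (e j)) := by
    intro l
    funext j
    exact hf (e j) l
  refine ⟨M.det, ?_, fun i => ⟨M.adjugate.mulVec (fun j => b (e j)) i, fun l => ?_⟩⟩
  · intro h0
    have : eval l₀ M.det = (Matrix.of fun j i => eval l₀ (r (e j) i)).det := RingHom.map_det _ _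
    rw [h0, map_zero] at this
    rw [← this] at he
    exact not_isUnit_zero he
  · have h1 := congrArg (fun v => (M.map (eval l)).adjugate.mulVec v i) (hM l)
    simp only [Matrix.mulVec_mulVec, Matrix.adjugate_mul, Matrix.smul_mulVec, Matrix.one_mulVec] at h1
    have h2 : eval l M.det = (M.map (eval l)).det := RingHom.map_det _ _
    have h3 : (M.map (eval l)).adjugate = M.adjugate.map (eval l) :=
      (RingHom.map_adjugate (eval l) M).symm
    rw [h2]
    refine h1.trans ?_
    rw [h3]
    simp [Matrix.mulVec, dotProduct]

/-- The exponents of the monomials of degree at most `d`. -/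
def exps (n d : ℕ) : Finset (Fin n →₀ ℕ) :=
  (Finset.range (d + 1)).biUnion fun k => Finset.finsuppAntidiag Finset.univ k

theorem mem_exps {d : ℕ} {a : Fin n →₀ ℕ} : a ∈ exps n d ↔ a.degree ≤ d := by
  simp [exps, Finset.mem_finsuppAntidiag, Finsupp.degree_eq_sum]

theorem eq_sum_exps {d : ℕ} {p : MvPolynomial (Fin n) ℂ} (hp : p.totalDegree ≤ d) :
    p = ∑ a ∈ exps n d, monomial a (coeff a p) := by
  conv_lhs => rw [p.as_sum]
  refine Finset.sum_subset (fun a ha => ?_) fun a _ ha => ?_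
  · rw [mem_exps]
    exact (le_totalDegree ha).trans hp
  · rw [notMem_support_iff.1 ha, monomial_zero]

theorem coeff_sum_exps {d : ℕ} (v : exps n d → ℂ) (a : exps n d) :
    coeff a.1 (∑ c : exps n d, monomial c.1 (v c)) = v a := by
  classical
  rw [coeff_sum, Finset.sum_eq_single a]
  · simp
  · intro c _ hc
    rw [coeff_monomial, if_neg fun h => hc (Subtype.ext h)]
  · simp

theorem totalDegree_sum_exps {d : ℕ} (v : exps n d → ℂ) :
    (∑ c : exps n d, monomial c.1 (v c)).totalDegree ≤ d := by
  refine totalDegree_finsetSum_le fun c _ => (totalDegree_monomial_le _ _).trans ?_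
  exact mem_exps.1 c.2

/-- Polynomials of degree at most `d` are determined by their values at finitely many points, so
each coefficient is a fixed linear combination of continuous functions of `l`. -/
theorem continuous_coeff {d : ℕ} {P : (Fin n → ℂ) → MvPolynomial (Fin n) ℂ}
    (hdeg : ∀ l, (P l).totalDegree ≤ d) (hcont : ∀ x, Continuous fun l => eval x (P l))
    (a : exps n d) : Continuous fun l => coeff a.1 (P l) := by
  classical
  obtain ⟨e, he⟩ := exists_isUnit_det (fun (x : Fin n → ℂ) (c : exps n d) =>
      eval x (monomial c.1 (1 : ℂ))) fun v hv => by
    have h0 : ∑ c : exps n d, monomial c.1 (v c) = 0 := by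
      refine funext fun x => ?_
      rw [map_zero, ← hv x, map_sum]
      refine Finset.sum_congr rfl fun c _ => ?_
      simp [eval_monomial, mul_comm]
    funext c
    rw [← coeff_sum_exps v c, h0]
    simp
  set M : Matrix (exps n d) (exps n d) ℂ :=
    Matrix.of fun j c => eval (e j) (monomial c.1 (1 : ℂ)) with hM
  have h1 : ∀ l, M.mulVec (fun c => coeff c.1 (P l)) = fun j => eval (e j) (P l) := by
    intro l
    funext j
    conv_rhs => rw [eq_sum_exps (hdeg l), map_sum, ← Finset.sum_coe_sort]
    refine Finset.sum_congr rfl fun c _ => ?_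
    simp [hM, eval_monomial, mul_comm]
  have h2 : ∀ l, coeff a.1 (P l) = ∑ j, M⁻¹ a j * eval (e j) (P l) := by
    intro l
    have := congrArg (fun v => M⁻¹.mulVec v a) (h1 l)
    simp only [Matrix.mulVec_mulVec, Matrix.nonsing_inv_mul _ he, Matrix.one_mulVec] at this
    exact this
  simp only [h2]
  exact continuous_finsetSum _ fun j _ => continuous_const.mul (hcont (e j))

/-- The coefficients of a Baker-Akhiezer function are polynomials in the spectral parameter. -/
theorem exists_coeff_eq_eval {A : Configuration n} {P : (Fin n → ℂ) → MvPolynomial (Fin n) ℂ}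
    (hdeg : ∀ l, (P l).totalDegree ≤ A.totalMult)
    (htop : ∀ l, homogeneousComponent A.totalMult (P l) = C (A.Am l) * A.AmPoly)
    (hq : ∀ l, Quasi A l (P l)) (hcont : ∀ x, Continuous fun l => eval x (P l)) :
    ∃ pc : (Fin n →₀ ℕ) → MvPolynomial (Fin n) ℂ,
      ∀ l, ∀ a ∈ exps n A.totalMult, coeff a (P l) = eval l (pc a) := by
  classical
  obtain ⟨l₀, hl₀⟩ : ∃ l, A.Am l ≠ 0 := by
    by_contra! h'
    exact A.AmPoly_ne_zero (funext fun x => by rw [A.eval_AmPoly, h' x, map_zero])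
  -- The equations satisfied by the coefficients of `P l`: the homogeneous quasi-invariance
  -- conditions, and the prescribed coefficients of degree `|m|`. `Quasi.eq_zero` makes the system
  -- nondegenerate at `l₀`.
  let E := {e : (Fin n → ℝ) × ℕ × (Fin n → ℝ) //
    e.1 ∈ A.vectors ∧ e.2.1 < A.mult e.1 ∧ e.2.2 ⬝ᵥ e.1 = 0} ⊕
    {a : exps n A.totalMult // a.1.degree = A.totalMult}
  let r : E → exps n A.totalMult → MvPolynomial (Fin n) ℂ := fun e a => match e with
    | .inl e => ∑ j ∈ Finset.range (2 * e.1.2.1 + 1 + 1),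
        linForm e.1.1 ^ (2 * e.1.2.1 + 1 - j) * C (((2 * e.1.2.1 + 1).choose j : ℂ) *
          eval (toComplex e.1.2.2) ((dirD e.1.1)^[j] (monomial a.1 1)))
    | .inr a' => if a = a'.1 then 1 else 0
  let b : E → MvPolynomial (Fin n) ℂ := fun e => match e with
    | .inl _ => 0
    | .inr a' => C (coeff a'.1.1 A.AmPoly) * A.AmPoly
  have hr : ∀ e l (v : exps n A.totalMult → ℂ), ∑ a, eval l (r (.inl e) a) * v a =
      eval (toComplex e.1.2.2) ((twist e.1.1 l ^ (2 * e.1.2.1 + 1))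
        (∑ a : exps n A.totalMult, monomial a.1 (v a))) := by
    intro e l v
    rw [map_sum, map_sum]
    refine Finset.sum_congr rfl fun a _ => ?_
    have : monomial a.1 (v a) = v a • monomial a.1 (1 : ℂ) := by simp [smul_monomial]
    rw [this, map_smul, smul_eval, mul_comm, twist_pow_apply, map_sum, map_sum]
    congr 1
    refine Finset.sum_congr rfl fun j _ => ?_
    rw [smul_eval, map_mul, map_pow, eval_linForm, eval_C, mul_assoc]
  have hr' : ∀ e l (v : exps n A.totalMult → ℂ), ∑ a, eval l (r (.inr e) a) * v a = v e.1 := by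
    intro e l v
    rw [Finset.sum_eq_single e.1]
    · simp [r]
    · intro c _ hc
      simp [r, hc]
    · simp
  obtain ⟨D, hD, hQ⟩ := exists_denominator r b (fun a l => coeff a.1 (P l)) (by
      rintro (e | e) l
      · rw [hr]
        have := eq_sum_exps (hdeg l)
        rw [← Finset.sum_coe_sort] at this
        rw [← this, hq l _ e.2.1 _ e.2.2.1 _ e.2.2.2]
        simp [b]
      · rw [hr']
        have := congrArg (coeff e.1.1) (htop l)
        rw [coeff_homogeneousComponent, if_pos e.2, coeff_C_mul] at this
        rw [this]
        simp [b, A.eval_AmPoly, mul_comm]) l₀ (by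
      intro v hv
      have h0 : ∑ a : exps n A.totalMult, monomial a.1 (v a) = 0 := by
        refine Quasi.eq_zero (A := A) (l := l₀) ?_ hl₀ (totalDegree_sum_exps v) ?_
        · intro α hα s hs y hy
          exact (hr ⟨(α, s, y), hα, hs, hy⟩ l₀ v).symm.trans (hv (.inl ⟨(α, s, y), hα, hs, hy⟩))
        · ext m
          rw [coeff_homogeneousComponent, coeff_zero]
          split_ifs with hm
          · have hm' : m ∈ exps n A.totalMult := mem_exps.2 hm.le
            exact (coeff_sum_exps v ⟨m, hm'⟩).trans ((hr' ⟨⟨m, hm'⟩, hm⟩ l₀ v).symm.trans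
              (hv (.inr ⟨⟨m, hm'⟩, hm⟩)))
          · rfl
      funext a
      rw [← coeff_sum_exps v a, h0]
      simp)
  have := fun a => exists_eval_eq_of_continuous hD _ (continuous_coeff hdeg hcont a) (hQ a)
  choose R hR using this
  refine ⟨fun a => if h : a ∈ exps n A.totalMult then R ⟨a, h⟩ else 0, fun l a ha => ?_⟩
  simpa only [dif_pos ha] using hR ⟨a, ha⟩ l

end PolynomialDependence

/-! ### Homogeneity in the spectral parameter -/

section Scaling

variable {n : ℕ}

/-- The substitution `x ↦ t x`. -/
def scale (t : ℂ) : MvPolynomial (Fin n) ℂ →ₐ[ℂ] MvPolynomial (Fin n) ℂ :=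
  aeval fun i => C t * X i

theorem coeff_scale (t : ℂ) (p : MvPolynomial (Fin n) ℂ) (a : Fin n →₀ ℕ) :
    coeff a (scale t p) = t ^ a.degree * coeff a p := by
  classical
  induction p using MvPolynomial.induction_on' with
  | monomial m c =>
    have : scale t (monomial m c) = monomial m (t ^ m.degree * c) := by
      rw [scale, aeval_monomial, Finsupp.prod_pow]
      simp only [mul_pow, Finset.prod_mul_distrib, Finset.prod_pow_eq_pow_sum]
      rw [← Finsupp.degree_eq_sum, monomial_eq (s := m), Finsupp.prod_pow, algebraMap_eq, C_mul, C_pow]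
      ring
    rw [this, coeff_monomial, coeff_monomial]
    split_ifs with h
    · rw [h]
    · rw [mul_zero]
  | add p q hp hq => rw [map_add, coeff_add, hp, hq, coeff_add, mul_add]

theorem eval_scale (t : ℂ) (p : MvPolynomial (Fin n) ℂ) (x : Fin n → ℂ) :
    eval x (scale t p) = eval (t • x) p := by
  have : (aeval x : MvPolynomial (Fin n) ℂ →ₐ[ℂ] ℂ).comp (scale t) = aeval (t • x) := by
    ext i
    simp [scale]
  exact DFunLike.congr_fun this p

theorem pderiv_scale (t : ℂ) (p : MvPolynomial (Fin n) ℂ) (i : Fin n) :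
    pderiv i (scale t p) = t • scale t (pderiv i p) := by
  ext m
  rw [coeff_pderiv, coeff_smul, coeff_scale, coeff_scale, coeff_pderiv]
  simp [pow_succ]
  ring

theorem twist_scale (t : ℂ) (α : Fin n → ℝ) (l : Fin n → ℂ) (p : MvPolynomial (Fin n) ℂ) :
    twist α (t • l) (scale t p) = t • scale t (twist α l p) := by
  rw [twist_apply, twist_apply, dirD_apply, dirD_apply, map_add, map_sum, smul_add, Finset.smul_sum,
    map_smul, smul_dotProduct, smul_smul, smul_eq_mul]
  congr 1
  refine Finset.sum_congr rfl fun i _ => ?_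
  rw [pderiv_scale, map_smul, smul_comm]

theorem twist_pow_scale (t : ℂ) (α : Fin n → ℝ) (l : Fin n → ℂ) (p : MvPolynomial (Fin n) ℂ) (k : ℕ) :
    (twist α (t • l) ^ k) (scale t p) = t ^ k • scale t ((twist α l ^ k) p) := by
  induction k with
  | zero => simp
  | succ k ih =>
    rw [pow_succ' (twist α (t • l)), pow_succ' (twist α l), Module.End.mul_apply,
      Module.End.mul_apply, ih, map_smul, twist_scale, smul_smul, pow_succ]

theorem Quasi.scale {A : Configuration n} {l : Fin n → ℂ} {p : MvPolynomial (Fin n) ℂ}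
    (hp : Quasi A l p) (t : ℝ) : Quasi A ((t : ℂ) • l) (scale (t : ℂ) p) := by
  intro α hα s hs y hy
  have : (t : ℂ) • toComplex y = toComplex (t • y) := by
    ext i; simp [toComplex]
  rw [twist_pow_scale, smul_eval, eval_scale, this, hp α hα s hs _
    (by rw [smul_dotProduct, hy, smul_zero]), mul_zero]

theorem totalDegree_scale_le (t : ℂ) (p : MvPolynomial (Fin n) ℂ) :
    (scale t p).totalDegree ≤ p.totalDegree := by
  refine Finset.sup_mono fun a ha => ?_
  rw [mem_support_iff, coeff_scale] at ha
  exact mem_support_iff.2 (right_ne_zero_of_mul ha)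

theorem homogeneousComponent_scale (t : ℂ) (p : MvPolynomial (Fin n) ℂ) (d : ℕ) :
    homogeneousComponent d (scale t p) = t ^ d • homogeneousComponent d p := by
  ext a
  rw [coeff_smul, coeff_homogeneousComponent, coeff_homogeneousComponent, coeff_scale]
  split_ifs with h
  · rw [h, smul_eq_mul]
  · rw [smul_zero]

/-- The polynomial `x ↦ P l (t x)` is quasi-invariant for `t l` and has the same leading part as `P
(t l)`, so uniqueness identifies the two. -/
theorem coeff_smul_param {A : Configuration n} {P : (Fin n → ℂ) → MvPolynomial (Fin n) ℂ}
    (hdeg : ∀ l, (P l).totalDegree ≤ A.totalMult)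
    (htop : ∀ l, homogeneousComponent A.totalMult (P l) = C (A.Am l) * A.AmPoly)
    (hq : ∀ l, Quasi A l (P l)) {l : Fin n → ℂ} (hl : A.Am l ≠ 0) {t : ℝ} (ht : 0 < t)
    (a : Fin n →₀ ℕ) : coeff a (P ((t : ℂ) • l)) = (t : ℂ) ^ a.degree * coeff a (P l) := by
  rw [← coeff_scale]
  congr 1
  have ht' : (t : ℂ) ≠ 0 := by exact_mod_cast ht.ne'
  have hAm : A.Am ((t : ℂ) • l) = (t : ℂ) ^ A.totalMult * A.Am l := by
    rw [← A.eval_AmPoly, eval_smul_of_isHomogeneous A.isHomogeneous_AmPoly, A.eval_AmPoly]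
  have h1 : P ((t : ℂ) • l) - (1 : ℂ) • scale (t : ℂ) (P l) = 0 := by
    refine Quasi.eq_zero ((hq _).sub_smul ((hq l).scale t) 1)
      (by rw [hAm]; exact mul_ne_zero (pow_ne_zero _ ht') hl) ?_ ?_
    · rw [one_smul]
      exact (totalDegree_sub _ _).trans (max_le (hdeg _) ((totalDegree_scale_le _ _).trans (hdeg l)))
    · rw [one_smul, map_sub, htop, homogeneousComponent_scale, htop, hAm, smul_eq_C_mul, C_mul]
      ring
  rw [one_smul] at h1
  exact sub_eq_zero.1 h1

theorem isHomogeneous_of_eval_smul {p : MvPolynomial (Fin n) ℂ} {d : ℕ}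
    (h : ∀ t : ℝ, 0 < t → ∀ l, eval ((t : ℂ) • l) p = (t : ℂ) ^ d * eval l p) : p.IsHomogeneous d := by
  have hz : ∀ r, r ≠ d → homogeneousComponent r p = 0 := by
    intro r hrd
    by_cases hr : p.totalDegree < r
    · exact homogeneousComponent_eq_zero _ _ hr
    refine funext fun l => ?_
    let Q : Polynomial ℂ := ∑ i ∈ Finset.range (p.totalDegree + 1),
      Polynomial.C (eval l (homogeneousComponent i p)) * Polynomial.X ^ i
        - Polynomial.C (eval l p) * Polynomial.X ^ d
    have hQ : Q = 0 := by
      refine Polynomial.eq_zero_of_infinite_isRoot _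
        (((Set.Ioi_infinite (0 : ℝ)).image Complex.ofReal_injective.injOn).mono ?_)
      rintro _ ⟨t, ht, rfl⟩
      have := h t ht l
      rw [eval_smul_eq_sum p _ _ le_rfl] at this
      simp only [Set.mem_ofPred, Polynomial.IsRoot.def, Q, Polynomial.eval_finsetSum,
        Polynomial.eval_sub, Polynomial.eval_mul, Polynomial.eval_C, Polynomial.eval_pow,
        Polynomial.eval_X]
      rw [sub_eq_zero, mul_comm (eval l p), ← this]
      exact Finset.sum_congr rfl fun i _ => mul_comm _ _
    have hc := congrArg (fun q => Polynomial.coeff q r) hQ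
    simp only [Q, Polynomial.coeff_sub, Polynomial.finsetSum_coeff, Polynomial.coeff_C_mul_X_pow,
      Polynomial.coeff_zero] at hc
    rw [Finset.sum_ite_eq, if_pos (by simp; omega), if_neg hrd, sub_zero] at hc
    rw [hc, map_zero]
  have : p = homogeneousComponent d p := by
    ext a
    rw [coeff_homogeneousComponent]
    split_ifs with ha
    · rfl
    · have := congrArg (coeff a) (hz _ ha)
      rwa [coeff_homogeneousComponent, if_pos rfl, coeff_zero] at this
  rw [this]
  exact homogeneousComponent_isHomogeneous d p

end Scaling

/-! ### Polynomials in two sets of variables -/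

section TwoSets

variable {n : ℕ}

/-- Polynomials in two sets of `n` variables: `(true, i)` stands for `x i` and `(false, i)` for the
spectral variable `l i`. -/
abbrev BiPoly (n : ℕ) := MvPolynomial (Bool × Fin n) ℂ

/-- Polynomials in one of the two sets of variables. -/
def emb (b : Bool) : MvPolynomial (Fin n) ℂ →ₐ[ℂ] BiPoly n := rename fun i => (b, i)

/-- Specialization of one of the two sets of variables. -/
def fix (b : Bool) (v : Fin n → ℂ) : BiPoly n →ₐ[ℂ] MvPolynomial (Fin n) ℂ :=
  aeval fun z => if z.1 = b then C (v z.2) else X z.2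

theorem emb_X (b : Bool) (i : Fin n) : emb b (X i) = X (b, i) := rename_X _ _

@[simp] theorem fix_X_self (b : Bool) (v : Fin n → ℂ) (i : Fin n) : fix b v (X (b, i)) = C (v i) := by
  simp [fix]

@[simp] theorem fix_X_not (b : Bool) (v : Fin n → ℂ) (i : Fin n) : fix b v (X (!b, i)) = X i := by
  simp [fix]

@[simp] theorem fix_emb_self (b : Bool) (v : Fin n → ℂ) (u : MvPolynomial (Fin n) ℂ) :
    fix b v (emb b u) = C (eval v u) := by
  have : (fix b v).comp (emb b) = (Algebra.ofId ℂ _).comp (aeval v) := by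
    ext i
    simp [emb_X, Algebra.ofId_apply]
  exact DFunLike.congr_fun this u

@[simp] theorem fix_emb_not (b : Bool) (v : Fin n → ℂ) (u : MvPolynomial (Fin n) ℂ) :
    fix b v (emb (!b) u) = u := by
  have : (fix b v).comp (emb (!b)) = AlgHom.id ℂ _ := by
    ext i
    simp [emb_X]
  exact DFunLike.congr_fun this u

theorem eval_fix (b : Bool) (v w : Fin n → ℂ) (f : BiPoly n) :
    eval w (fix b v f) = eval (fun z => if z.1 = b then v z.2 else w z.2) f := by
  have : (aeval w : MvPolynomial (Fin n) ℂ →ₐ[ℂ] ℂ).comp (fix b v) =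
      aeval fun z => if z.1 = b then v z.2 else w z.2 := by
    ext z
    simp only [fix, AlgHom.comp_apply, aeval_X]
    split_ifs <;> simp
  exact DFunLike.congr_fun this f

theorem eval_fix_not (b : Bool) (v w : Fin n → ℂ) (f : BiPoly n) :
    eval w (fix b v f) = eval v (fix (!b) w f) := by
  rw [eval_fix, eval_fix]
  congr 2
  funext ⟨b', i⟩
  cases b <;> cases b' <;> rfl

theorem eq_zero_of_fix (b : Bool) {f : BiPoly n} (h : ∀ v, fix b v f = 0) : f = 0 := by
  refine funext fun z => ?_
  have := eval_fix b (fun i => z (b, i)) (fun i => z (!b, i)) f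
  rw [h, map_zero] at this
  rw [map_zero, this]
  congr 2
  funext ⟨b', i⟩
  cases b <;> cases b' <;> rfl

theorem pderiv_emb_self (b : Bool) (i : Fin n) (u : MvPolynomial (Fin n) ℂ) :
    pderiv (b, i) (emb b u) = emb b (pderiv i u) :=
  pderiv_rename (fun _ _ h => (Prod.mk.inj h).2) i u

theorem pderiv_emb_not (b : Bool) (i : Fin n) (u : MvPolynomial (Fin n) ℂ) :
    pderiv (b, i) (emb (!b) u) = 0 := by
  induction u using MvPolynomial.induction_on with
  | C a => simp [emb]
  | add p q hp hq => rw [map_add, map_add, hp, hq, add_zero]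
  | mul_X p j hp =>
    rw [map_mul, pderiv_mul, hp, emb_X, pderiv_X_of_ne (by cases b <;> simp)]
    simp

theorem fix_pderiv (b : Bool) (v : Fin n → ℂ) (i : Fin n) (f : BiPoly n) :
    fix b v (pderiv (!b, i) f) = pderiv i (fix b v f) := by
  classical
  induction f using MvPolynomial.induction_on with
  | C a => simp [fix]
  | add p q hp hq => simp only [map_add, hp, hq]
  | mul_X p z hp =>
    obtain ⟨b', j⟩ := z
    rw [pderiv_mul, map_add, map_mul, map_mul, map_mul, hp, pderiv_mul]
    congr 2
    rcases eq_or_ne b' b with rfl | hb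
    · rw [fix_X_self, pderiv_C, pderiv_X_of_ne (by cases b' <;> simp), map_zero]
    · obtain rfl : b' = !b := by cases b <;> cases b' <;> simp_all
      rw [fix_X_not, pderiv_X, pderiv_X]
      by_cases h : j = i
      · subst h; simp
      · simp [h]

theorem pderiv_comm {σ : Type*} (i j : σ) (f : MvPolynomial σ ℂ) :
    pderiv i (pderiv j f) = pderiv j (pderiv i f) := by
  classical
  have : ⁅(pderiv i : Derivation ℂ (MvPolynomial σ ℂ) (MvPolynomial σ ℂ)),
      (pderiv j : Derivation ℂ (MvPolynomial σ ℂ) (MvPolynomial σ ℂ))⁆ = 0 := by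
    refine derivation_ext fun k => ?_
    rw [Derivation.commutator_apply, pderiv_X, pderiv_X]
    simp [Pi.single_apply, apply_ite (pderiv i), apply_ite (pderiv j)]
  have h := DFunLike.congr_fun this f
  rw [Derivation.commutator_apply] at h
  exact sub_eq_zero.1 h

end TwoSets

/-! ### The dual pair of operators and their commutator -/

section Operators

variable {n : ℕ}

/-- The derivative in the variable `(b, i)`, conjugated by `exp (x, l)`. -/
def D (b : Bool) (i : Fin n) : Module.End ℂ (BiPoly n) :=
  (pderiv (b, i) : Derivation ℂ (BiPoly n) (BiPoly n)).toLinearMap + LinearMap.mulLeft ℂ (X (!b, i))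

theorem D_apply (b : Bool) (i : Fin n) (f : BiPoly n) :
    D b i f = pderiv (b, i) f + X (!b, i) * f := rfl

theorem D_emb_self_mul (b : Bool) (i : Fin n) (u : MvPolynomial (Fin n) ℂ) (f : BiPoly n) :
    D b i (emb b u * f) = emb b (pderiv i u) * f + emb b u * D b i f := by
  rw [D_apply, D_apply, pderiv_mul, pderiv_emb_self]
  ring

theorem D_emb_not_mul (b : Bool) (i : Fin n) (u : MvPolynomial (Fin n) ℂ) (f : BiPoly n) :
    D b i (emb (!b) u * f) = emb (!b) u * D b i f := by
  rw [D_apply, D_apply, pderiv_mul, pderiv_emb_not]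
  ring

theorem D_not_emb_mul (b : Bool) (i : Fin n) (u : MvPolynomial (Fin n) ℂ) (f : BiPoly n) :
    D (!b) i (emb b u * f) = emb b u * D (!b) i f := by
  simpa using D_emb_not_mul (!b) i u f

theorem D_X_mul (b : Bool) (i : Fin n) (f : BiPoly n) :
    D b i (X (b, i) * f) = f + X (b, i) * D b i f := by
  rw [← emb_X, D_emb_self_mul, pderiv_X_self, map_one, one_mul]

/-- Both are conjugates, by the same exponential, of partial derivatives in different variables. -/
theorem D_comm (b : Bool) (i j : Fin n) (f : BiPoly n) :
    D b i (D (!b) j f) = D (!b) j (D b i f) := by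
  classical
  simp only [D_apply, map_add, pderiv_mul, Bool.not_not]
  rw [pderiv_comm (b, i)]
  by_cases h : i = j
  · subst h
    simp only [pderiv_X_self]
    ring
  · rw [pderiv_X_of_ne (by simpa using Ne.symm h), pderiv_X_of_ne (by simpa using h)]
    ring

/-- The quadratic form `x²`. -/
def sqPoly (n : ℕ) : MvPolynomial (Fin n) ℂ := ∑ i, X i ^ 2

theorem pderiv_sq (i : Fin n) : pderiv i (sqPoly n) = 2 * X i := by
  classical
  rw [sqPoly, map_sum, Finset.sum_eq_single i]
  · rw [pderiv_pow, pderiv_X_self]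
    simp
  · intro j _ hj
    rw [pderiv_pow, pderiv_X_of_ne hj, mul_zero]
  · simp

variable (A : Configuration n)

/-- The operator `A_m (Δ - ∑ 2 m_α (x, α)⁻¹ ∂_α)`, conjugated by `exp (x, l)`. -/
def U (b : Bool) : Module.End ℂ (BiPoly n) :=
  LinearMap.mulLeft ℂ (emb b A.AmPoly) * ∑ i, D b i * D b i -
    2 * ∑ i, LinearMap.mulLeft ℂ (emb b (pderiv i A.AmPoly)) * D b i

theorem U_apply (b : Bool) (f : BiPoly n) :
    U A b f = emb b A.AmPoly * ∑ i, D b i (D b i f) -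
      2 * ∑ i, emb b (pderiv i A.AmPoly) * D b i f := by
  have h2 : ∀ g : BiPoly n, (2 : Module.End ℂ (BiPoly n)) g = 2 * g := by
    intro g
    rw [← one_add_one_eq_two, ← one_add_one_eq_two, LinearMap.add_apply, add_mul]
    simp
  simp only [U, LinearMap.sub_apply, Module.End.mul_apply, LinearMap.sum_apply, h2,
    LinearMap.mulLeft_apply]

theorem U_emb_not_mul (b : Bool) (u : MvPolynomial (Fin n) ℂ) (f : BiPoly n) :
    U A b (emb (!b) u * f) = emb (!b) u * U A b f := by
  simp only [U_apply, D_emb_not_mul, ← Finset.mul_sum, mul_left_comm _ (emb (!b) u)]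
  ring

theorem U_D_comm (b : Bool) (j : Fin n) (f : BiPoly n) :
    U A b (D (!b) j f) = D (!b) j (U A b f) := by
  have h2 : ∀ g : BiPoly n, 2 * g = (2 : ℂ) • g := fun g => by
    rw [smul_eq_C_mul, map_ofNat]
  simp only [U_apply, map_sub, D_not_emb_mul, map_sum, D_comm, h2, map_smul]

theorem U_comm (b : Bool) (f : BiPoly n) : U A b (U A (!b) f) = U A (!b) (U A b f) := by
  have h2 : ∀ g : BiPoly n, 2 * g = (2 : ℂ) • g := fun g => by
    rw [smul_eq_C_mul, map_ofNat]
  rw [U_apply A (!b) f, U_apply A (!b) (U A b f)]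
  simp only [h2, map_sub, map_smul, U_emb_not_mul, map_sum, U_D_comm]

theorem sum_X_mul_pderiv_AmPoly :
    ∑ i, X i * pderiv i A.AmPoly = (A.totalMult : MvPolynomial (Fin n) ℂ) * A.AmPoly := by
  rw [A.isHomogeneous_AmPoly.sum_X_mul_pderiv, nsmul_eq_mul]

/-- The commutator of the Laplacian with `x²` is `4 (x, ∂) + 2n`; the first-order part contributes
`-4 |m|` through Euler's identity for `A_m`. -/
theorem U_sq_mul (b : Bool) (f : BiPoly n) :
    U A b (emb b (sqPoly n) * f) = emb b (sqPoly n) * U A b f + emb b A.AmPoly *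
      (4 * ∑ i, X (b, i) * D b i f + ((2 * n : ℂ) - 4 * A.totalMult) • f) := by
  have h1 : ∀ i, D b i (emb b (sqPoly n) * f) = 2 * (X (b, i) * f) + emb b (sqPoly n) * D b i f := by
    intro i
    rw [D_emb_self_mul, pderiv_sq, map_mul, emb_X, map_ofNat]
    ring
  have h2' : ∀ g : BiPoly n, 2 * g = (2 : ℂ) • g := fun g => by
    rw [smul_eq_C_mul, map_ofNat]
  have h2 : ∀ i, D b i (D b i (emb b (sqPoly n) * f)) =
      2 * f + 4 * (X (b, i) * D b i f) + emb b (sqPoly n) * D b i (D b i f) := by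
    intro i
    rw [h1, map_add, h2', map_smul, D_X_mul, D_emb_self_mul, pderiv_sq, map_mul, emb_X, map_ofNat,
      ← h2']
    ring
  have h3 : ∑ i, emb b (pderiv i A.AmPoly) * X (b, i) = (A.totalMult : BiPoly n) * emb b A.AmPoly := by
    have := congrArg (emb b) (sum_X_mul_pderiv_AmPoly A)
    rw [map_sum, map_mul, map_natCast] at this
    rw [← this]
    refine Finset.sum_congr rfl fun i _ => ?_
    rw [map_mul, emb_X, mul_comm]
  have h4 : ∑ i, emb b (pderiv i A.AmPoly) * (2 * (X (b, i) * f) + emb b (sqPoly n) * D b i f) =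
      2 * ((A.totalMult : BiPoly n) * emb b A.AmPoly) * f +
        emb b (sqPoly n) * ∑ i, emb b (pderiv i A.AmPoly) * D b i f := by
    rw [← h3, Finset.mul_sum, Finset.mul_sum, Finset.sum_mul, ← Finset.sum_add_distrib]
    refine Finset.sum_congr rfl fun i _ => ?_
    ring
  rw [U_apply, U_apply]
  simp only [h2]
  simp only [h1, h4, Finset.sum_add_distrib, Finset.sum_const, Finset.card_univ, Fintype.card_fin,
    ← Finset.mul_sum, nsmul_eq_mul, smul_eq_C_mul, map_sub, map_mul, map_natCast, map_ofNat]
  ring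

/-- The operator `A_m(x) (Δ - ∑ 2 m_α (x, α)⁻¹ ∂_α - l²)` (for `b = true`, and with `x`, `l`
exchanged for `b = false`), conjugated by `exp (x, l)`. -/
def T (b : Bool) (f : BiPoly n) : BiPoly n :=
  U A b f - emb b A.AmPoly * (emb (!b) (sqPoly n) * f)

theorem sum_X_mul_D_sub (b : Bool) (f : BiPoly n) :
    ∑ i, X (b, i) * D b i f - ∑ i, X (!b, i) * D (!b) i f =
      ∑ i, X (b, i) * pderiv (b, i) f - ∑ i, X (!b, i) * pderiv (!b, i) f := by
  rw [← Finset.sum_sub_distrib, ← Finset.sum_sub_distrib]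
  refine Finset.sum_congr rfl fun i _ => ?_
  rw [D_apply, D_apply, Bool.not_not]
  ring

/-- The operators `U` commute, so only their commutators with `x²` and `l²` remain. The scalar terms
and the exponential's contributions `(x, l)` cancel, leaving the difference of the Euler operators.
-/
theorem T_comm (b : Bool) (f : BiPoly n) : T A (!b) (T A b f) = T A b (T A (!b) f) +
    4 * (emb b A.AmPoly * (emb (!b) A.AmPoly *
      (∑ i, X (b, i) * pderiv (b, i) f - ∑ i, X (!b, i) * pderiv (!b, i) f))) := by
  have e1 : U A (!b) (emb b A.AmPoly * (emb (!b) (sqPoly n) * f)) =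
      emb b A.AmPoly * U A (!b) (emb (!b) (sqPoly n) * f) := by
    simpa using U_emb_not_mul A (!b) A.AmPoly (emb (!b) (sqPoly n) * f)
  rw [← sum_X_mul_D_sub]
  simp only [T, map_sub, U_emb_not_mul, Bool.not_not, e1, U_sq_mul, U_comm A b, smul_eq_C_mul]
  ring

/-- `D_α`, the operator `∂_α` conjugated by `exp (x, l)`. -/
def Dα (α : Fin n → ℝ) : Module.End ℂ (BiPoly n) := ∑ i, (α i : ℂ) • D true i

theorem Dα_apply (α : Fin n → ℝ) (f : BiPoly n) : Dα α f = ∑ i, (α i : ℂ) • D true i f := by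
  simp [Dα, LinearMap.sum_apply]

theorem fix_false_Dα (α : Fin n → ℝ) (l : Fin n → ℂ) (f : BiPoly n) :
    fix false l (Dα α f) = twist α l (fix false l f) := by
  have h1 : ∀ i, fix false l (pderiv (true, i) f) = pderiv i (fix false l f) :=
    fun i => fix_pderiv false l i f
  rw [Dα_apply, twist_apply, dirD_apply, map_sum, dotProduct, Finset.sum_smul, ← Finset.sum_add_distrib]
  refine Finset.sum_congr rfl fun i _ => ?_
  rw [D_apply, map_smul, map_add, map_mul, h1]
  have : fix false l (X (!true, i)) = C (l i) := fix_X_self false l i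
  rw [this, smul_add, smul_eq_C_mul (_ * _ : MvPolynomial (Fin n) ℂ), smul_eq_C_mul (fix false l f),
    C_mul, toComplex]
  ring

theorem fix_false_Dα_pow (α : Fin n → ℝ) (l : Fin n → ℂ) (k : ℕ) (f : BiPoly n) :
    fix false l ((Dα α ^ k) f) = (twist α l ^ k) (fix false l f) := by
  induction k with
  | zero => simp
  | succ k ih =>
    rw [pow_succ' (Dα α), pow_succ' (twist α l), Module.End.mul_apply, Module.End.mul_apply,
      fix_false_Dα, ih]

/-- The conditions of quasi-invariance for `f(x, l) exp (x, l)`, for all `l`. -/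
def QuasiAll (f : BiPoly n) : Prop :=
  ∀ α ∈ A.vectors, ∀ s < A.mult α, ∀ y : Fin n → ℝ, y ⬝ᵥ α = 0 →
    fix true (toComplex y) ((Dα α ^ (2 * s + 1)) f) = 0

variable {A}

theorem quasiAll_iff {f : BiPoly n} : QuasiAll A f ↔ ∀ l, Quasi A l (fix false l f) := by
  constructor
  · intro h l α hα s hs y hy
    have := eval_fix_not false l (toComplex y) ((Dα α ^ (2 * s + 1)) f)
    rw [← fix_false_Dα_pow, this]
    change eval l (fix true _ _) = 0
    rw [h α hα s hs y hy, map_zero]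
  · intro h α hα s hs y hy
    refine funext fun l => ?_
    have := eval_fix_not false l (toComplex y) ((Dα α ^ (2 * s + 1)) f)
    rw [fix_false_Dα_pow, h l α hα s hs y hy] at this
    rw [map_zero]
    exact this.symm

theorem QuasiAll.sub {f g : BiPoly n} (hf : QuasiAll A f) (hg : QuasiAll A g) :
    QuasiAll A (f - g) := by
  intro α hα s hs y hy
  rw [map_sub, map_sub, hf α hα s hs y hy, hg α hα s hs y hy, sub_zero]

theorem QuasiAll.sum {ι : Type*} {s : Finset ι} {f : ι → BiPoly n} (hf : ∀ i ∈ s, QuasiAll A (f i)) :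
    QuasiAll A (∑ i ∈ s, f i) := by
  intro α hα k hk y hy
  rw [map_sum, map_sum]
  exact Finset.sum_eq_zero fun i hi => hf i hi α hα k hk y hy

theorem Dα_emb_false_mul (α : Fin n → ℝ) (u : MvPolynomial (Fin n) ℂ) (k : ℕ) (f : BiPoly n) :
    (Dα α ^ k) (emb false u * f) = emb false u * (Dα α ^ k) f := by
  induction k with
  | zero => simp
  | succ k ih =>
    rw [pow_succ', Module.End.mul_apply, Module.End.mul_apply, ih, Dα_apply, Dα_apply, Finset.mul_sum]
    refine Finset.sum_congr rfl fun i _ => ?_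
    have := D_emb_not_mul true i u ((Dα α ^ k) f)
    rw [Bool.not_true] at this
    rw [this, mul_smul_comm]

theorem QuasiAll.emb_false_mul {f : BiPoly n} (hf : QuasiAll A f) (u : MvPolynomial (Fin n) ℂ) :
    QuasiAll A (emb false u * f) := by
  intro α hα s hs y hy
  rw [Dα_emb_false_mul, map_mul, hf α hα s hs y hy, mul_zero]

theorem Dα_pow_D_false (α : Fin n → ℝ) (j : Fin n) (k : ℕ) (f : BiPoly n) :
    (Dα α ^ k) (D false j f) = D false j ((Dα α ^ k) f) := by
  induction k with
  | zero => simp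
  | succ k ih =>
    rw [pow_succ', Module.End.mul_apply, Module.End.mul_apply, ih, Dα_apply, Dα_apply, map_sum]
    refine Finset.sum_congr rfl fun i _ => ?_
    rw [map_smul]
    exact congrArg _ (D_comm true i j _)

theorem QuasiAll.D_false {f : BiPoly n} (hf : QuasiAll A f) (j : Fin n) :
    QuasiAll A (D false j f) := by
  intro α hα s hs y hy
  have h1 : fix true (toComplex y) (pderiv (false, j) ((Dα α ^ (2 * s + 1)) f)) =
    pderiv j (fix true (toComplex y) ((Dα α ^ (2 * s + 1)) f)) := fix_pderiv true _ _ _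
  rw [Dα_pow_D_false, D_apply, map_add, map_mul, h1, hf α hα s hs y hy]
  simp

theorem Dα_emb_true_mul (α : Fin n → ℝ) (u : MvPolynomial (Fin n) ℂ) (f : BiPoly n) :
    Dα α (emb true u * f) = emb true (dirD α u) * f + emb true u * Dα α f := by
  rw [Dα_apply, Dα_apply, dirD_apply, map_sum, Finset.sum_mul, Finset.mul_sum, ← Finset.sum_add_distrib]
  refine Finset.sum_congr rfl fun i _ => ?_
  rw [D_emb_self_mul, smul_add, map_smul, smul_mul_assoc, mul_smul_comm]

theorem dirD_sq (α : Fin n → ℝ) : dirD α (sqPoly n) = 2 * linForm α := by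
  rw [dirD_apply, linForm, Finset.mul_sum]
  refine Finset.sum_congr rfl fun i _ => ?_
  rw [pderiv_sq, smul_eq_C_mul]
  ring

/-- Leibniz rule for a quadratic factor. The coefficients vanish exactly where the truncated
exponents `k - 1`, `k - 2` would be wrong. -/
theorem Dα_pow_sq_mul (α : Fin n → ℝ) (k : ℕ) (f : BiPoly n) :
    (Dα α ^ k) (emb true (sqPoly n) * f) = emb true (sqPoly n) * (Dα α ^ k) f +
      (2 * k : ℂ) • (emb true (linForm α) * (Dα α ^ (k - 1)) f) +
      (k * (k - 1) * ((α ⬝ᵥ α : ℝ) : ℂ)) • (Dα α ^ (k - 2)) f := by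
  have hC : ∀ c : ℂ, emb true (C c : MvPolynomial (Fin n) ℂ) = C c := fun c => rename_C _ _
  have hC2 : (C 2 : BiPoly n) = 2 := map_ofNat C 2
  have hC4 : (C 4 : BiPoly n) = 4 := map_ofNat C 4
  induction k with
  | zero => simp
  | succ k ih =>
    rw [pow_succ', Module.End.mul_apply, ih, map_add, map_add, Dα_emb_true_mul, map_smul, map_smul,
      Dα_emb_true_mul, dirD_linForm, dirD_sq, map_mul, map_ofNat, hC]
    rcases k with _ | _ | k
    · norm_num [smul_eq_C_mul, hC2, hC4]
      ring
    · norm_num [smul_eq_C_mul, hC2, hC4]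
      ring
    · simp only [Nat.add_sub_cancel, ← Module.End.mul_apply, ← pow_succ', smul_eq_C_mul,
        show k + 1 + 1 - 2 = k from rfl, show k + 1 + 1 + 1 - 2 = k + 1 from rfl]
      simp only [Nat.cast_add, Nat.cast_one, map_add, map_sub, map_mul, map_one,
        map_natCast, map_ofNat]
      ring

/-- On the hyperplane the term with `(x, α)` drops out, and the others have order `2s + 1` or `2s -
1`, both odd; at `s = 0` the last coefficient is zero. -/
theorem QuasiAll.sq_mul {f : BiPoly n} (hf : QuasiAll A f) : QuasiAll A (emb true (sqPoly n) * f) := by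
  intro α hα s hs y hy
  rw [Dα_pow_sq_mul, map_add, map_add, map_smul, map_smul, map_mul, map_mul, hf α hα s hs y hy,
    fix_emb_self, fix_emb_self, eval_linForm, toComplex_dotProduct, hy]
  rcases s with _ | s
  · simp
  · rw [show 2 * (s + 1) + 1 - 2 = 2 * s + 1 by omega, hf α hα s (by omega) y hy]
    simp

/-- The operator is built from derivatives in `l`, multiplications by functions of `l`, and
multiplication by `x²`; each preserves the conditions in `x`. -/
theorem QuasiAll.T_false {f : BiPoly n} (hf : QuasiAll A f) : QuasiAll A (T A false f) := by
  rw [T, U_apply]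
  refine ((QuasiAll.emb_false_mul (.sum fun i _ => (hf.D_false i).D_false i) _).sub ?_).sub
    (hf.sq_mul.emb_false_mul _)
  have : (2 : BiPoly n) = emb false 2 := (map_ofNat _ _).symm
  rw [this]
  exact QuasiAll.emb_false_mul (.sum fun i _ => (hf.D_false i).emb_false_mul _) _

end Operators

/-! ### Uniqueness for the eigenvalue equation -/

section LinearODE

variable {n : ℕ}

theorem homogeneousComponent_mul_of_isHomogeneous {σ : Type*} {p : MvPolynomial σ ℂ} {a : ℕ}
    (hp : p.IsHomogeneous a) (q : MvPolynomial σ ℂ) (r : ℕ) :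
    homogeneousComponent (a + r) (p * q) = p * homogeneousComponent r q := by
  conv_lhs => rw [← sum_homogeneousComponent q, Finset.mul_sum, map_sum]
  have h : ∀ i, homogeneousComponent (a + r) (p * homogeneousComponent i q) =
      if r = i then p * homogeneousComponent i q else 0 := by
    intro i
    rw [homogeneousComponent_of_mem (hp.mul (homogeneousComponent_isHomogeneous i q))]
    simp
  simp only [h]
  rw [Finset.sum_ite_eq]
  split_ifs with hr
  · rfl
  · rw [homogeneousComponent_eq_zero _ _ (by simpa using hr), mul_zero]

/-- Restriction of a polynomial to the line `l + s x`. -/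
def lineHom (l x : Fin n → ℂ) : MvPolynomial (Fin n) ℂ →ₐ[ℂ] Polynomial ℂ :=
  aeval fun i => Polynomial.C (l i) + Polynomial.X * Polynomial.C (x i)

theorem eval_zero_lineHom (l x : Fin n → ℂ) (g : MvPolynomial (Fin n) ℂ) :
    (lineHom l x g).eval 0 = eval l g := by
  have : (Polynomial.aeval (0 : ℂ) : Polynomial ℂ →ₐ[ℂ] ℂ).comp (lineHom l x) = aeval l := by
    ext i
    simp [lineHom]
  exact DFunLike.congr_fun this g

theorem derivative_lineHom (l x : Fin n → ℂ) (g : MvPolynomial (Fin n) ℂ) :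
    Polynomial.derivative (lineHom l x g) = lineHom l x (∑ i, C (x i) * pderiv i g) := by
  classical
  have hC : ∀ c, lineHom l x (C c) = Polynomial.C c := fun c => by simp [lineHom]
  induction g using MvPolynomial.induction_on with
  | C a => simp [hC]
  | add p q hp hq => simp only [map_add, hp, hq, mul_add, Finset.sum_add_distrib]
  | mul_X p j hp =>
    have h1 : ∑ i, C (x i) * pderiv i (p * X j) =
        (∑ i, C (x i) * pderiv i p) * X j + C (x j) * p := by
      simp only [pderiv_mul, mul_add, Finset.sum_add_distrib, Finset.sum_mul]
      congr 1
      · exact Finset.sum_congr rfl fun i _ => by ring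
      · rw [Finset.sum_eq_single j]
        · rw [pderiv_X_self, mul_one]
        · intro i _ hi
          rw [pderiv_X_of_ne hi.symm, mul_zero, mul_zero]
        · simp
    rw [h1, map_add, map_mul (lineHom l x), map_mul (lineHom l x), map_mul (lineHom l x),
      Polynomial.derivative_mul, hp, hC]
    have hX : Polynomial.derivative (lineHom l x (X j)) = Polynomial.C (x j) := by simp [lineHom]
    rw [hX, mul_comm (lineHom l x p)]

theorem lineHom_monomial (l x : Fin n → ℂ) (m : Fin n → ℕ) (s : Finset (Fin n)) :
    (∏ i ∈ s, (Polynomial.C (l i) + Polynomial.X * Polynomial.C (x i)) ^ m i).natDegree ≤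
        ∑ i ∈ s, m i ∧
      (∏ i ∈ s, (Polynomial.C (l i) + Polynomial.X * Polynomial.C (x i)) ^ m i).coeff (∑ i ∈ s, m i) =
        ∏ i ∈ s, x i ^ m i := by
  classical
  induction s using Finset.induction_on with
  | empty => simp
  | insert j s hj ih =>
    have h1 : (Polynomial.C (l j) + Polynomial.X * Polynomial.C (x j)).natDegree ≤ 1 := by
      compute_degree
    have h2 : ((Polynomial.C (l j) + Polynomial.X * Polynomial.C (x j)) ^ m j).natDegree ≤ m j := by
      simpa using Polynomial.natDegree_pow_le_of_le (m j) h1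
    rw [Finset.prod_insert hj, Finset.sum_insert hj, Finset.prod_insert hj]
    refine ⟨Polynomial.natDegree_mul_le_of_le h2 ih.1, ?_⟩
    rw [Polynomial.coeff_mul_add_eq_of_natDegree_le h2 ih.1, ih.2]
    congr 1
    have := Polynomial.coeff_pow_of_natDegree_le (m := m j) h1
    rw [mul_one] at this
    rw [this]
    simp

theorem lineHom_isHomogeneous (l x : Fin n → ℂ) {g : MvPolynomial (Fin n) ℂ} {d : ℕ}
    (hg : g.IsHomogeneous d) : (lineHom l x g).natDegree ≤ d ∧ (lineHom l x g).coeff d = eval x g := by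
  have h1 : lineHom l x g = ∑ m ∈ g.support, Polynomial.C (coeff m g) *
      ∏ i, (Polynomial.C (l i) + Polynomial.X * Polynomial.C (x i)) ^ m i := by
    conv_lhs => rw [g.as_sum, map_sum]
    refine Finset.sum_congr rfl fun m _ => ?_
    rw [lineHom, aeval_monomial, Finsupp.prod_pow]
    rfl
  have hd : ∀ m ∈ g.support, ∑ i, m i = d := by
    intro m hm
    rw [← hg (mem_support_iff.1 hm), Finsupp.weight_apply, Finsupp.sum_fintype _ _ (by simp)]
    simp
  constructor
  · rw [h1]
    refine Polynomial.natDegree_sum_le_of_forall_le _ _ fun m hm => ?_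
    refine (Polynomial.natDegree_C_mul_le _ _).trans ?_
    rw [← hd m hm]
    exact (lineHom_monomial l x m Finset.univ).1
  · rw [h1, Polynomial.finsetSum_coeff, eval_eq']
    refine Finset.sum_congr rfl fun m hm => ?_
    rw [Polynomial.coeff_C_mul]
    congr 1
    rw [← hd m hm]
    exact (lineHom_monomial l x m Finset.univ).2

variable {A : Configuration n}

/-- Uniqueness of the solution of degree at most `|m|` in `l` of the eigenvalue equation. -/
theorem eq_zero_of_eigen {x : Fin n → ℂ} (hx : eval x A.AmPoly ≠ 0) {h : MvPolynomial (Fin n) ℂ}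
    (heq : A.AmPoly * (∑ i, pderiv i (pderiv i h) + 2 * ∑ i, C (x i) * pderiv i h) -
      2 * ∑ i, pderiv i A.AmPoly * pderiv i h - 2 * (∑ i, C (x i) * pderiv i A.AmPoly) * h = 0)
    (hdeg : h.totalDegree ≤ A.totalMult) (htop : eval x (homogeneousComponent A.totalMult h) = 0) :
    h = 0 := by
  have h2 : ∀ g : MvPolynomial (Fin n) ℂ, 2 * g = C 2 * g := fun g => by rw [map_ofNat]
  by_contra h0
  set d := h.totalDegree with hd
  set hd' := homogeneousComponent d h with hdd
  have hne : hd' ≠ 0 := homogeneousComponent_totalDegree_ne_zero h0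
  have hhom : hd'.IsHomogeneous d := homogeneousComponent_isHomogeneous d h
  have hA := A.isHomogeneous_AmPoly
  -- The part of the equation of degree `|m| + d - 1`: the Laplacian and the term pairing the
  -- gradients of `A_m` and `h` only reach degree `|m| + d - 2`. Degrees zero are treated apart.
  have key : A.AmPoly * ∑ i, C (x i) * pderiv i hd' = (∑ i, C (x i) * pderiv i A.AmPoly) * hd' := by
    rcases Nat.eq_zero_or_pos A.totalMult with hN | hN
    · have hz : ∀ (g : MvPolynomial (Fin n) ℂ), g.totalDegree = 0 → ∀ i, pderiv i g = 0 := by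
        intro g hg i
        rw [totalDegree_eq_zero_iff_eq_C.1 hg, pderiv_C]
      have e1 := hz A.AmPoly (by rw [A.totalDegree_AmPoly, hN])
      have e2 := hz hd' (by rw [hhom.totalDegree hne]; omega)
      simp [e1, e2]
    · obtain ⟨M, hM⟩ := Nat.exists_eq_succ_of_ne_zero hN.ne'
      have hAi : ∀ i, (pderiv i A.AmPoly).IsHomogeneous M := fun i => by
        have := hA.pderiv (i := i)
        rwa [hM] at this
      have hCAi : ∀ i, (C (x i) * pderiv i A.AmPoly).IsHomogeneous M := fun i => (hAi i).C_mul _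
      have hz : ∀ r, d < r → homogeneousComponent r h = 0 := fun r hr =>
        homogeneousComponent_eq_zero _ _ hr
      rcases Nat.eq_zero_or_pos d with h00 | hpos
      · have hC := totalDegree_eq_zero_iff_eq_C.1 (hd.symm.trans h00)
        have hdh : hd' = h := by
          rw [hdd, h00, homogeneousComponent_zero, ← hC]
        have hdi : ∀ i, pderiv i h = 0 := fun i => by rw [hC, pderiv_C]
        simp only [hdi, map_zero, mul_zero, Finset.sum_const_zero, add_zero, sub_self, zero_sub,
          neg_eq_zero, mul_assoc] at heq
        have h3 := (mul_eq_zero.1 heq).resolve_left two_ne_zero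
        rw [hdh, h3]
        simp [hdi]
      · obtain ⟨r, hr⟩ := Nat.exists_eq_succ_of_ne_zero hpos.ne'
        have e := congrArg (homogeneousComponent (A.totalMult + r)) heq
        have e3 : ∀ i, homogeneousComponent (A.totalMult + r) (pderiv i A.AmPoly * pderiv i h) = 0 := by
          intro i
          rw [hM, show M.succ + r = M + (r + 1) by omega, homogeneousComponent_mul_of_isHomogeneous (hAi i),
            homogeneousComponent_pderiv, hz _ (by omega), map_zero, mul_zero]
        have e4 : homogeneousComponent (A.totalMult + r) ((∑ i, C (x i) * pderiv i A.AmPoly) * h) =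
            (∑ i, C (x i) * pderiv i A.AmPoly) * hd' := by
          rw [hM, show M.succ + r = M + (r + 1) by omega, homogeneousComponent_mul_of_isHomogeneous
            (IsHomogeneous.sum _ _ _ fun i _ => hCAi i), hdd, hr]
        have e5 : homogeneousComponent r (∑ i, pderiv i (pderiv i h) + 2 * ∑ i, C (x i) * pderiv i h) =
            2 * ∑ i, C (x i) * pderiv i hd' := by
          rw [map_add, map_sum, h2, h2, homogeneousComponent_C_mul, map_sum]
          have e6 : ∀ i, homogeneousComponent r (pderiv i (pderiv i h)) = 0 := fun i => by
            rw [homogeneousComponent_pderiv, homogeneousComponent_pderiv, hz _ (by omega), map_zero,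
              map_zero]
          simp only [e6, Finset.sum_const_zero, zero_add, homogeneousComponent_C_mul,
            homogeneousComponent_pderiv]
          rw [hdd, hr]
        have e6 : homogeneousComponent (A.totalMult + r)
            (2 * ∑ i, pderiv i A.AmPoly * pderiv i h) = 0 := by
          rw [h2, homogeneousComponent_C_mul, map_sum]
          simp only [e3, Finset.sum_const_zero, mul_zero]
        have e7 : homogeneousComponent (A.totalMult + r)
            (2 * (∑ i, C (x i) * pderiv i A.AmPoly) * h) =
            2 * ((∑ i, C (x i) * pderiv i A.AmPoly) * hd') := by
          rw [mul_assoc, h2, homogeneousComponent_C_mul, e4, ← h2]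
        rw [map_sub, map_sub, map_zero, homogeneousComponent_mul_of_isHomogeneous hA, e5, e6, e7,
          sub_zero, mul_left_comm, ← mul_sub] at e
        exact sub_eq_zero.1 ((mul_eq_zero.1 e).resolve_left two_ne_zero)
  refine hne (funext fun l => ?_)
  rw [map_zero, ← eval_zero_lineHom l x]
  set p := lineHom l x hd' with hp
  set a := lineHom l x A.AmPoly with ha
  obtain ⟨hpd, hpc⟩ := lineHom_isHomogeneous l x hhom
  obtain ⟨had, hac⟩ := lineHom_isHomogeneous l x hA
  rw [← hp] at hpd hpc
  rw [← ha] at had hac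
  have hW : a * Polynomial.derivative p = Polynomial.derivative a * p := by
    rw [hp, ha, derivative_lineHom, derivative_lineHom, ← map_mul, ← map_mul, key]
  suffices hp0 : p = 0 by rw [hp0, Polynomial.eval_zero]
  by_contra hpne
  have hXd : ∀ (g : Polynomial ℂ) (k : ℕ), (Polynomial.X * Polynomial.derivative g).coeff k =
      k * g.coeff k := by
    intro g k
    rcases k with _ | k
    · simp
    · rw [Polynomial.coeff_X_mul, Polynomial.coeff_derivative]
      push_cast
      ring
  have hXdeg : ∀ (g : Polynomial ℂ) (k : ℕ), g.natDegree ≤ k →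
      (Polynomial.X * Polynomial.derivative g).natDegree ≤ k := by
    intro g k hg
    rw [Polynomial.natDegree_le_iff_coeff_eq_zero]
    intro j hj
    rw [hXd, Polynomial.coeff_eq_zero_of_natDegree_lt (by omega), mul_zero]
  -- On the line `l + s x` this says that `a` and `p` have equal logarithmic derivatives. After
  -- multiplication by the variable, comparing leading coefficients gives `deg p = deg a = |m|`,
  -- where `a` has leading coefficient `A_m(x) ≠ 0`. Then `d = |m|`, and the leading coefficient of
  -- `p` is the value excluded by `htop`.
  have hW' : a * (Polynomial.X * Polynomial.derivative p) =
      (Polynomial.X * Polynomial.derivative a) * p := by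
    rw [mul_left_comm, hW, mul_assoc]
  have hc := congrArg (fun g => Polynomial.coeff g (A.totalMult + p.natDegree)) hW'
  simp only [Polynomial.coeff_mul_add_eq_of_natDegree_le had (hXdeg p _ le_rfl),
    Polynomial.coeff_mul_add_eq_of_natDegree_le (hXdeg a _ had) le_rfl, hXd, hac] at hc
  have hlc : p.coeff p.natDegree ≠ 0 := by
    rw [Polynomial.coeff_natDegree]
    exact Polynomial.leadingCoeff_ne_zero.2 hpne
  have hNe : (p.natDegree : ℂ) = A.totalMult := by
    have : ((p.natDegree : ℂ) - A.totalMult) * (eval x A.AmPoly * p.coeff p.natDegree) = 0 := by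
      linear_combination hc
    exact sub_eq_zero.1 ((mul_eq_zero.1 this).resolve_right (mul_ne_zero hx hlc))
  have hNe' : p.natDegree = A.totalMult := by exact_mod_cast hNe
  have hdN : d = A.totalMult := by omega
  apply hlc
  rw [hNe', ← hdN, hpc, hdd, hdN, htop]

end LinearODE

/-! ### Bispectrality: both operators annihilate the function -/

section Bispectrality

variable {n : ℕ}

/-- The span of the products `u(x) v(l)` with `u`, `v` homogeneous of the same degree less
than `d`. -/
def low (n d : ℕ) : Submodule ℂ (BiPoly n) :=
  Submodule.span ℂ {f | ∃ k < d, ∃ u v : MvPolynomial (Fin n) ℂ, u.IsHomogeneous k ∧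
    v.IsHomogeneous k ∧ f = emb true u * emb false v}

/-- The polynomials of degree less than `d` in the variables `(!b, ·)`. -/
def degLT (b : Bool) (d : ℕ) : Submodule ℂ (BiPoly n) :=
  Submodule.span ℂ {f | ∃ u v : MvPolynomial (Fin n) ℂ, v.totalDegree < d ∧
    f = emb b u * emb (!b) v}

theorem low_le (b : Bool) {d : ℕ} {W : Submodule ℂ (BiPoly n)}
    (h : ∀ k < d, ∀ u v : MvPolynomial (Fin n) ℂ, u.IsHomogeneous k → v.IsHomogeneous k →
      emb b u * emb (!b) v ∈ W) : low n d ≤ W := by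
  refine Submodule.span_le.2 ?_
  rintro _ ⟨k, hk, u, v, hu, hv, rfl⟩
  cases b
  · rw [mul_comm]
    exact h k hk v u hv hu
  · exact h k hk u v hu hv

theorem emb_mul_emb_mem_degLT (b : Bool) {d : ℕ} (u : MvPolynomial (Fin n) ℂ)
    {v : MvPolynomial (Fin n) ℂ} (hv : v.totalDegree < d) : emb b u * emb (!b) v ∈ degLT b d :=
  Submodule.subset_span ⟨u, v, hv, rfl⟩

theorem low_le_degLT (b : Bool) (d : ℕ) : low n d ≤ degLT b d :=
  low_le b fun _ hk u _ _ hv => emb_mul_emb_mem_degLT b u (hv.totalDegree_le.trans_lt hk)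

theorem degLT_le {b : Bool} {d : ℕ} {W : Submodule ℂ (BiPoly n)}
    (h : ∀ u v : MvPolynomial (Fin n) ℂ, v.totalDegree < d → emb b u * emb (!b) v ∈ W) :
    degLT b d ≤ W := by
  refine Submodule.span_le.2 ?_
  rintro _ ⟨u, v, hv, rfl⟩
  exact h u v hv

theorem degLT_mono (b : Bool) {d e : ℕ} (h : d ≤ e) : (degLT b d : Submodule ℂ (BiPoly n)) ≤ degLT b e :=
  degLT_le fun u _ hv => emb_mul_emb_mem_degLT b u (hv.trans_le h)

theorem emb_mul_mem_degLT {b : Bool} {d : ℕ} (w : MvPolynomial (Fin n) ℂ) {f : BiPoly n}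
    (hf : f ∈ degLT b d) : emb b w * f ∈ degLT b d := by
  have : degLT b d ≤ (degLT b d).comap (LinearMap.mulLeft ℂ (emb b w)) := by
    refine degLT_le fun u v hv => ?_
    rw [Submodule.mem_comap, LinearMap.mulLeft_apply, ← mul_assoc, ← map_mul]
    exact emb_mul_emb_mem_degLT b _ hv
  exact this hf

theorem X_mul_mem_degLT {b : Bool} {d : ℕ} (i : Fin n) {f : BiPoly n}
    (hf : f ∈ degLT b d) : X (!b, i) * f ∈ degLT b (d + 1) := by
  have : degLT b d ≤ (degLT b (d + 1)).comap (LinearMap.mulLeft ℂ (X (!b, i))) := by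
    refine degLT_le fun u v hv => ?_
    rw [Submodule.mem_comap, LinearMap.mulLeft_apply, mul_left_comm, ← emb_X, ← map_mul]
    refine emb_mul_emb_mem_degLT b _ ((totalDegree_mul _ _).trans_lt ?_)
    rw [totalDegree_X]
    omega
  exact this hf

theorem pderiv_mem_degLT {b : Bool} {d : ℕ} (i : Fin n) {f : BiPoly n}
    (hf : f ∈ degLT b d) : pderiv (b, i) f ∈ degLT b d := by
  have : degLT b d ≤ (degLT b d).comap
      (pderiv (b, i) : Derivation ℂ (BiPoly n) (BiPoly n)).toLinearMap := by
    refine degLT_le fun u v hv => ?_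
    have : pderiv (b, i) (emb b u * emb (!b) v) = emb b (pderiv i u) * emb (!b) v := by
      rw [pderiv_mul, pderiv_emb_self, pderiv_emb_not, mul_zero, add_zero]
    rw [Submodule.mem_comap]
    change pderiv (b, i) (emb b u * emb (!b) v) ∈ _
    rw [this]
    exact emb_mul_emb_mem_degLT b _ hv
  exact this hf

theorem totalDegree_fix_le {b : Bool} {d : ℕ} {f : BiPoly n} (hf : f ∈ degLT b (d + 1))
    (w : Fin n → ℂ) : (fix b w f).totalDegree ≤ d := by
  have : degLT b (d + 1) ≤
      (restrictTotalDegree (Fin n) ℂ d).comap (fix b w).toLinearMap := by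
    refine degLT_le fun u v hv => ?_
    rw [Submodule.mem_comap, mem_restrictTotalDegree]
    change (fix b w (emb b u * emb (!b) v)).totalDegree ≤ d
    rw [map_mul, fix_emb_self, fix_emb_not]
    refine (totalDegree_mul _ _).trans ?_
    rw [totalDegree_C]
    omega
  exact (mem_restrictTotalDegree _ _ _).1 (this hf)

variable (A : Configuration n)

/-- Expanding the conjugated Laplacian cancels the quadratic form in the other variables, so `T`
raises the degree in those variables by at most one. -/
theorem T_eq (b : Bool) (f : BiPoly n) : T A b f =
    emb b A.AmPoly * (∑ i, pderiv (b, i) (pderiv (b, i) f) +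
      2 * ∑ i, X (!b, i) * pderiv (b, i) f) -
    2 * ∑ i, emb b (pderiv i A.AmPoly) * pderiv (b, i) f -
    2 * (∑ i, X (!b, i) * emb b (pderiv i A.AmPoly)) * f := by
  have h1 : ∀ i, D b i (D b i f) = pderiv (b, i) (pderiv (b, i) f) +
      2 * (X (!b, i) * pderiv (b, i) f) + X (!b, i) ^ 2 * f := by
    intro i
    rw [D_apply, D_apply, map_add, pderiv_mul, pderiv_X_of_ne (by cases b <;> simp)]
    ring
  have h2 : emb (!b) (sqPoly n) = ∑ i, X (!b, i) ^ 2 := by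
    simp only [sqPoly, map_sum, map_pow, emb_X]
  have h3 : ∑ i, emb b (pderiv i A.AmPoly) * D b i f =
      ∑ i, emb b (pderiv i A.AmPoly) * pderiv (b, i) f +
        (∑ i, X (!b, i) * emb b (pderiv i A.AmPoly)) * f := by
    rw [Finset.sum_mul, ← Finset.sum_add_distrib]
    refine Finset.sum_congr rfl fun i _ => ?_
    rw [D_apply]
    ring
  rw [T, U_apply, h3, h2]
  simp only [h1, Finset.sum_add_distrib, ← Finset.mul_sum, ← Finset.sum_mul]
  ring

theorem T_mem_degLT {b : Bool} {d : ℕ} {f : BiPoly n} (hf : f ∈ degLT b d) :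
    T A b f ∈ degLT b (d + 1) := by
  have h2 : ∀ g : BiPoly n, 2 * g = (2 : ℂ) • g := fun g => by
    rw [smul_eq_C_mul, map_ofNat]
  have hle := degLT_mono (n := n) b d.le_succ
  rw [T_eq, mul_assoc, Finset.sum_mul]
  simp only [h2]
  refine Submodule.sub_mem _ (Submodule.sub_mem _ (emb_mul_mem_degLT _ (Submodule.add_mem _ ?_ ?_)) ?_) ?_
  · exact hle (Submodule.sum_mem _ fun i _ => pderiv_mem_degLT i (pderiv_mem_degLT i hf))
  · exact Submodule.smul_mem _ _ (Submodule.sum_mem _ fun i _ =>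
      X_mul_mem_degLT i (pderiv_mem_degLT i hf))
  · exact Submodule.smul_mem _ _ (hle (Submodule.sum_mem _ fun i _ =>
      emb_mul_mem_degLT _ (pderiv_mem_degLT i hf)))
  · refine Submodule.smul_mem _ _ (Submodule.sum_mem _ fun i _ => ?_)
    rw [mul_assoc]
    exact X_mul_mem_degLT i (emb_mul_mem_degLT _ hf)

/-- On the top term `A_m(x) A_m(l)` the two contributions of degree `|m| + 1` in the other variables
cancel. This is what keeps `T P` within the degree bound of the uniqueness statements. -/
theorem T_AmPoly_mem (b : Bool) :
    T A b (emb b A.AmPoly * emb (!b) A.AmPoly) ∈ degLT b (A.totalMult + 1) := by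
  have h1 : ∀ (i) (g : MvPolynomial (Fin n) ℂ), pderiv (b, i) (emb b g * emb (!b) A.AmPoly) =
      emb b (pderiv i g) * emb (!b) A.AmPoly := by
    intro i g
    rw [pderiv_mul, pderiv_emb_self, pderiv_emb_not, mul_zero, add_zero]
  have h2 : T A b (emb b A.AmPoly * emb (!b) A.AmPoly) =
      emb b (A.AmPoly * ∑ i, pderiv i (pderiv i A.AmPoly) -
        2 * ∑ i, pderiv i A.AmPoly * pderiv i A.AmPoly) * emb (!b) A.AmPoly := by
    rw [T_eq]
    simp only [h1, map_sub, map_mul, map_sum, map_ofNat, Finset.mul_sum, Finset.sum_mul, mul_add, sub_mul]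
    have e : ∀ i, emb b A.AmPoly * (2 * (X (!b, i) * (emb b (pderiv i A.AmPoly) * emb (!b) A.AmPoly))) =
      2 * (X (!b, i) * emb b (pderiv i A.AmPoly)) * (emb b A.AmPoly * emb (!b) A.AmPoly) :=
        fun i => by ring
    simp only [e, mul_assoc]
    ring
  rw [h2]
  exact emb_mul_emb_mem_degLT b _ (by rw [A.totalDegree_AmPoly]; exact Nat.lt_succ_self _)

theorem T_sub (b : Bool) (f g : BiPoly n) : T A b (f - g) = T A b f - T A b g := by
  rw [T, T, T, map_sub]
  ring

theorem T_smul (b : Bool) (c : ℂ) (f : BiPoly n) : T A b (c • f) = c • T A b f := by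
  rw [T, T, map_smul, smul_sub]
  congr 1
  rw [smul_eq_C_mul, smul_eq_C_mul]
  ring

theorem fix_T (b : Bool) (v : Fin n → ℂ) (f : BiPoly n) : fix b v (T A (!b) f) =
    A.AmPoly * (∑ i, pderiv i (pderiv i (fix b v f)) + 2 * ∑ i, C (v i) * pderiv i (fix b v f)) -
      2 * ∑ i, pderiv i A.AmPoly * pderiv i (fix b v f) -
      2 * (∑ i, C (v i) * pderiv i A.AmPoly) * fix b v f := by
  rw [T_eq]
  simp only [map_sub, map_mul, map_add, map_sum, map_ofNat, fix_emb_not, fix_pderiv, Bool.not_not,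
    fix_X_self]

variable {A} {P : BiPoly n}

theorem euler_of_mem_low (b : Bool) {d : ℕ} {f : BiPoly n} (hf : f ∈ low n d) :
    ∑ i, X (b, i) * pderiv (b, i) f - ∑ i, X (!b, i) * pderiv (!b, i) f = 0 := by
  let E : BiPoly n →ₗ[ℂ] BiPoly n :=
    ∑ i, LinearMap.mulLeft ℂ (X (b, i)) ∘ₗ (pderiv (b, i) : Derivation ℂ (BiPoly n) (BiPoly n)).toLinearMap -
    ∑ i, LinearMap.mulLeft ℂ (X (!b, i)) ∘ₗ
      (pderiv (!b, i) : Derivation ℂ (BiPoly n) (BiPoly n)).toLinearMap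
  have hE : ∀ g, E g = ∑ i, X (b, i) * pderiv (b, i) g - ∑ i, X (!b, i) * pderiv (!b, i) g := by
    intro g
    simp [E, LinearMap.sum_apply]
  have : low n d ≤ LinearMap.ker E := by
    refine low_le b fun k _ u v hu hv => ?_
    have e1 : ∀ i, X (b, i) * pderiv (b, i) (emb b u * emb (!b) v) =
        emb b (X i * pderiv i u) * emb (!b) v := by
      intro i
      rw [pderiv_mul, pderiv_emb_self, pderiv_emb_not, map_mul, emb_X]
      ring
    have e2 : ∀ i, X (!b, i) * pderiv (!b, i) (emb b u * emb (!b) v) =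
        emb b u * emb (!b) (X i * pderiv i v) := by
      intro i
      have := pderiv_emb_not (!b) i u
      rw [Bool.not_not] at this
      rw [pderiv_mul, pderiv_emb_self, this, map_mul, emb_X]
      ring
    rw [LinearMap.mem_ker, hE]
    simp only [e1, e2]
    rw [← Finset.sum_mul, ← Finset.mul_sum, ← map_sum, ← map_sum, hu.sum_X_mul_pderiv,
      hv.sum_X_mul_pderiv, map_nsmul, map_nsmul, nsmul_eq_mul, nsmul_eq_mul]
    ring
  rw [← hE]
  exact this hf

/-- Setting one set of variables to zero kills all products of positive degree, and degree zero is
constant in both sets. -/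
theorem fix_zero_of_mem_low (b : Bool) {d : ℕ} {f : BiPoly n} (hf : f ∈ low n d) :
    fix b 0 f = C (eval 0 f) := by
  have : low n d ≤ LinearMap.eqLocus (fix b (0 : Fin n → ℂ)).toLinearMap
      ((Algebra.linearMap ℂ (MvPolynomial (Fin n) ℂ)) ∘ₗ
        (aeval (0 : Bool × Fin n → ℂ) : BiPoly n →ₐ[ℂ] ℂ).toLinearMap) := by
    refine low_le b fun k _ u v hu hv => ?_
    rw [LinearMap.mem_eqLocus]
    change fix b 0 (emb b u * emb (!b) v) = C (eval 0 (emb b u * emb (!b) v))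
    have h0 : ∀ (b' : Bool) (w : MvPolynomial (Fin n) ℂ), eval 0 (emb b' w) = eval 0 w := fun b' w => by
      rw [emb, eval_rename]
      rfl
    rw [map_mul, map_mul, fix_emb_self, fix_emb_not, h0, h0]
    rcases Nat.eq_zero_or_pos k with rfl | hk
    · rw [totalDegree_eq_zero_iff_eq_C.1 ((totalDegree_zero_iff_isHomogeneous _).2 hv)]
      simp
    · have : eval 0 u = 0 := by
        have := eval_smul_of_isHomogeneous hu 0 0
        rw [smul_zero, zero_pow hk.ne', zero_mul] at this
        exact this
      rw [this]
      simp
  exact this hf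

theorem mem_low_succ (hP : P - emb true A.AmPoly * emb false A.AmPoly ∈ low n A.totalMult) :
    P ∈ low n (A.totalMult + 1) := by
  have h1 : low n A.totalMult ≤ low n (A.totalMult + 1) :=
    low_le true fun k hk u v hu hv => Submodule.subset_span ⟨k, by omega, u, v, hu, hv, rfl⟩
  have h2 : emb true A.AmPoly * emb false A.AmPoly ∈ low n (A.totalMult + 1) :=
    Submodule.subset_span ⟨_, Nat.lt_succ_self _, _, _, A.isHomogeneous_AmPoly,
      A.isHomogeneous_AmPoly, rfl⟩
  simpa using Submodule.add_mem _ (h1 hP) h2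

theorem T_mem (b : Bool) (hP : P - emb true A.AmPoly * emb false A.AmPoly ∈ low n A.totalMult) :
    T A b P ∈ degLT b (A.totalMult + 1) := by
  have h1 := T_mem_degLT A (low_le_degLT b _ hP)
  rw [T_sub] at h1
  have h2 := T_AmPoly_mem A b
  have h3 : emb b A.AmPoly * emb (!b) A.AmPoly = emb true A.AmPoly * emb false A.AmPoly := by
    cases b
    · exact mul_comm _ _
    · rfl
  rw [h3] at h2
  simpa using Submodule.add_mem _ h1 h2

theorem homogeneousComponent_fix (b : Bool) (v : Fin n → ℂ)
    (hP : P - emb true A.AmPoly * emb false A.AmPoly ∈ low n A.totalMult) :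
    homogeneousComponent A.totalMult (fix b v P) = C (eval v A.AmPoly) * A.AmPoly := by
  have h1 : low n A.totalMult ≤ LinearMap.ker
      (homogeneousComponent A.totalMult ∘ₗ (fix b v).toLinearMap) := by
    refine low_le b fun k hk u w hu hw => ?_
    rw [LinearMap.mem_ker]
    change homogeneousComponent A.totalMult (fix b v (emb b u * emb (!b) w)) = 0
    rw [map_mul, fix_emb_self, fix_emb_not, homogeneousComponent_C_mul,
      homogeneousComponent_of_mem hw, if_neg (by omega), mul_zero]
  have h2 : homogeneousComponent A.totalMult
    (fix b v (P - emb true A.AmPoly * emb false A.AmPoly)) = 0 := h1 hP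
  have h3 : emb true A.AmPoly * emb false A.AmPoly = emb b A.AmPoly * emb (!b) A.AmPoly := by
    cases b
    · exact mul_comm _ _
    · rfl
  rw [map_sub, map_sub, sub_eq_zero, h3, map_mul, fix_emb_self, fix_emb_not,
    homogeneousComponent_C_mul, homogeneousComponent_eq_self A.isHomogeneous_AmPoly] at h2
  exact h2

theorem totalDegree_fix (b : Bool) (v : Fin n → ℂ)
    (hP : P - emb true A.AmPoly * emb false A.AmPoly ∈ low n A.totalMult) :
    (fix b v P).totalDegree ≤ A.totalMult :=
  totalDegree_fix_le (low_le_degLT b _ (mem_low_succ hP)) v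

theorem fix_zero_T (b : Bool)
    (hP : P - emb true A.AmPoly * emb false A.AmPoly ∈ low n A.totalMult) :
    fix (!b) 0 (T A b P) = 0 := by
  have h := fix_T A (!b) 0 P
  rw [Bool.not_not, fix_zero_of_mem_low _ (mem_low_succ hP)] at h
  rw [h]
  simp

theorem eval_zero_fix (b : Bool) (v : Fin n → ℂ) (f : BiPoly n) :
    eval 0 (fix b v f) = eval v (fix (!b) 0 f) := eval_fix_not b v 0 f

theorem eq_zero_of_forall_ne_zero (b : Bool) {f : BiPoly n}
    (h : ∀ v, eval v A.AmPoly ≠ 0 → fix b v f = 0) : f = 0 := by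
  have h1 : emb b A.AmPoly * f = 0 := by
    refine eq_zero_of_fix b fun v => ?_
    rw [map_mul, fix_emb_self]
    by_cases hv : eval v A.AmPoly = 0
    · rw [hv, map_zero, zero_mul]
    · rw [h v hv, mul_zero]
  refine (mul_eq_zero.1 h1).resolve_left fun h2 => A.AmPoly_ne_zero ?_
  exact rename_injective _ (fun _ _ h => (Prod.mk.inj h).2) (by rw [map_zero]; exact h2)

/-- For `A_m(l) ≠ 0`, quasi-invariance and the degree bound make `T P` a multiple of `P`. At `x = 0`
the former vanishes and the latter is the nonzero constant `P(0, 0)`, so the multiple is zero. -/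
theorem T_false_eq_zero (hP : P - emb true A.AmPoly * emb false A.AmPoly ∈ low n A.totalMult)
    (hq : QuasiAll A P) (hc : eval 0 P ≠ 0) : T A false P = 0 := by
  refine eq_zero_of_forall_ne_zero (A := A) false fun l hl => ?_
  have hdeg := totalDegree_fix_le (T_mem false hP) l
  have hl' : A.Am l ≠ 0 := by rwa [← A.eval_AmPoly]
  obtain ⟨κ, hκ⟩ := (quasiAll_iff.1 hq.T_false l).exists_homogeneousComponent_eq hl' hdeg
  have h1 : fix false l (T A false P) - (κ / A.Am l) • fix false l P = 0 := by
    refine Quasi.eq_zero ((quasiAll_iff.1 hq.T_false l).sub_smul (quasiAll_iff.1 hq l) _) hl'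
      ((totalDegree_sub _ _).trans (max_le hdeg ((totalDegree_smul_le _ _).trans
        (totalDegree_fix false l hP)))) ?_
    rw [map_sub, map_smul, hκ, homogeneousComponent_fix false l hP, A.eval_AmPoly, smul_eq_C_mul,
      ← mul_assoc, ← C_mul, div_mul_cancel₀ _ hl', sub_self]
  have h2 := congrArg (eval 0) h1
  rw [map_sub, smul_eval, eval_zero_fix, eval_zero_fix, fix_zero_T false hP,
    fix_zero_of_mem_low _ (mem_low_succ hP), map_zero, map_zero, eval_C, zero_sub, neg_eq_zero] at h2
  rwa [(mul_eq_zero.1 h2).resolve_right hc, zero_smul, sub_zero] at h1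

/-- By `T_comm` and the Euler identity, `T A true P` is again annihilated by `T A false`. For
`A_m(x) ≠ 0`, subtracting the multiple of `P` with the same top form evaluated at `l = x` leaves
zero by `eq_zero_of_eigen`; evaluation at `l = 0` kills the multiple. -/
theorem T_true_eq_zero (hP : P - emb true A.AmPoly * emb false A.AmPoly ∈ low n A.totalMult)
    (hq : QuasiAll A P) (hc : eval 0 P ≠ 0) : T A true P = 0 := by
  refine eq_zero_of_forall_ne_zero (A := A) true fun x hx => ?_
  have hdeg := totalDegree_fix_le (T_mem true hP) x
  have hT : T A false (T A true P) = 0 := by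
    have := T_comm A true P
    rw [euler_of_mem_low true (mem_low_succ hP)] at this
    simp only [Bool.not_true] at this
    rw [this, T_false_eq_zero hP hq hc]
    simp [T]
  set κ := eval x (homogeneousComponent A.totalMult (fix true x (T A true P))) /
    (eval x A.AmPoly * eval x A.AmPoly) with hκ
  have h1 : fix true x (T A true P - κ • P) = 0 := by
    have h0 : fix true x (T A (!true) (T A true P - κ • P)) = 0 := by
      rw [Bool.not_true, T_sub, T_smul, hT, T_false_eq_zero hP hq hc]
      simp
    rw [fix_T] at h0
    refine eq_zero_of_eigen hx h0 ?_ ?_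
    · rw [map_sub, map_smul]
      exact (totalDegree_sub _ _).trans (max_le hdeg ((totalDegree_smul_le _ _).trans
        (totalDegree_fix true x hP)))
    · rw [map_sub, map_smul, map_sub, map_smul, map_sub, smul_eval, homogeneousComponent_fix true x hP,
        map_mul, eval_C, hκ, div_mul_cancel₀ _ (mul_ne_zero hx hx), sub_self]
  have h2 := congrArg (eval 0) h1
  rw [eval_zero_fix, map_sub, map_smul, Bool.not_true] at h2
  have h3 := fix_zero_T true hP
  rw [Bool.not_true] at h3
  rw [h3, fix_zero_of_mem_low _ (mem_low_succ hP), map_zero, map_sub, map_zero, smul_eval, eval_C,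
    zero_sub, neg_eq_zero] at h2
  rwa [(mul_eq_zero.1 h2).resolve_right hc, zero_smul, sub_zero] at h1

end Bispectrality

/-! ### From the Baker-Akhiezer function to its polynomial -/

section Construction

variable {n : ℕ}

theorem hasDerivAt_eval {𝕜 : Type*} [NontriviallyNormedField 𝕜] [NormedAlgebra 𝕜 ℂ]
    {σ : Type*} [Fintype σ] (p : MvPolynomial σ ℂ) {c : 𝕜 → σ → ℂ} {c' : σ → ℂ} {t : 𝕜}
    (hc : ∀ i, HasDerivAt (fun s => c s i) (c' i) t) :
    HasDerivAt (fun s => eval (c s) p) (∑ i, c' i * eval (c t) (pderiv i p)) t := by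
  classical
  induction p using MvPolynomial.induction_on with
  | C a => simpa using hasDerivAt_const t a
  | add p q hp hq =>
    simp only [map_add, mul_add, Finset.sum_add_distrib]
    exact hp.add hq
  | mul_X p j hp =>
    simp only [map_mul, eval_X]
    have h := hp.mul (hc j)
    refine h.congr_deriv ?_
    simp only [pderiv_mul, map_add, map_mul, eval_X, mul_add, Finset.sum_add_distrib, Finset.sum_mul]
    congr 1
    · exact Finset.sum_congr rfl fun i _ => by ring
    · rw [Finset.sum_eq_single j]
      · rw [pderiv_X_self, map_one]
        ring
      · intro i _ hi
        rw [pderiv_X_of_ne hi.symm, map_zero, mul_zero, mul_zero]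
      · simp

theorem hasDerivAt_eval_mul_exp {𝕜 : Type*} [NontriviallyNormedField 𝕜] [NormedAlgebra 𝕜 ℂ]
    (p : MvPolynomial (Fin n) ℂ) (l : Fin n → ℂ) {c : 𝕜 → Fin n → ℂ}
    {c' : Fin n → ℂ} {t : 𝕜} (hc : ∀ i, HasDerivAt (fun s => c s i) (c' i) t) :
    HasDerivAt (fun s => eval (c s) p * Complex.exp (c s ⬝ᵥ l))
      ((∑ i, c' i * eval (c t) (pderiv i p + C (l i) * p)) * Complex.exp (c t ⬝ᵥ l)) t := by
  have h1 : HasDerivAt (fun s => c s ⬝ᵥ l) (c' ⬝ᵥ l) t := by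
    simp only [dotProduct]
    exact HasDerivAt.fun_sum fun i _ => (hc i).mul_const (l i)
  have h2 : HasDerivAt (fun s => Complex.exp (c s ⬝ᵥ l)) (Complex.exp (c t ⬝ᵥ l) * (c' ⬝ᵥ l)) t := by
    exact (Complex.hasDerivAt_exp _).comp_of_eq t h1 rfl
  refine ((hasDerivAt_eval p hc).mul h2).congr_deriv ?_
  simp only [map_add, map_mul, eval_C, mul_add, Finset.sum_add_distrib, dotProduct]
  have : ∑ i, c' i * (l i * eval (c t) p) = (∑ i, c' i * l i) * eval (c t) p := by
    rw [Finset.sum_mul]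
    exact Finset.sum_congr rfl fun i _ => by ring
  rw [this]
  ring

theorem dirDeriv_eval_mul_exp (α : Fin n → ℝ) (k : ℕ) (p : MvPolynomial (Fin n) ℂ)
    (l x : Fin n → ℂ) : dirDeriv α k (fun y => eval y p * Complex.exp (y ⬝ᵥ l)) x =
      eval x ((twist α l ^ k) p) * Complex.exp (x ⬝ᵥ l) := by
  have key : iteratedDeriv k (fun t : ℂ => eval (x + t • toComplex α) p *
      Complex.exp ((x + t • toComplex α) ⬝ᵥ l)) = fun t =>
      eval (x + t • toComplex α) ((twist α l ^ k) p) * Complex.exp ((x + t • toComplex α) ⬝ᵥ l) := by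
    induction k with
    | zero => simp [iteratedDeriv_zero]
    | succ k ih =>
      rw [iteratedDeriv_succ, ih]
      funext t
      have hc : ∀ i, HasDerivAt (fun s : ℂ => (x + s • toComplex α) i) (toComplex α i) t := by
        intro i
        simpa using ((hasDerivAt_id t).mul_const (toComplex α i)).const_add (x i)
      rw [(hasDerivAt_eval_mul_exp ((twist α l ^ k) p) l hc).deriv, pow_succ', Module.End.mul_apply,
        twist_apply, dirD_apply, show l ⬝ᵥ toComplex α = ∑ i, l i * toComplex α i from rfl,
        Finset.sum_smul, ← Finset.sum_add_distrib, map_sum]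
      congr 1
      refine Finset.sum_congr rfl fun i _ => ?_
      rw [map_add, map_add, smul_eval, smul_eval, map_mul, eval_C, toComplex]
      ring
  have := congrFun key 0
  simpa [dirDeriv] using this

/-- A Baker-Akhiezer function with `φ(x, l) = P(x, l) exp (x, l)` has `P` polynomial in both
arguments and invariant under `(x, l) ↦ (t x, l / t)`. -/
theorem IsBakerAkhiezer.exists_biPoly {A : Configuration n} {φ : (Fin n → ℂ) → (Fin n → ℂ) → ℂ}
    (hφ : IsBakerAkhiezer A φ) : ∃ P : BiPoly n,
      P - emb true A.AmPoly * emb false A.AmPoly ∈ low n A.totalMult ∧ QuasiAll A P ∧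
      ∀ x l, φ x l = eval x (fix false l P) * Complex.exp (x ⬝ᵥ l) := by
  choose p hdeg htop hform using hφ.form
  have hq : ∀ l, Quasi A l (p l) := by
    intro l α hα s hs y hy
    have h1 := hφ.quasi l α hα s hs y hy
    simp only [hform] at h1
    rw [dirDeriv_eval_mul_exp] at h1
    exact (mul_eq_zero.1 h1).resolve_right (Complex.exp_ne_zero _)
  have hcont : ∀ x, Continuous fun l => eval x (p l) := by
    intro x
    have h1 : ∀ l, eval x (p l) = φ x l * Complex.exp (-(x ⬝ᵥ l)) := by
      intro l
      rw [hform, mul_assoc, ← Complex.exp_add, add_neg_cancel, Complex.exp_zero, mul_one]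
    simp only [h1]
    refine (hφ.continuous_param x).mul (Complex.continuous_exp.comp ?_)
    simp only [dotProduct]
    fun_prop
  obtain ⟨pc, hpc⟩ := exists_coeff_eq_eval hdeg htop hq hcont
  -- Uniqueness gives the scaling law only where `A_m(l) ≠ 0`; continuity extends it.
  have hhom : ∀ a ∈ exps n A.totalMult, (pc a).IsHomogeneous a.degree := by
    intro a ha
    refine isHomogeneous_of_eval_smul fun t ht => ?_
    refine eq_of_eq_of_eval_ne_zero A.AmPoly_ne_zero
      ((MvPolynomial.continuous_eval _).comp (continuous_const_smul _))
      (continuous_const.mul (MvPolynomial.continuous_eval _)) fun l hl => ?_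
    rw [A.eval_AmPoly] at hl
    rw [← hpc _ a ha, ← hpc _ a ha, coeff_smul_param hdeg htop hq hl ht]
  let P : BiPoly n := ∑ a ∈ exps n A.totalMult, emb true (monomial a 1) * emb false (pc a)
  have hfix : ∀ l, fix false l P = p l := by
    intro l
    rw [eq_sum_exps (hdeg l), map_sum]
    refine Finset.sum_congr rfl fun a ha => ?_
    have := fix_emb_not false l (monomial a (1 : ℂ))
    rw [Bool.not_false] at this
    rw [map_mul, fix_emb_self, this, ← hpc l a ha, mul_comm, C_mul_monomial, mul_one]
  refine ⟨P, ?_, ?_, fun x l => ?_⟩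
  · let P₀ : BiPoly n := ∑ a ∈ (exps n A.totalMult).filter fun a => a.degree < A.totalMult,
      emb true (monomial a 1) * emb false (pc a)
    have hP₀ : P₀ ∈ low n A.totalMult := by
      refine Submodule.sum_mem _ fun a ha => Submodule.subset_span ?_
      rw [Finset.mem_filter] at ha
      exact ⟨a.degree, ha.2, _, _, isHomogeneous_monomial _ rfl, hhom a ha.1, rfl⟩
    have hP₁ : P - P₀ = emb true A.AmPoly * emb false A.AmPoly := by
      rw [← sub_eq_zero]
      refine eq_zero_of_fix false fun l => ?_
      have e1 : fix false l P₀ = ∑ a ∈ (exps n A.totalMult).filter fun a => a.degree < A.totalMult,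
          monomial a (coeff a (p l)) := by
        rw [map_sum]
        refine Finset.sum_congr rfl fun a ha => ?_
        have := fix_emb_not false l (monomial a (1 : ℂ))
        rw [Bool.not_false] at this
        rw [map_mul, fix_emb_self, this, ← hpc l a (Finset.mem_filter.1 ha).1, mul_comm,
          C_mul_monomial, mul_one]
      have e2 := fix_emb_not false l A.AmPoly
      rw [Bool.not_false] at e2
      rw [map_sub, map_sub, hfix, e1, map_mul, fix_emb_self, e2, A.eval_AmPoly, mul_comm, ← htop,
        sub_eq_zero]
      ext m
      rw [coeff_sub, coeff_homogeneousComponent, coeff_sum]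
      simp only [coeff_monomial]
      rw [Finset.sum_ite_eq']
      rcases lt_trichotomy m.degree A.totalMult with h | h | h
      · rw [if_pos (Finset.mem_filter.2 ⟨mem_exps.2 h.le, h⟩), if_neg h.ne, sub_self]
      · rw [if_neg (by simp [h]), if_pos h, sub_zero]
      · rw [if_neg (by simp [h.le]), if_neg h.ne', sub_zero]
        exact coeff_eq_zero_of_totalDegree_lt ((hdeg l).trans_lt h)
    have : P - emb true A.AmPoly * emb false A.AmPoly = P₀ := by
      rw [← hP₁]
      ring
    rw [this]
    exact hP₀
  · exact quasiAll_iff.2 fun l => by rw [hfix]; exact hq l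
  · rw [hfix, hform]

/-- The eigenvalue equation for a Baker-Akhiezer function at `l`. -/
theorem IsBakerAkhiezer.exists_poly {A : Configuration n} {φ : (Fin n → ℂ) → (Fin n → ℂ) → ℂ}
    (hφ : IsBakerAkhiezer A φ) (h0 : φ 0 0 ≠ 0) (l : Fin n → ℂ) : ∃ p : MvPolynomial (Fin n) ℂ,
      p.totalDegree ≤ A.totalMult ∧
      homogeneousComponent A.totalMult p = C (A.Am l) * A.AmPoly ∧
      eval 0 p = φ 0 0 ∧
      A.AmPoly * (∑ i, pderiv i (pderiv i p) + 2 * ∑ i, C (l i) * pderiv i p) -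
        2 * ∑ i, pderiv i A.AmPoly * pderiv i p - 2 * (∑ i, C (l i) * pderiv i A.AmPoly) * p = 0 := by
  obtain ⟨P, hP, hq, hform⟩ := hφ.exists_biPoly
  have h00 : φ 0 0 = eval 0 P := by
    rw [hform, eval_fix]
    simp
  have hz : ∀ l, eval 0 (fix false l P) = φ 0 0 := by
    intro l
    rw [eval_zero_fix, fix_zero_of_mem_low _ (mem_low_succ hP), eval_C, h00]
  refine ⟨fix false l P, totalDegree_fix false l hP, ?_, hz l, ?_⟩
  · rw [homogeneousComponent_fix false l hP, A.eval_AmPoly]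
  · rw [← fix_T, Bool.not_false, T_true_eq_zero hP hq (by rwa [← h00]), map_zero]

end Construction

/-! ### Gaussian integrals on the shifted real space -/

section Gaussian

variable {n : ℕ} {ι : Type*}

/-- Families of continuous functions of at most exponential growth, uniformly in the parameter. -/
structure Tame (S : Set ι) (G : ι → (Fin n → ℝ) → ℂ) : Prop where
  cont : ∀ s ∈ S, Continuous (G s)
  bound : ∃ c k : ℝ, 0 ≤ c ∧ 0 ≤ k ∧ ∀ s ∈ S, ∀ y, ‖G s y‖ ≤ c * Real.exp (k * ‖y‖)

namespace Tame

variable {S : Set ι} {G H : ι → (Fin n → ℝ) → ℂ}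

theorem of_norm_le {c : ℝ} (hcont : ∀ s ∈ S, Continuous (G s)) (h : ∀ s ∈ S, ∀ y, ‖G s y‖ ≤ c) :
    Tame S G := by
  refine ⟨hcont, |c|, 0, abs_nonneg c, le_rfl, fun s hs y => ?_⟩
  simpa using (h s hs y).trans (le_abs_self c)

theorem of_norm_le_linear {a c : ℝ} (hcont : ∀ s ∈ S, Continuous (G s))
    (h : ∀ s ∈ S, ∀ y, ‖G s y‖ ≤ a + c * ‖y‖) : Tame S G := by
  refine ⟨hcont, |a| + |c|, 1, by positivity, zero_le_one, fun s hs y => (h s hs y).trans ?_⟩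
  have h1 := Real.add_one_le_exp (1 * ‖y‖)
  have h2 := norm_nonneg y
  have h3 := mul_le_mul_of_nonneg_right (le_abs_self c) h2
  have h4 := le_abs_self a
  have h5 := mul_le_mul_of_nonneg_left h1 (by positivity : 0 ≤ |a| + |c|)
  have h6 := mul_nonneg (abs_nonneg a) h2
  have h7 := abs_nonneg c
  nlinarith

theorem const (c : ℂ) : Tame S fun _ (_ : Fin n → ℝ) => c :=
  of_norm_le (c := ‖c‖) (fun _ _ => continuous_const) fun _ _ _ => le_rfl

theorem coord (i : Fin n) : Tame S fun _ (y : Fin n → ℝ) => (y i : ℂ) := by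
  refine of_norm_le_linear (a := 0) (c := 1) (fun _ _ => by fun_prop) fun s _ y => ?_
  simpa using norm_le_pi_norm y i

theorem mul (hG : Tame S G) (hH : Tame S H) : Tame S fun s y => G s y * H s y := by
  obtain ⟨c, k, hc, hk, h⟩ := hG.bound
  obtain ⟨c', k', hc', hk', h'⟩ := hH.bound
  refine ⟨fun s hs => (hG.cont s hs).mul (hH.cont s hs), c * c', k + k', by positivity,
    by positivity, fun s hs y => ?_⟩
  rw [norm_mul, add_mul, Real.exp_add]
  calc ‖G s y‖ * ‖H s y‖ ≤ (c * Real.exp (k * ‖y‖)) * (c' * Real.exp (k' * ‖y‖)) :=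
        mul_le_mul (h s hs y) (h' s hs y) (norm_nonneg _) (by positivity)
    _ = c * c' * (Real.exp (k * ‖y‖) * Real.exp (k' * ‖y‖)) := by ring

theorem add (hG : Tame S G) (hH : Tame S H) : Tame S fun s y => G s y + H s y := by
  obtain ⟨c, k, hc, hk, h⟩ := hG.bound
  obtain ⟨c', k', hc', hk', h'⟩ := hH.bound
  refine ⟨fun s hs => (hG.cont s hs).add (hH.cont s hs), c + c', k + k', by positivity,
    by positivity, fun s hs y => (norm_add_le _ _).trans ?_⟩
  have h1 : Real.exp (k * ‖y‖) ≤ Real.exp ((k + k') * ‖y‖) :=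
    Real.exp_le_exp.2 (mul_le_mul_of_nonneg_right (by linarith) (norm_nonneg _))
  have h2 : Real.exp (k' * ‖y‖) ≤ Real.exp ((k + k') * ‖y‖) :=
    Real.exp_le_exp.2 (mul_le_mul_of_nonneg_right (by linarith) (norm_nonneg _))
  rw [add_mul]
  exact add_le_add ((h s hs y).trans (mul_le_mul_of_nonneg_left h1 hc))
    ((h' s hs y).trans (mul_le_mul_of_nonneg_left h2 hc'))

theorem sum {κ : Type*} {t : Finset κ} {G : κ → ι → (Fin n → ℝ) → ℂ}
    (h : ∀ j ∈ t, Tame S (G j)) : Tame S fun s y => ∑ j ∈ t, G j s y := by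
  classical
  induction t using Finset.induction_on with
  | empty => simpa using const 0
  | insert j t hj ih =>
    simp only [Finset.sum_insert hj]
    exact (h j (Finset.mem_insert_self j t)).add (ih fun i hi => h i (Finset.mem_insert_of_mem hi))

theorem prod {κ : Type*} {t : Finset κ} {G : κ → ι → (Fin n → ℝ) → ℂ}
    (h : ∀ j ∈ t, Tame S (G j)) : Tame S fun s y => ∏ j ∈ t, G j s y := by
  classical
  induction t using Finset.induction_on with
  | empty => simpa using const 1
  | insert j t hj ih =>
    simp only [Finset.prod_insert hj]
    exact (h j (Finset.mem_insert_self j t)).mul (ih fun i hi => h i (Finset.mem_insert_of_mem hi))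

theorem pow (hG : Tame S G) (m : ℕ) : Tame S fun s y => G s y ^ m := by
  induction m with
  | zero => simpa using const 1
  | succ m ih =>
    simp only [pow_succ]
    exact ih.mul hG

theorem eval {c : ι → (Fin n → ℝ) → Fin n → ℂ} (hc : ∀ i, Tame S fun s y => c s y i)
    (p : MvPolynomial (Fin n) ℂ) : Tame S fun s y => MvPolynomial.eval (c s y) p := by
  induction p using MvPolynomial.induction_on with
  | C a => simpa using const a
  | add p q hp hq =>
    simp only [map_add]
    exact hp.add hq
  | mul_X p j hp =>
    simp only [map_mul, eval_X]
    exact hp.mul (hc j)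

end Tame

variable (ξ : Fin n → ℝ)

theorem shift_apply (y : Fin n → ℝ) (i : Fin n) : shift ξ y i = y i + Complex.I * ξ i := rfl

theorem continuous_shift : Continuous (shift ξ) := by
  refine continuous_pi fun i => ?_
  simp only [shift_apply]
  fun_prop

theorem Tame.shift {S : Set ι} (i : Fin n) : Tame S fun _ y => shift ξ y i :=
  (Tame.coord i).add (Tame.const _)

theorem shift_dotProduct_shift (y : Fin n → ℝ) : shift ξ y ⬝ᵥ shift ξ y =
    ((y ⬝ᵥ y - ξ ⬝ᵥ ξ : ℝ) : ℂ) + 2 * Complex.I * ((y ⬝ᵥ ξ : ℝ) : ℂ) := by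
  simp only [dotProduct, shift_apply, Complex.ofReal_sub, Complex.ofReal_sum, Complex.ofReal_mul,
    Finset.mul_sum, ← Finset.sum_sub_distrib, ← Finset.sum_add_distrib]
  refine Finset.sum_congr rfl fun i _ => ?_
  linear_combination (ξ i : ℂ) ^ 2 * Complex.I_sq

theorem shift_dotProduct_toComplex (y α : Fin n → ℝ) : shift ξ y ⬝ᵥ toComplex α =
    ((y ⬝ᵥ α : ℝ) : ℂ) + Complex.I * ((ξ ⬝ᵥ α : ℝ) : ℂ) := by
  rw [shift, add_dotProduct, smul_dotProduct, toComplex_dotProduct, toComplex_dotProduct, smul_eq_mul]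

theorem continuous_gaussianDensity : Continuous (gaussianDensity : (Fin n → ℂ) → ℂ) := by
  unfold gaussianDensity
  simp only [dotProduct]
  fun_prop

theorem norm_gaussianDensity_shift (y : Fin n → ℝ) : ‖gaussianDensity (shift ξ y)‖ =
    ((2 * Real.pi) ^ (-(n : ℝ) / 2) * Real.exp ((ξ ⬝ᵥ ξ) / 2)) * Real.exp (-(y ⬝ᵥ y) / 2) := by
  rw [gaussianDensity, norm_mul, Complex.norm_exp, shift_dotProduct_shift, Complex.norm_real,
    Real.norm_of_nonneg (by positivity), mul_assoc (_ ^ _), ← Real.exp_add]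
  congr 2
  simp
  ring

theorem sq_norm_le_dotProduct (y : Fin n → ℝ) : ‖y‖ ^ 2 ≤ y ⬝ᵥ y := by
  have h0 : 0 ≤ y ⬝ᵥ y := Finset.sum_nonneg fun j _ => mul_self_nonneg (y j)
  have : ‖y‖ ≤ Real.sqrt (y ⬝ᵥ y) := by
    refine (pi_norm_le_iff_of_nonneg (Real.sqrt_nonneg _)).2 fun i => Real.le_sqrt_of_sq_le ?_
    rw [Real.norm_eq_abs, sq_abs, sq]
    exact Finset.single_le_sum (f := fun j => y j * y j) (fun j _ => mul_self_nonneg _)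
      (Finset.mem_univ i)
  calc ‖y‖ ^ 2 ≤ Real.sqrt (y ⬝ᵥ y) ^ 2 := by gcongr
    _ = y ⬝ᵥ y := Real.sq_sqrt h0

theorem integrable_exp_mul_norm_gaussianDensity (k : ℝ) :
    Integrable fun y : Fin n → ℝ => Real.exp (k * ‖y‖) * ‖gaussianDensity (shift ξ y)‖ := by
  have h1 : Integrable fun y : Fin n → ℝ => ∏ i, Real.exp (-(1 / 4) * y i ^ 2) :=
    Integrable.fintype_prod (f := fun _ t => Real.exp (-(1 / 4) * t ^ 2))
      fun _ => integrable_exp_neg_mul_sq (by norm_num)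
  set c := (2 * Real.pi) ^ (-(n : ℝ) / 2) * Real.exp ((ξ ⬝ᵥ ξ) / 2) with hc
  have hc0 : 0 ≤ c := by positivity
  refine (h1.const_mul (c * Real.exp (k ^ 2))).mono' ?_ (ae_of_all _ fun y => ?_)
  · refine Continuous.aestronglyMeasurable ?_
    exact (Real.continuous_exp.comp (continuous_const.mul continuous_norm)).mul
      (continuous_gaussianDensity.comp (continuous_shift ξ)).norm
  · rw [Real.norm_of_nonneg (by positivity), norm_gaussianDensity_shift, ← hc, ← Real.exp_sum,
      mul_left_comm, mul_assoc c, ← Real.exp_add, ← Real.exp_add]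
    refine mul_le_mul_of_nonneg_left (Real.exp_le_exp.2 ?_) hc0
    have h2 : ∑ i, -(1 / 4) * y i ^ 2 = -(1 / 4) * (y ⬝ᵥ y) := by
      rw [← Finset.mul_sum]
      simp only [dotProduct, sq]
    rw [h2]
    -- `k ‖y‖ ≤ k² + ‖y‖² / 4`, and the sup norm is at most the Euclidean one; half of the Gaussian
    -- exponent remains for integrability.
    nlinarith [sq_norm_le_dotProduct y, sq_nonneg (k - ‖y‖ / 2)]

variable {ξ} in
theorem Tame.integrable {S : Set ι} {G : ι → (Fin n → ℝ) → ℂ} (hG : Tame S G) {s : ι} (hs : s ∈ S) :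
    Integrable fun y => G s y * gaussianDensity (BakerAkhiezer.shift ξ y) := by
  obtain ⟨c, k, hc, hk, h⟩ := hG.bound
  refine ((integrable_exp_mul_norm_gaussianDensity ξ k).const_mul c).mono'
    ((hG.cont s hs).mul (continuous_gaussianDensity.comp (continuous_shift ξ))).aestronglyMeasurable
    (ae_of_all _ fun y => ?_)
  rw [norm_mul, ← mul_assoc]
  exact mul_le_mul_of_nonneg_right (h s hs y) (norm_nonneg _)

theorem integral_gaussianDensity : ∫ y, gaussianDensity (shift ξ y) = 1 := by
  have h1 : ∀ y, gaussianDensity (shift ξ y) =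
      ((((2 * Real.pi) ^ (-(n : ℝ) / 2) : ℝ) : ℂ) * Complex.exp (((ξ ⬝ᵥ ξ / 2 : ℝ) : ℂ))) *
      Complex.exp (-(1 / 2 : ℂ) * ∑ i, (y i : ℂ) ^ 2 + ∑ i, (-Complex.I * ξ i) * y i) := by
    intro y
    rw [gaussianDensity, shift_dotProduct_shift, mul_assoc ((_ : ℝ) : ℂ), ← Complex.exp_add]
    congr 2
    have e1 : ((y ⬝ᵥ y : ℝ) : ℂ) = ∑ i, (y i : ℂ) ^ 2 := by
      simp [dotProduct, sq]
    have e2 : ∑ i, (-Complex.I * ξ i) * y i = -Complex.I * ((y ⬝ᵥ ξ : ℝ) : ℂ) := by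
      simp only [dotProduct, Complex.ofReal_sum, Complex.ofReal_mul, Finset.mul_sum]
      exact Finset.sum_congr rfl fun i _ => by ring
    rw [e2, ← e1]
    push_cast
    ring
  simp only [h1]
  rw [integral_const_mul, GaussianFourier.integral_cexp_neg_mul_sum_add (by norm_num)]
  have e3 : ∑ i, (-Complex.I * (ξ i : ℂ)) ^ 2 = -((ξ ⬝ᵥ ξ : ℝ) : ℂ) := by
    simp only [dotProduct, Complex.ofReal_sum, Complex.ofReal_mul, ← Finset.sum_neg_distrib]
    refine Finset.sum_congr rfl fun i _ => ?_
    linear_combination (ξ i : ℂ) ^ 2 * Complex.I_sq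
  have e4 : (Real.pi / (1 / 2) : ℂ) ^ (Fintype.card (Fin n) / 2 : ℂ) =
      (((2 * Real.pi) ^ ((n : ℝ) / 2) : ℝ) : ℂ) := by
    rw [Complex.ofReal_cpow (by positivity)]
    congr 1
    · push_cast
      ring
    · simp
  rw [e3, e4, mul_mul_mul_comm, ← Complex.exp_add, ← Complex.ofReal_mul, ← Real.rpow_add (by positivity)]
  have e5 : -(n : ℝ) / 2 + n / 2 = 0 := by ring
  have e6 : ((ξ ⬝ᵥ ξ / 2 : ℝ) : ℂ) + -((ξ ⬝ᵥ ξ : ℝ) : ℂ) / (4 * (1 / 2)) = 0 := by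
    push_cast
    ring
  rw [e5, e6]
  simp

end Gaussian

/-! ### The radial differential equation -/

section Analysis

variable {n : ℕ} {A : Configuration n} {ξ : Fin n → ℝ} {p : MvPolynomial (Fin n) ℂ}

theorem integral_eq_zero_of_hasLineDerivAt {f f' : (Fin n → ℝ) → ℂ} (v : Fin n → ℝ)
    (hf : Integrable f) (hf' : Integrable f') (h : ∀ x, HasLineDerivAt ℝ f (f' x) x v) :
    ∫ x, f' x = 0 := by
  have := integral_bilinear_hasLineDerivAt_right_eq_neg_left_of_integrable (μ := volume)
    (f := f) (f' := f') (g := fun _ => (1 : ℂ)) (g' := fun _ => 0) (v := v)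
    (B := ContinuousLinearMap.mul ℝ ℂ) (by simpa using hf') (by simp) (by simpa using hf)
    (fun x _ => h x) (fun x _ => hasDerivAt_const _ _)
  simpa using this.symm

theorem shift_dotProduct_ne_zero {α : Fin n → ℝ} (h : ξ ⬝ᵥ α ≠ 0) (y : Fin n → ℝ) :
    shift ξ y ⬝ᵥ toComplex α ≠ 0 := by
  rw [shift_dotProduct_toComplex]
  intro h0
  have := congrArg Complex.im h0
  simp at this
  exact h this

theorem Am_shift_ne_zero (hξ : ∀ α ∈ A.vectors, ξ ⬝ᵥ α ≠ 0) (y : Fin n → ℝ) :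
    A.Am (shift ξ y) ≠ 0 :=
  Finset.prod_ne_zero_iff.2 fun α hα => pow_ne_zero _ (shift_dotProduct_ne_zero (hξ α hα) y)

theorem Am_toComplex_ne_zero (hξ : ∀ α ∈ A.vectors, ξ ⬝ᵥ α ≠ 0) : A.Am (toComplex ξ) ≠ 0 := by
  refine Finset.prod_ne_zero_iff.2 fun α hα => pow_ne_zero _ ?_
  rw [toComplex_dotProduct]
  exact_mod_cast hξ α hα

theorem tame_Am_inv {ι : Type*} (S : Set ι) (u : ι → (Fin n → ℝ) → Fin n → ℂ)
    (h : ∀ α ∈ A.vectors, Tame S fun s y => (u s y ⬝ᵥ toComplex α)⁻¹) :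
    Tame S fun s y => (A.Am (u s y))⁻¹ := by
  simp only [Configuration.Am, ← Finset.prod_inv_distrib, ← inv_pow]
  exact Tame.prod fun α hα => (h α hα).pow _

/-- On `i ξ + ℝⁿ` the imaginary part of `(z, α)` is constantly `(ξ, α) ≠ 0`, so the inverse is
bounded. -/
theorem tame_Am_shift_inv {ι : Type*} (S : Set ι) (hξ : ∀ α ∈ A.vectors, ξ ⬝ᵥ α ≠ 0) :
    Tame S fun _ y => (A.Am (shift ξ y))⁻¹ := by
  refine tame_Am_inv S _ fun α hα => Tame.of_norm_le (c := |ξ ⬝ᵥ α|⁻¹) (fun _ _ => ?_) fun _ _ y => ?_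
  · refine Continuous.inv₀ ?_ (shift_dotProduct_ne_zero (hξ α hα))
    have := continuous_shift ξ
    simp only [dotProduct]
    fun_prop
  · rw [norm_inv]
    refine inv_anti₀ (abs_pos.2 (hξ α hα)) ?_
    refine le_trans (le_of_eq ?_) (Complex.abs_im_le_norm _)
    rw [shift_dotProduct_toComplex]
    simp

theorem abs_dotProduct_le (y v : Fin n → ℝ) : |y ⬝ᵥ v| ≤ (∑ i, |v i|) * ‖y‖ := by
  rw [dotProduct, Finset.sum_mul]
  refine (Finset.abs_sum_le_sum_abs _ _).trans (Finset.sum_le_sum fun i _ => ?_)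
  rw [abs_mul, mul_comm]
  exact mul_le_mul_of_nonneg_left (norm_le_pi_norm y i) (abs_nonneg _)

/-- The function `p(s z) exp (s z, ξ)`, `z = y + i ξ`. -/
def scaledExp (ξ : Fin n → ℝ) (p : MvPolynomial (Fin n) ℂ) (s : ℝ) (y : Fin n → ℝ) : ℂ :=
  eval ((s : ℂ) • shift ξ y) p * Complex.exp (((s : ℂ) • shift ξ y) ⬝ᵥ toComplex ξ)

theorem tame_scaledExp (R : ℝ) (p : MvPolynomial (Fin n) ℂ) :
    Tame {s : ℝ | |s| ≤ R} (scaledExp ξ p) := by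
  have hR : ∀ s : ℝ, s ∈ {s : ℝ | |s| ≤ R} → |s| ≤ R := fun s hs => hs
  have h1 : Tame {s : ℝ | |s| ≤ R} fun s (_ : Fin n → ℝ) => (s : ℂ) :=
    Tame.of_norm_le (c := R) (fun _ _ => continuous_const) fun s hs _ => by
      rw [Complex.norm_real]
      exact hR s hs
  refine (Tame.eval (fun i => h1.mul (Tame.shift ξ i)) p).mul ⟨fun s _ => ?_, ?_⟩
  · have := continuous_shift ξ
    simp only [dotProduct]
    fun_prop
  · refine ⟨1, |R| * ∑ i, |ξ i|, zero_le_one, by positivity, fun s hs y => ?_⟩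
    rw [one_mul, Complex.norm_exp]
    refine Real.exp_le_exp.2 ?_
    have e1 : (((s : ℂ) • shift ξ y) ⬝ᵥ toComplex ξ).re = s * (y ⬝ᵥ ξ) := by
      rw [smul_dotProduct, shift_dotProduct_toComplex]
      simp
    rw [e1]
    refine (le_abs_self _).trans ?_
    rw [abs_mul, mul_assoc]
    exact mul_le_mul ((hR s hs).trans (le_abs_self R)) (abs_dotProduct_le y ξ) (abs_nonneg _) (abs_nonneg _)

theorem hasDerivAt_scaledExp (p : MvPolynomial (Fin n) ℂ) (s : ℝ) (y : Fin n → ℝ) :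
    HasDerivAt (fun s => scaledExp ξ p s y)
      (∑ i, shift ξ y i * scaledExp ξ (pderiv i p + C (toComplex ξ i) * p) s y) s := by
  have hc : ∀ i, HasDerivAt (fun s : ℝ => ((s : ℂ) • shift ξ y) i) (shift ξ y i) s := by
    intro i
    simpa using (Complex.ofRealCLM.hasDerivAt (x := s)).mul_const (shift ξ y i)
  refine (hasDerivAt_eval_mul_exp p (toComplex ξ) hc).congr_deriv ?_
  rw [Finset.sum_mul]
  exact Finset.sum_congr rfl fun i _ => by rw [scaledExp]; ring

theorem hasDerivAt_integral_scaledExp (hξ : ∀ α ∈ A.vectors, ξ ⬝ᵥ α ≠ 0)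
    (p : MvPolynomial (Fin n) ℂ) (s : ℝ) :
    HasDerivAt (fun s => ∫ y, scaledExp ξ p s y * (A.Am (shift ξ y))⁻¹ ^ 2 *
        gaussianDensity (shift ξ y))
      (∫ y, (∑ i, shift ξ y i * scaledExp ξ (pderiv i p + C (toComplex ξ i) * p) s y) *
        (A.Am (shift ξ y))⁻¹ ^ 2 * gaussianDensity (shift ξ y)) s := by
  set R := |s| + 1 with hR
  have h1 : Tame {s : ℝ | |s| ≤ R} fun s y => scaledExp ξ p s y * (A.Am (shift ξ y))⁻¹ ^ 2 :=
    (tame_scaledExp R p).mul ((tame_Am_shift_inv _ hξ).pow 2)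
  have h2 : Tame {s : ℝ | |s| ≤ R} fun s y => (∑ i, shift ξ y i *
      scaledExp ξ (pderiv i p + C (toComplex ξ i) * p) s y) * (A.Am (shift ξ y))⁻¹ ^ 2 :=
    (Tame.sum fun i _ => (Tame.shift ξ i).mul (tame_scaledExp R _)).mul
      ((tame_Am_shift_inv _ hξ).pow 2)
  have hball : ∀ t ∈ Metric.ball s 1, t ∈ {s : ℝ | |s| ≤ R} := by
    intro t ht
    rw [Metric.mem_ball, Real.dist_eq] at ht
    have := abs_sub_abs_le_abs_sub t s
    change |t| ≤ R
    linarith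
  have hs : s ∈ {s : ℝ | |s| ≤ R} := hball s (Metric.mem_ball_self one_pos)
  obtain ⟨c, k, hc, hk, hb⟩ := h2.bound
  refine (hasDerivAt_integral_of_dominated_loc_of_deriv_le
    (F := fun s y => scaledExp ξ p s y * (A.Am (shift ξ y))⁻¹ ^ 2 * gaussianDensity (shift ξ y))
    (F' := fun s y => (∑ i, shift ξ y i * scaledExp ξ (pderiv i p + C (toComplex ξ i) * p) s y) *
      (A.Am (shift ξ y))⁻¹ ^ 2 * gaussianDensity (shift ξ y))
    (bound := fun y => c * (Real.exp (k * ‖y‖) * ‖gaussianDensity (shift ξ y)‖))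
    (Metric.ball_mem_nhds s one_pos) ?_ (h1.integrable hs) (h2.integrable hs).aestronglyMeasurable
    (ae_of_all _ fun y t ht => ?_) ((integrable_exp_mul_norm_gaussianDensity ξ k).const_mul c)
    (ae_of_all _ fun y t ht => ?_)).2
  · filter_upwards [Metric.ball_mem_nhds s one_pos] with t ht
    exact (h1.integrable (hball t ht)).aestronglyMeasurable
  · rw [norm_mul, ← mul_assoc]
    exact mul_le_mul_of_nonneg_right (hb t (hball t ht) y) (norm_nonneg _)
  · exact ((hasDerivAt_scaledExp p t y).mul_const _).mul_const _

theorem hasDerivAt_gaussianDensity {c : ℝ → Fin n → ℂ} {c' : Fin n → ℂ} {t : ℝ}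
    (hc : ∀ i, HasDerivAt (fun s => c s i) (c' i) t) :
    HasDerivAt (fun s => gaussianDensity (c s)) (-(c' ⬝ᵥ c t) * gaussianDensity (c t)) t := by
  have h1 : HasDerivAt (fun s => c s ⬝ᵥ c s) (2 * (c' ⬝ᵥ c t)) t := by
    simp only [dotProduct]
    refine (HasDerivAt.fun_sum fun i _ => (hc i).mul (hc i)).congr_deriv ?_
    rw [Finset.mul_sum]
    exact Finset.sum_congr rfl fun i _ => by ring
  have h2 : HasDerivAt (fun s => -(c s ⬝ᵥ c s) / 2) (-(c' ⬝ᵥ c t)) t :=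
    (h1.neg.div_const 2).congr_deriv (by ring)
  refine ((h2.cexp).const_mul _).congr_deriv ?_
  rw [gaussianDensity]
  ring

theorem hasLineDerivAt_integrand (hξ : ∀ α ∈ A.vectors, ξ ⬝ᵥ α ≠ 0)
    (q : MvPolynomial (Fin n) ℂ) (s : ℝ) (i : Fin n) (y : Fin n → ℝ) :
    HasLineDerivAt ℝ (fun y => scaledExp ξ q s y * (A.Am (shift ξ y))⁻¹ ^ 2 *
        gaussianDensity (shift ξ y))
      ((s * scaledExp ξ (pderiv i q + C (toComplex ξ i) * q) s y * (A.Am (shift ξ y))⁻¹ ^ 2 -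
        2 * (eval (shift ξ y) (pderiv i A.AmPoly) * scaledExp ξ q s y * (A.Am (shift ξ y))⁻¹ ^ 3) -
        shift ξ y i * scaledExp ξ q s y * (A.Am (shift ξ y))⁻¹ ^ 2) * gaussianDensity (shift ξ y))
      y (Pi.single i 1) := by
  set c : ℝ → Fin n → ℂ := fun t => shift ξ (y + t • Pi.single i 1) with hcdef
  have hc0 : c 0 = shift ξ y := by simp [hcdef]
  have hc : ∀ j, HasDerivAt (fun t => c t j) ((Pi.single i 1 : Fin n → ℂ) j) 0 := by
    intro j
    have e : (fun t => c t j) = fun t : ℝ => (t : ℂ) * (Pi.single i 1 : Fin n → ℂ) j + shift ξ y j := by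
      funext t
      simp only [hcdef, shift_apply, Pi.add_apply, Pi.smul_apply, Pi.single_apply]
      split_ifs <;> simp
      ring
    rw [e]
    simpa using ((Complex.ofRealCLM.hasDerivAt (x := (0 : ℝ))).mul_const
      ((Pi.single i 1 : Fin n → ℂ) j)).add_const (shift ξ y j)
  have hsc : ∀ j, HasDerivAt (fun t => ((s : ℂ) • c t) j) (((s : ℂ) • (Pi.single i 1 : Fin n → ℂ)) j) 0 :=
    fun j => (hc j).const_mul (s : ℂ)
  have hsum : ∀ g : Fin n → ℂ, ∑ j, (Pi.single i 1 : Fin n → ℂ) j * g j = g i := by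
    intro g
    simp [Pi.single_apply]
  have h1 := hasDerivAt_eval_mul_exp q (toComplex ξ) hsc
  have h2 := hasDerivAt_eval A.AmPoly hc
  have h3 := hasDerivAt_gaussianDensity hc
  simp only [A.eval_AmPoly, hc0, hsum, Pi.smul_apply, smul_eq_mul, mul_assoc, ← Finset.mul_sum] at h1 h2 h3
  have hne : A.Am (c 0) ≠ 0 := by
    rw [hc0]
    exact Am_shift_ne_zero hξ y
  have h4 := ((h1.mul ((h2.fun_inv hne).pow 2)).mul h3)
  refine h4.congr_deriv ?_
  have hdot : (Pi.single i 1 : Fin n → ℂ) ⬝ᵥ shift ξ y = shift ξ y i := by simp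
  simp only [hc0, hdot, scaledExp, Pi.mul_apply, Pi.pow_apply, div_eq_mul_inv, ← inv_pow,
    Nat.add_one_sub_one, pow_one, Nat.cast_ofNat]
  ring

/-- The eigenvalue equation at the point `s z`. -/
theorem eigen_scaled
    (heq : A.AmPoly * (∑ i, pderiv i (pderiv i p) + 2 * ∑ i, C (toComplex ξ i) * pderiv i p) -
      2 * ∑ i, pderiv i A.AmPoly * pderiv i p -
      2 * (∑ i, C (toComplex ξ i) * pderiv i A.AmPoly) * p = 0)
    {s : ℂ} (hs : s ≠ 0) (z : Fin n → ℂ) :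
    A.Am z * (s * ∑ i, eval (s • z) (pderiv i (pderiv i p + C (toComplex ξ i) * p) +
        C (toComplex ξ i) * (pderiv i p + C (toComplex ξ i) * p))) -
      2 * ∑ i, eval z (pderiv i A.AmPoly) * eval (s • z) (pderiv i p + C (toComplex ξ i) * p) =
    A.Am z * (s * ((ξ ⬝ᵥ ξ : ℝ) : ℂ) * eval (s • z) p) := by
  have hA : eval (s • z) A.AmPoly = s ^ A.totalMult * A.Am z := by
    rw [eval_smul_of_isHomogeneous A.isHomogeneous_AmPoly, A.eval_AmPoly]
  -- Homogeneity of degree `|m| - 1`, multiplied by `s` to avoid the subtraction when `|m| = 0`.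
  have hAi : ∀ i, s * eval (s • z) (pderiv i A.AmPoly) =
      s ^ A.totalMult * eval z (pderiv i A.AmPoly) := by
    intro i
    rcases Nat.eq_zero_or_pos A.totalMult with hN | hN
    · have : pderiv i A.AmPoly = 0 := by
        rw [totalDegree_eq_zero_iff_eq_C.1 (A.totalDegree_AmPoly.trans hN), pderiv_C]
      rw [this]
      simp
    · rw [eval_smul_of_isHomogeneous A.isHomogeneous_AmPoly.pderiv, ← mul_assoc, ← pow_succ',
        Nat.sub_add_cancel hN]
  have e := congrArg (fun g => s * eval (s • z) g) heq
  simp only [map_sub, map_mul, map_add, map_sum, map_ofNat, eval_C, map_zero, mul_zero, hA] at e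
  have e1 : s * (∑ i, eval (s • z) (pderiv i A.AmPoly) * eval (s • z) (pderiv i p) +
      (∑ i, toComplex ξ i * eval (s • z) (pderiv i A.AmPoly)) * eval (s • z) p) =
      s ^ A.totalMult * ∑ i, eval z (pderiv i A.AmPoly) *
        eval (s • z) (pderiv i p + C (toComplex ξ i) * p) := by
    rw [Finset.sum_mul, ← Finset.sum_add_distrib, Finset.mul_sum, Finset.mul_sum]
    refine Finset.sum_congr rfl fun i _ => ?_
    rw [← mul_assoc, ← hAi, map_add, map_mul, eval_C]
    ring
  have e2 : ∑ i, eval (s • z) (pderiv i (pderiv i p + C (toComplex ξ i) * p) +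
        C (toComplex ξ i) * (pderiv i p + C (toComplex ξ i) * p)) =
      ∑ i, eval (s • z) (pderiv i (pderiv i p)) + 2 * ∑ i, toComplex ξ i * eval (s • z) (pderiv i p) +
        ((ξ ⬝ᵥ ξ : ℝ) : ℂ) * eval (s • z) p := by
    rw [← toComplex_dotProduct, dotProduct, Finset.sum_mul, Finset.mul_sum, ← Finset.sum_add_distrib,
      ← Finset.sum_add_distrib]
    refine Finset.sum_congr rfl fun i _ => ?_
    simp only [map_add, map_mul, eval_C, pderiv_C_mul]
    ring
  rw [e2]
  refine mul_left_cancel₀ (pow_ne_zero A.totalMult hs) ?_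
  linear_combination e + 2 * e1

/-- The vector field with components `(∂_i φ)(s z) A_m(z)⁻² γ(z)` has divergence of integral zero.
In the divergence, `s (Δφ)(s z)` and the derivative of `A_m⁻²` combine by the eigenvalue equation
into `s ξ² φ(s z)`, while the derivative of `γ` produces minus the Euler term. -/
theorem integral_euler_scaledExp (hξ : ∀ α ∈ A.vectors, ξ ⬝ᵥ α ≠ 0)
    (heq : A.AmPoly * (∑ i, pderiv i (pderiv i p) + 2 * ∑ i, C (toComplex ξ i) * pderiv i p) -
      2 * ∑ i, pderiv i A.AmPoly * pderiv i p -
      2 * (∑ i, C (toComplex ξ i) * pderiv i A.AmPoly) * p = 0)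
    {s : ℝ} (hs : s ≠ 0) :
    ∫ y, (∑ i, shift ξ y i * scaledExp ξ (pderiv i p + C (toComplex ξ i) * p) s y) *
        (A.Am (shift ξ y))⁻¹ ^ 2 * gaussianDensity (shift ξ y) =
      s * ((ξ ⬝ᵥ ξ : ℝ) : ℂ) * ∫ y, scaledExp ξ p s y * (A.Am (shift ξ y))⁻¹ ^ 2 *
        gaussianDensity (shift ξ y) := by
  let q : Fin n → MvPolynomial (Fin n) ℂ := fun i => pderiv i p + C (toComplex ξ i) * p
  let S : Set ℝ := {t | |t| ≤ |s|}
  have hsS : s ∈ S := le_refl |s|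
  have hinv := tame_Am_shift_inv (A := A) (ξ := ξ) S hξ
  have hE : ∀ q, Tame S (scaledExp ξ q) := fun q => tame_scaledExp |s| q
  let G : Fin n → ℝ → (Fin n → ℝ) → ℂ := fun i t y =>
    s * scaledExp ξ (pderiv i (q i) + C (toComplex ξ i) * q i) t y * (A.Am (shift ξ y))⁻¹ ^ 2 -
      2 * (eval (shift ξ y) (pderiv i A.AmPoly) * scaledExp ξ (q i) t y * (A.Am (shift ξ y))⁻¹ ^ 3) -
      shift ξ y i * scaledExp ξ (q i) t y * (A.Am (shift ξ y))⁻¹ ^ 2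
  have hG : ∀ i, Tame S (G i) := by
    intro i
    have h1 := ((Tame.const (s : ℂ)).mul (hE (pderiv i (q i) + C (toComplex ξ i) * q i))).mul (hinv.pow 2)
    have h2 := (Tame.const (-2 : ℂ)).mul (((Tame.eval (fun j => Tame.shift ξ j)
      (pderiv i A.AmPoly)).mul (hE (q i))).mul (hinv.pow 3))
    have h3 := (Tame.const (-1 : ℂ)).mul (((Tame.shift ξ i).mul (hE (q i))).mul (hinv.pow 2))
    have h4 := (h1.add h2).add h3
    convert h4 using 3
    simp only [G]
    ring
  have hGi : ∀ i, Integrable fun y => G i s y * gaussianDensity (shift ξ y) :=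
    fun i => (hG i).integrable hsS
  have hz : ∀ i, ∫ y, G i s y * gaussianDensity (shift ξ y) = 0 := fun i =>
    integral_eq_zero_of_hasLineDerivAt (Pi.single i 1)
      (((hE (q i)).mul (hinv.pow 2)).integrable hsS) (hGi i)
      fun y => hasLineDerivAt_integrand hξ (q i) s i y
  have hsum : ∫ y, ∑ i, G i s y * gaussianDensity (shift ξ y) = 0 := by
    rw [integral_finsetSum _ fun i _ => hGi i]
    exact Finset.sum_eq_zero fun i _ => hz i
  rw [← integral_const_mul, ← sub_eq_zero, ← integral_sub, ← neg_eq_zero, ← integral_neg, ← hsum]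
  · refine integral_congr_ae (ae_of_all _ fun y => ?_)
    have hne := Am_shift_ne_zero hξ y
    have hpde := eigen_scaled heq (s := (s : ℂ)) (by exact_mod_cast hs) (shift ξ y)
    set z := shift ξ y with hzdef
    set ex := Complex.exp (((s : ℂ) • z) ⬝ᵥ toComplex ξ) with hex
    have hsc : ∀ g, scaledExp ξ g s y = eval ((s : ℂ) • z) g * ex := fun g => rfl
    have hG' : ∑ i, G i s y * gaussianDensity z = ((s * ∑ i, eval ((s : ℂ) • z)
          (pderiv i (q i) + C (toComplex ξ i) * q i)) * (A.Am z)⁻¹ ^ 2 -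
        2 * (∑ i, eval z (pderiv i A.AmPoly) * eval ((s : ℂ) • z) (q i)) * (A.Am z)⁻¹ ^ 3 -
        (∑ i, z i * eval ((s : ℂ) • z) (q i)) * (A.Am z)⁻¹ ^ 2) * ex * gaussianDensity z := by
      simp only [Finset.mul_sum, Finset.sum_mul, ← Finset.sum_sub_distrib]
      refine Finset.sum_congr rfl fun i _ => ?_
      simp only [G, hsc]
      rw [← hzdef]
      ring
    have hF : ∑ i, z i * scaledExp ξ (q i) s y = (∑ i, z i * eval ((s : ℂ) • z) (q i)) * ex := by
      rw [Finset.sum_mul]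
      exact Finset.sum_congr rfl fun i _ => by rw [hsc]; ring
    change -((∑ i, z i * scaledExp ξ (q i) s y) * (A.Am z)⁻¹ ^ 2 * gaussianDensity z -
      s * ((ξ ⬝ᵥ ξ : ℝ) : ℂ) * (scaledExp ξ p s y * (A.Am z)⁻¹ ^ 2 * gaussianDensity z)) =
      ∑ i, G i s y * gaussianDensity z
    rw [hG', hF, hsc]
    have h5 : (s * ∑ i, eval ((s : ℂ) • z) (pderiv i (q i) + C (toComplex ξ i) * q i)) -
        2 * (∑ i, eval z (pderiv i A.AmPoly) * eval ((s : ℂ) • z) (q i)) * (A.Am z)⁻¹ =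
        s * ((ξ ⬝ᵥ ξ : ℝ) : ℂ) * eval ((s : ℂ) • z) p := by
      refine mul_left_cancel₀ hne ?_
      rw [← hpde]
      change _ = A.Am z * (s * ∑ i, eval ((s : ℂ) • z) (pderiv i (q i) + C (toComplex ξ i) * q i)) -
        2 * ∑ i, eval z (pderiv i A.AmPoly) * eval ((s : ℂ) • z) (q i)
      linear_combination (-2 * ∑ i, eval z (pderiv i A.AmPoly) * eval ((s : ℂ) • z) (q i)) *
        mul_inv_cancel₀ hne
    linear_combination (-(A.Am z)⁻¹ ^ 2 * ex * gaussianDensity z) * h5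
  · exact ((Tame.sum fun i _ => (Tame.shift ξ i).mul (hE (q i))).mul (hinv.pow 2)).integrable hsS
  · exact (((hE p).mul (hinv.pow 2)).integrable hsS).const_mul _

end Analysis

/-! ### Asymptotics for large `s` and conclusion -/

section Limit

variable {n : ℕ} {A : Configuration n} {ξ : Fin n → ℝ} {p : MvPolynomial (Fin n) ℂ}

/-- The points `t z + ξ` with `z = y + i ξ`. -/
def blowup (ξ : Fin n → ℝ) (t : ℝ) (y : Fin n → ℝ) : Fin n → ℂ :=
  (t : ℂ) • shift ξ y + toComplex ξ

theorem continuous_blowup (t : ℝ) : Continuous (blowup ξ t) :=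
  ((continuous_shift ξ).const_smul (t : ℂ)).add continuous_const

theorem continuous_blowup_left (y : Fin n → ℝ) : Continuous fun t => blowup ξ t y :=
  (Complex.continuous_ofReal.smul continuous_const).add continuous_const

theorem blowup_zero (y : Fin n → ℝ) : blowup ξ 0 y = toComplex ξ := by
  simp [blowup]

theorem blowup_dotProduct (t : ℝ) (y α : Fin n → ℝ) : blowup ξ t y ⬝ᵥ toComplex α =
    ((ξ ⬝ᵥ α + t * (y ⬝ᵥ α) : ℝ) : ℂ) + Complex.I * ((t * (ξ ⬝ᵥ α) : ℝ) : ℂ) := by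
  rw [blowup, add_dotProduct, smul_dotProduct, shift_dotProduct_toComplex, toComplex_dotProduct,
    smul_eq_mul]
  push_cast
  ring

/-- With `a = (ξ, α)` and `b = (y, α)`, the pairing is `a + t b + i t a`. The real part can vanish
only if `t |b| = |a|`, and then the imaginary part is not small. The bound is uniform in `t ≥ 0`, as
dominated convergence at `t → 0` requires. -/
theorem sq_le_norm_blowup_dotProduct {t : ℝ} (ht : 0 ≤ t) (y α : Fin n → ℝ) :
    |ξ ⬝ᵥ α| ^ 2 ≤ ‖blowup ξ t y ⬝ᵥ toComplex α‖ * (|ξ ⬝ᵥ α| + |y ⬝ᵥ α|) := by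
  set a := ξ ⬝ᵥ α
  set b := y ⬝ᵥ α
  set w := blowup ξ t y ⬝ᵥ toComplex α with hw
  have hre : w.re = a + t * b := by rw [hw, blowup_dotProduct]; simp [a, b]
  have him : w.im = t * a := by rw [hw, blowup_dotProduct]; simp [a]
  have h1 : |a + t * b| ≤ ‖w‖ := hre ▸ Complex.abs_re_le_norm w
  have h2 : t * |a| ≤ ‖w‖ := by
    have := Complex.abs_im_le_norm w
    rwa [him, abs_mul, abs_of_nonneg ht] at this
  have h3 : |a| ≤ ‖w‖ + t * |b| := by
    have := abs_sub (a + t * b) (t * b)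
    rw [add_sub_cancel_right, abs_mul t, abs_of_nonneg ht] at this
    linarith
  have h4 := mul_le_mul_of_nonneg_left h3 (abs_nonneg a)
  have h5 := mul_le_mul_of_nonneg_right h2 (abs_nonneg b)
  nlinarith

theorem blowup_dotProduct_ne_zero {t : ℝ} (ht : 0 ≤ t) {α : Fin n → ℝ} (h : ξ ⬝ᵥ α ≠ 0)
    (y : Fin n → ℝ) : blowup ξ t y ⬝ᵥ toComplex α ≠ 0 := by
  intro h0
  have := sq_le_norm_blowup_dotProduct (ξ := ξ) ht y α
  rw [h0, norm_zero, zero_mul, sq_abs] at this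
  exact absurd this (not_le.2 (by positivity))

theorem tame_Am_blowup_inv (hξ : ∀ α ∈ A.vectors, ξ ⬝ᵥ α ≠ 0) :
    Tame (Set.Icc (0 : ℝ) 1) fun t y => (A.Am (blowup ξ t y))⁻¹ := by
  refine tame_Am_inv _ _ fun α hα => Tame.of_norm_le_linear (a := |ξ ⬝ᵥ α|⁻¹)
    (c := (|ξ ⬝ᵥ α| ^ 2)⁻¹ * ∑ i, |α i|) (fun t ht => ?_) fun t ht y => ?_
  · refine Continuous.inv₀ ?_ (blowup_dotProduct_ne_zero ht.1 (hξ α hα))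
    have := continuous_blowup (ξ := ξ) t
    simp only [dotProduct]
    fun_prop
  · have h1 := sq_le_norm_blowup_dotProduct (ξ := ξ) ht.1 y α
    have h2 := norm_pos_iff.2 (blowup_dotProduct_ne_zero ht.1 (hξ α hα) y)
    have h3 := abs_pos.2 (hξ α hα)
    have h4 := abs_dotProduct_le y α
    rw [norm_inv]
    calc ‖blowup ξ t y ⬝ᵥ toComplex α‖⁻¹
        ≤ (|ξ ⬝ᵥ α| ^ 2)⁻¹ * (|ξ ⬝ᵥ α| + |y ⬝ᵥ α|) := by
          rw [inv_mul_eq_div, inv_eq_one_div, div_le_div_iff₀ h2 (by positivity)]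
          linarith
      _ ≤ (|ξ ⬝ᵥ α| ^ 2)⁻¹ * (|ξ ⬝ᵥ α| + (∑ i, |α i|) * ‖y‖) := by gcongr
      _ = _ := by field_simp

/-- The integrand after translating the contour and rescaling, with `t = 1 / s`. -/
def blowupIntegrand (A : Configuration n) (ξ : Fin n → ℝ) (p : MvPolynomial (Fin n) ℂ) (t : ℝ)
    (y : Fin n → ℝ) : ℂ :=
  (∑ i ∈ Finset.range (A.totalMult + 1), ((t : ℂ) ^ 2) ^ (A.totalMult - i) *
    eval (blowup ξ t y) (homogeneousComponent i p)) * (A.Am (blowup ξ t y))⁻¹ ^ 2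

theorem tame_blowupIntegrand (hξ : ∀ α ∈ A.vectors, ξ ⬝ᵥ α ≠ 0) :
    Tame (Set.Icc (0 : ℝ) 1) (blowupIntegrand A ξ p) := by
  have h1 : Tame (Set.Icc (0 : ℝ) 1) fun t (_ : Fin n → ℝ) => (t : ℂ) :=
    Tame.of_norm_le (c := 1) (fun _ _ => continuous_const) fun t ht _ => by
      rw [Complex.norm_real, Real.norm_of_nonneg ht.1]
      exact ht.2
  exact (Tame.sum fun i _ => ((h1.pow 2).pow _).mul
    (Tame.eval (fun j => (h1.mul (Tame.shift ξ j)).add (Tame.const _)) _)).mul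
      ((tame_Am_blowup_inv hξ).pow 2)

theorem continuousOn_blowupIntegrand (hξ : ∀ α ∈ A.vectors, ξ ⬝ᵥ α ≠ 0) (y : Fin n → ℝ) :
    ContinuousOn (fun t => blowupIntegrand A ξ p t y) (Set.Icc 0 1) := by
  have hev : ∀ q : MvPolynomial (Fin n) ℂ, Continuous fun t => eval (blowup ξ t y) q :=
    fun q => (MvPolynomial.continuous_eval q).comp (continuous_blowup_left y)
  have hAm : Continuous fun t => A.Am (blowup ξ t y) := by
    simpa only [A.eval_AmPoly] using hev A.AmPoly
  refine ContinuousOn.mul (Continuous.continuousOn ?_) ((hAm.continuousOn.inv₀ ?_).pow 2)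
  · exact continuous_finsetSum _ fun i _ =>
      ((Complex.continuous_ofReal.pow 2).pow _).mul (hev _)
  · intro t ht
    exact Finset.prod_ne_zero_iff.2 fun α hα =>
      pow_ne_zero _ (blowup_dotProduct_ne_zero ht.1 (hξ α hα) y)

theorem blowupIntegrand_zero (hξ : ∀ α ∈ A.vectors, ξ ⬝ᵥ α ≠ 0)
    (hp : homogeneousComponent A.totalMult p = C (A.Am (toComplex ξ)) * A.AmPoly)
    (y : Fin n → ℝ) : blowupIntegrand A ξ p 0 y = 1 := by
  have hne := Am_toComplex_ne_zero hξ
  rw [blowupIntegrand, Finset.sum_range_succ, Finset.sum_eq_zero, hp, blowup_zero]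
  · rw [map_mul, eval_C, A.eval_AmPoly]
    simp only [Nat.sub_self, pow_zero]
    field_simp
    simp
  · intro i hi
    have : A.totalMult - i ≠ 0 := by
      have := Finset.mem_range.1 hi
      omega
    simp [this]

theorem tendsto_integral_blowupIntegrand (hξ : ∀ α ∈ A.vectors, ξ ⬝ᵥ α ≠ 0)
    (hp : homogeneousComponent A.totalMult p = C (A.Am (toComplex ξ)) * A.AmPoly) :
    Tendsto (fun t => ∫ y, blowupIntegrand A ξ p t y * gaussianDensity (shift ξ y))
      (𝓝[>] 0) (𝓝 1) := by
  have hT := tame_blowupIntegrand (A := A) (p := p) hξ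
  obtain ⟨c, k, hc, hk, hb⟩ := hT.bound
  have hev : ∀ᶠ t : ℝ in 𝓝[>] 0, t ∈ Set.Icc (0 : ℝ) 1 :=
    mem_of_superset (Ioc_mem_nhdsGT one_pos) Set.Ioc_subset_Icc_self
  rw [← integral_gaussianDensity ξ]
  refine tendsto_integral_filter_of_dominated_convergence
    (fun y => c * (Real.exp (k * ‖y‖) * ‖gaussianDensity (shift ξ y)‖)) ?_ ?_
    ((integrable_exp_mul_norm_gaussianDensity ξ k).const_mul c) (ae_of_all _ fun y => ?_)
  · filter_upwards [hev] with t ht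
    exact (hT.integrable ht).aestronglyMeasurable
  · filter_upwards [hev] with t ht
    refine ae_of_all _ fun y => ?_
    rw [norm_mul, ← mul_assoc]
    exact mul_le_mul_of_nonneg_right (hb t ht y) (norm_nonneg _)
  · have h1 := (continuousOn_blowupIntegrand (p := p) hξ y) 0 (by simp)
    rw [ContinuousWithinAt, blowupIntegrand_zero hξ hp] at h1
    have h2 := (h1.mono_left (le_inf nhdsWithin_le_nhds (le_principal_iff.2 hev))).mul_const
      (gaussianDensity (shift ξ y))
    rwa [one_mul] at h2

theorem integral_scaledExp_eq (hd : p.totalDegree ≤ A.totalMult) {s : ℝ} (hs : s ≠ 0) :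
    ∫ y, scaledExp ξ p s y * (A.Am (shift ξ y))⁻¹ ^ 2 * gaussianDensity (shift ξ y) =
      Complex.exp ((s : ℂ) ^ 2 * ((ξ ⬝ᵥ ξ : ℝ) : ℂ) / 2) *
        ∫ y, blowupIntegrand A ξ p s⁻¹ y * gaussianDensity (shift ξ y) := by
  -- The real translation by `s ξ` completes the square in the exponent and turns `z` into `s (z / s
  -- + ξ)`. The part of `p` of degree `i` then scales by `s^(2i)` and `A_m²` by `s^(2|m|)`, whence
  -- the powers `t^(2(|m| - i))` with `t = 1 / s`.
  rw [← integral_add_right_eq_self _ (s • ξ), ← integral_const_mul]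
  refine integral_congr_ae (ae_of_all _ fun y => ?_)
  have hs' : (s : ℂ) ≠ 0 := by exact_mod_cast hs
  have hz : shift ξ (y + s • ξ) = (s : ℂ) • blowup ξ s⁻¹ y := by
    funext i
    simp only [shift_apply, blowup, Pi.add_apply, Pi.smul_apply, smul_eq_mul, toComplex]
    push_cast
    field_simp
    ring
  have hz' : shift ξ (y + s • ξ) = shift ξ y + (s : ℂ) • toComplex ξ := by
    rw [hz, blowup, smul_add, smul_smul]
    push_cast
    rw [mul_inv_cancel₀ hs', one_smul]
  have hA : A.Am (shift ξ (y + s • ξ)) = (s : ℂ) ^ A.totalMult * A.Am (blowup ξ s⁻¹ y) := by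
    rw [hz, ← A.eval_AmPoly, eval_smul_of_isHomogeneous A.isHomogeneous_AmPoly, A.eval_AmPoly]
  have hev : eval ((s : ℂ) • shift ξ (y + s • ξ)) p = ((s : ℂ) ^ 2) ^ A.totalMult *
      ∑ i ∈ Finset.range (A.totalMult + 1), (((s⁻¹ : ℝ) : ℂ) ^ 2) ^ (A.totalMult - i) *
        eval (blowup ξ s⁻¹ y) (homogeneousComponent i p) := by
    rw [hz, smul_smul, ← sq, eval_smul_eq_sum p _ _ hd, Finset.mul_sum]
    refine Finset.sum_congr rfl fun i hi => ?_
    have hi' : i ≤ A.totalMult := Nat.lt_succ_iff.1 (Finset.mem_range.1 hi)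
    rw [← mul_assoc]
    congr 1
    push_cast
    rw [inv_pow, inv_pow, ← pow_sub₀ _ (pow_ne_zero 2 hs') (Nat.sub_le _ _),
      Nat.sub_sub_self hi']
  have hexp : Complex.exp (((s : ℂ) • shift ξ (y + s • ξ)) ⬝ᵥ toComplex ξ) *
      gaussianDensity (shift ξ (y + s • ξ)) =
      Complex.exp ((s : ℂ) ^ 2 * ((ξ ⬝ᵥ ξ : ℝ) : ℂ) / 2) * gaussianDensity (shift ξ y) := by
    rw [hz', gaussianDensity, gaussianDensity, mul_left_comm, mul_left_comm (Complex.exp _),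
      ← Complex.exp_add, ← Complex.exp_add]
    congr 2
    simp only [smul_dotProduct, add_dotProduct, dotProduct_add, dotProduct_smul, smul_eq_mul,
      toComplex_dotProduct, dotProduct_comm (toComplex ξ) (shift ξ y)]
    ring
  change scaledExp ξ p s (y + s • ξ) * (A.Am (shift ξ (y + s • ξ)))⁻¹ ^ 2 *
    gaussianDensity (shift ξ (y + s • ξ)) = _
  rw [scaledExp, mul_right_comm, mul_assoc (eval _ _), hexp, hev, hA]
  have h1 : ((s : ℂ) ^ 2) ^ A.totalMult * ((s : ℂ) ^ A.totalMult)⁻¹ ^ 2 = 1 := by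
    rw [inv_pow, ← pow_mul, ← pow_mul, mul_comm 2, mul_inv_cancel₀ (pow_ne_zero _ hs')]
  rw [mul_inv, mul_pow]
  simp only [blowupIntegrand]
  linear_combination (Complex.exp ((s : ℂ) ^ 2 * ((ξ ⬝ᵥ ξ : ℝ) : ℂ) / 2) *
    gaussianDensity (shift ξ y) * (∑ i ∈ Finset.range (A.totalMult + 1),
      (((s⁻¹ : ℝ) : ℂ) ^ 2) ^ (A.totalMult - i) *
        eval (blowup ξ s⁻¹ y) (homogeneousComponent i p)) * (A.Am (blowup ξ s⁻¹ y))⁻¹ ^ 2) * h1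

/-- A solution of the radial equation `J'(s) = s ξ² J(s)` that grows like `exp (s² ξ² / 2)` has
`J(0) = 1`. -/
theorem eq_one_of_radial_equation {J J' L : ℝ → ℂ} {a : ℂ} (hJ : ∀ s, HasDerivAt J (J' s) s)
    (hJ' : ∀ s, s ≠ 0 → J' s = s * a * J s)
    (hL : ∀ s, s ≠ 0 → J s = Complex.exp ((s : ℂ) ^ 2 * a / 2) * L s⁻¹)
    (hlim : Tendsto L (𝓝[>] 0) (𝓝 1)) : J 0 = 1 := by
  let K : ℝ → ℂ := fun s => Complex.exp (-((s : ℂ) ^ 2 * a / 2)) * J s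
  have hK : ∀ s : ℝ, HasDerivAt K (Complex.exp (-((s : ℂ) ^ 2 * a / 2)) * (J' s - s * a * J s)) s := by
    intro s
    have h1 : HasDerivAt (fun s : ℝ => -((s : ℂ) ^ 2 * a / 2)) (-((s : ℂ) * a)) s := by
      have := ((((Complex.ofRealCLM.hasDerivAt (x := s)).pow 2).mul_const a).div_const 2).neg
      refine this.congr_deriv ?_
      simp
      ring
    refine (h1.cexp.mul (hJ s)).congr_deriv ?_
    ring
  have hK0 : ∀ s ∈ Set.Ioi (0 : ℝ), deriv K s = 0 := by
    intro s hs
    rw [(hK s).deriv, hJ' s (ne_of_gt hs), sub_self, mul_zero]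
  -- The equation is available only for `s ≠ 0`, so `K` is constant on the positive axis; its value
  -- comes from `s → ∞` through `L`, and continuity carries it to `s = 0`.
  have hconst : ∀ s ∈ Set.Ioi (0 : ℝ), K s = K 1 := fun s hs =>
    isOpen_Ioi.is_const_of_deriv_eq_zero isPreconnected_Ioi
      (fun s _ => (hK s).differentiableAt.differentiableWithinAt) hK0 hs (Set.mem_Ioi.2 one_pos)
  have hL1 : ∀ t ∈ Set.Ioi (0 : ℝ), L t = K 1 := by
    intro t ht
    rw [← hconst t⁻¹ (Set.mem_Ioi.2 (inv_pos.2 (Set.mem_Ioi.1 ht)))]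
    simp only [K]
    rw [hL t⁻¹ (inv_ne_zero (ne_of_gt ht)), ← mul_assoc, ← Complex.exp_add, neg_add_cancel,
      Complex.exp_zero, one_mul, inv_inv]
  have h1 : K 1 = 1 := tendsto_nhds_unique
    (tendsto_const_nhds.congr' (eventually_nhdsWithin_of_forall fun t ht => (hL1 t ht).symm)) hlim
  have h2 : K 0 = K 1 := tendsto_nhds_unique
    ((hK 0).continuousAt.tendsto.mono_left (nhdsWithin_le_nhds (s := Set.Ioi 0)))
    (tendsto_const_nhds.congr' (eventually_nhdsWithin_of_forall fun t ht => (hconst t ht).symm))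
  rw [h1] at h2
  simpa [K] using h2

end Limit

end BakerAkhiezer

end

theorem mainTheorem2 {n : ℕ} (A : BakerAkhiezer.Configuration n)
    (φ : (Fin n → ℂ) → (Fin n → ℂ) → ℂ) (hφ : BakerAkhiezer.IsBakerAkhiezer A φ)
    (h0 : φ 0 0 ≠ 0) (ξ : Fin n → ℝ) (hξ : ∀ α ∈ A.vectors, ξ ⬝ᵥ α ≠ 0) :
    BakerAkhiezer.GaussianIntegrable ξ (fun x => 1 / A.Am x ^ 2) ∧
      φ 0 0 = (BakerAkhiezer.gaussianIntegral ξ (fun x => 1 / A.Am x ^ 2))⁻¹ := by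
  have hinv : ∀ x, 1 / A.Am x ^ 2 = (A.Am x)⁻¹ ^ 2 := fun x => by rw [one_div, inv_pow]
  simp only [BakerAkhiezer.GaussianIntegrable, BakerAkhiezer.gaussianIntegral, hinv]
  refine ⟨((BakerAkhiezer.tame_Am_shift_inv Set.univ hξ).pow 2).integrable (Set.mem_univ ()), ?_⟩
  obtain ⟨p, hd, hp, hp0, heq⟩ := hφ.exists_poly h0 (BakerAkhiezer.toComplex ξ)
  have h := BakerAkhiezer.eq_one_of_radial_equation
    (BakerAkhiezer.hasDerivAt_integral_scaledExp hξ p)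
    (fun s hs => BakerAkhiezer.integral_euler_scaledExp hξ heq hs)
    (fun s hs => BakerAkhiezer.integral_scaledExp_eq hd hs)
    (BakerAkhiezer.tendsto_integral_blowupIntegrand hξ hp)
  -- At `s = 0` the factor `φ(s z, ξ)` is the constant `p(0) = φ(0, 0)`, which leaves the integral.
  simp only [BakerAkhiezer.scaledExp, Complex.ofReal_zero, zero_smul, zero_dotProduct,
    Complex.exp_zero, mul_one, hp0, mul_assoc] at h
  rw [integral_const_mul] at h
  exact eq_inv_of_mul_eq_one_left h
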